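/- **Setting.** Let $M$ be a compact oriented smooth 3-manifold with boundary, $\kappa$ a constant, and $B=B_0\oplus B_1$ a supercommutative Banach algebra over $\mathbb C$ (closed even and odd parts; even elements central, odd elements anticommuting; e.g. a Grassmann algebra). Differential forms on $M$ have values in $B$; the wedge product uses the product of $B$, and constants of $B$ commute with coordinate differentials. The fields are smooth: even 1-forms $e^a$, $\omega^{ab}=-\omega^{ba}$, odd spinor 1-forms $\psi_\alpha$, even functions $\phi^a$, odd spinor functions $\chi_\alpha$ ($a,b=1,2,3$; $\alpha=1,2$). **Conventions.** $\eta=\mathrm{diag}(-1,1,1)$, $\epsilon_{123}=1$; $\Gamma_1=\begin{pmatrix}0&1\\-1&0\end{pmatrix}$, $\Gamma_2=\begin{pmatrix}0&1\\1&0\end{pmatrix}$, $\Gamma_3=\begin{pmatrix}1&0\\0&-1\end{pmatrix}$, $\Gamma_{ab}=\tfrac12[\Gamma_a,\Gamma_b]$; $\bar\psi=\psi^{\top}\mathcal C$ with $\mathcal C=-i\Gamma_1$, $(\mathcal C_{\alpha\beta})=\mathcal C^{-1}$, and $(\Gamma^a)_{\alpha\beta}=(\Gamma^a(\mathcal C^{-1})^{\top})_{\alpha\beta}$,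 so that $\bar\chi\Gamma^a\psi=\bar\chi^\alpha(\Gamma^a)_{\alpha\beta}\bar\psi^\beta$. Put $D_\omega\phi^a=d\phi^a+\omega^a{}_b\phi^b$, $D_\omega\psi=d\psi+\tfrac14\omega^{ab}\wedge\Gamma_{ab}\psi$ (likewise for $\chi$), $R^{ab}=d\omega^{ab}+\omega^a{}_c\wedge\omega^{cb}$. The $\mathcal N=1$ super-Poincaré algebra in three dimensions has even generators $J_{ab}$, $P_a$ and odd generators $Q_\alpha$, with nonzero brackets $$[J_{ab},J_{cd}]=\eta_{bc}J_{ad}+\eta_{ad}J_{bc}-\eta_{bd}J_{ac}-\eta_{ac}J_{bd},\qquad [J_{ab},P_c]=\eta_{bc}P_a-\eta_{ac}P_b,$$ $$[Q_\alpha,J_{ab}]=\tfrac12(\Gamma_{ab})_\alpha{}^\beta Q_\beta,\qquad \{Q_\alpha,Q_\beta\}=-\tfrac i2(\Gamma^a)_{\alpha\beta}P_a,$$ and invariant form $\langle J_{ab}P_c\rangle=\epsilon_{abc}$, $\langle Q_\alpha Q_\beta\rangle=-i\,\mathcal C_{\alpha\beta}$ (other components zero). It is realized by supermatrices of format $4|2$.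 Odd coefficients anticommute with the $Q_\alpha$, so $(qQ_\alpha)(q'Q_\beta)=-qq'\,Q_\alpha Q_\beta$ and $\langle qQ_\alpha,q'Q_\beta\rangle=-qq'\langle Q_\alpha Q_\beta\rangle$. For gauge potentials $\mathcal A,\bar{\mathcal A}$ with values in this algebra put $\Theta=\mathcal A-\bar{\mathcal A}$, $\mathcal A_t=\bar{\mathcal A}+t\Theta$, $\mathcal F_t=d\mathcal A_t+\mathcal A_t\wedge\mathcal A_t$, $$T_{\mathcal A\leftarrow\bar{\mathcal A}}=2\int_0^1dt\,\langle\Theta\wedge\mathcal F_t\rangle,\qquad \mathscr L_{CS}(\mathcal A)=\kappa\,T_{\mathcal A\leftarrow0},\qquad \mathscr B(\mathcal A,\bar{\mathcal A})=2\int_0^1dt\int_0^tds\,\langle(\mathcal A-\bar{\mathcal A})\wedge\bar{\mathcal A}\rangle,$$ and $S_T[\mathcal A,\bar{\mathcal A}]=\kappa\int_M T_{\mathcal A\leftarrow\bar{\mathcal A}}$. **Statement.** Let $\mathcal A=e^aP_a+\tfrac12\omega^{ab}J_{ab}+\bar\psi Q$ and let $\bar{\mathcal A}=g^{-1}\mathcal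 Ag+g^{-1}dg$ with the coset element $g=e^{-\bar\chi Q}e^{-\phi^aP_a}$. Then: 1. $\displaystyle\int_M\mathscr L_{CS}(\mathcal A)=\kappa\int_M\big(\epsilon_{abc}R^{ab}\wedge e^c-i\,\bar\psi\wedge D_\omega\psi\big)-\frac\kappa2\int_{\partial M}\epsilon_{abc}\,\omega^{ab}\wedge e^c$ (three-dimensional $\mathcal N=1$ Poincaré supergravity). 2. $\bar{\mathcal A}=V^aP_a+\tfrac12W^{ab}J_{ab}+\bar\Psi Q$ with $$V^a=e^a-D_\omega\phi^a+\tfrac i2\,\bar\chi\Gamma^a\psi-\tfrac i4\,\bar\chi\Gamma^aD_\omega\chi,\qquad W^{ab}=\omega^{ab},\qquad \Psi=\psi-D_\omega\chi.$$ 3. $\displaystyle S_T[\mathcal A,\bar{\mathcal A}]=\int_M\mathscr L_{CS}(\mathcal A)-\int_M\mathscr L_{CS}(\bar{\mathcal A})-\kappa\int_{\partial M}\mathscr B(\mathcal A,\bar{\mathcal A}).$ 4. The transgression action collapses to the boundary action of two-dimensional topological supergravity: $$S_T[\mathcal A,\bar{\mathcal A}]=\kappa\int_{\partial M}\big(\epsilon_{abc}R^{ab}\phi^c-2i\,\bar\psi\wedge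 D_\omega\chi\big).$$ -/

import Mathlib

open scoped Manifold ContDiff

noncomputable section

namespace TopSugra

/-! ### Differential forms on a 3-manifold with boundary, with values in an algebra `B` -/

/-- The model vector space of a 3-manifold. -/
abbrev E3 : Type := EuclideanSpace ℝ (Fin 3)

/-- `B`-valued `k`-forms on `M` (not necessarily smooth). The tangent space
`TangentSpace (𝓡∂ 3) x` of Mathlib is by definition the type `E3`. -/
abbrev DForm (M : Type*) (B : Type*) [NormedRing B] [NormedAlgebra ℂ B] (k : ℕ) :=
  M → E3 [⋀^Fin k]→L[ℝ] B

section Forms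

variable {M : Type*} [TopologicalSpace M] [ChartedSpace (EuclideanHalfSpace 3) M]
variable {B : Type*} [NormedRing B] [NormedAlgebra ℂ B] {k : ℕ}

/-- The coordinate expression of a form in the chart `c`: its pull-back along the inverse of `c`. -/
def chartRep (c : OpenPartialHomeomorph M (EuclideanHalfSpace 3)) (α : DForm M B k) :
    E3 → E3 [⋀^Fin k]→L[ℝ] B := fun y =>
  (α ((c.extend (𝓡∂ 3)).symm y)).compContinuousLinearMap
    (mfderivWithin 𝓘(ℝ, E3) (𝓡∂ 3) (c.extend (𝓡∂ 3)).symm (Set.range (𝓡∂ 3)) y)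

/-- A form is smooth if its coordinate expression in every smooth chart is smooth
(up to the boundary). -/
def IsSmoothForm (α : DForm M B k) : Prop :=
  ∀ c ∈ IsManifold.maximalAtlas (𝓡∂ 3) ∞ M,
    ContDiffOn ℝ ∞ (chartRep c α) (c.extend (𝓡∂ 3)).target

/-- The exterior derivative of a form, computed at `x` in the preferred chart at `x`. -/
def extD (α : DForm M B k) : DForm M B (k + 1) := fun x =>
  (extDerivWithin (chartRep (chartAt (EuclideanHalfSpace 3) x) α) (Set.range (𝓡∂ 3))
    (extChartAt (𝓡∂ 3) x x)).compContinuousLinearMap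
      (mfderiv (𝓡∂ 3) 𝓘(ℝ, E3) (extChartAt (𝓡∂ 3) x) x)

/-- The differential of a `B`-valued function, as a 1-form. -/
def dFun (f : M → B) : DForm M B 1 := fun x =>
  ContinuousAlternatingMap.ofSubsingleton ℝ E3 B (0 : Fin 1)
    (mfderiv (𝓡∂ 3) 𝓘(ℝ, B) f x)

/-- Left multiplication of a form by a function, `f α`. -/
def lmul (f : M → B) (α : DForm M B k) : DForm M B k := fun x =>
  (ContinuousLinearMap.mul ℝ B (f x)).compContinuousAlternatingMap (α x)

/-- Right multiplication of a form by a function, `α f`. -/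
def rmul (α : DForm M B k) (f : M → B) : DForm M B k := fun x =>
  ((ContinuousLinearMap.mul ℝ B).flip (f x)).compContinuousAlternatingMap (α x)

/-- The wedge product of a 1-form with a `k`-form, by means of the product of `B`:
`(α ∧ β) (v₀, …, v_k) = ∑ i, (-1) ^ i * α (v_i) * β (v₀, …, v̂_i, …, v_k)`. -/
def wedge (α : DForm M B 1) (β : DForm M B k) : DForm M B (k + 1) := fun x =>
  ContinuousAlternatingMap.alternatizeUncurryFin
    (((ContinuousLinearMap.compContinuousAlternatingMapCLM ℝ E3 B B (Fin k)).flip (β x)).comp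
      ((ContinuousLinearMap.mul ℝ B).comp
        ((ContinuousAlternatingMap.ofSubsingleton ℝ E3 B (0 : Fin 1)).symm (α x))))

end Forms

/-! ### Integration over an oriented compact 3-manifold and over its boundary -/

/-- A finite oriented atlas of smooth charts of `M`, together with a smooth partition of unity
subordinate to it: the data by which forms are integrated. -/
structure OrientedAtlas (M : Type*) [TopologicalSpace M]
    [ChartedSpace (EuclideanHalfSpace 3) M] where
  /-- the number of charts -/
  n : ℕ
  chart : Fin n → OpenPartialHomeomorph M (EuclideanHalfSpace 3)
  chart_mem : ∀ i, chart i ∈ IsManifold.maximalAtlas (𝓡∂ 3) ∞ M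
  /-- all changes of coordinates have a positive Jacobian determinant -/
  oriented : ∀ i j, ∀ x ∈ (chart i).source ∩ (chart j).source,
    0 < (fderivWithin ℝ ((chart j).extend (𝓡∂ 3) ∘ ((chart i).extend (𝓡∂ 3)).symm)
      (Set.range (𝓡∂ 3)) ((chart i).extend (𝓡∂ 3) x)).det
  ρ : SmoothPartitionOfUnity (Fin n) (𝓡∂ 3) M
  subordinate : ρ.IsSubordinate fun i => (chart i).source

section Integral

variable {M : Type*} [TopologicalSpace M] [ChartedSpace (EuclideanHalfSpace 3) M]
variable {B : Type*} [NormedRing B] [NormedAlgebra ℂ B]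

/-- The standard basis of the model space. -/
abbrev stdVec (j : Fin 3) : E3 := EuclideanSpace.single j (1 : ℝ)

/-- The integral of a 3-form over `M`: the sum over the charts of the Lebesgue integrals of the
coefficients of `dy⁰ ∧ dy¹ ∧ dy²` in the coordinate expressions of `ρ i • α`. -/
def integral (O : OrientedAtlas M) (α : DForm M B 3) : B :=
  ∑ i, ∫ y in ((O.chart i).extend (𝓡∂ 3)).target,
    O.ρ i (((O.chart i).extend (𝓡∂ 3)).symm y) •
      chartRep (O.chart i) α y ![stdVec 0, stdVec 1, stdVec 2]

/-- The inclusion of the boundary plane `y 0 = 0` of the half-space `0 ≤ y 0`. -/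
def bdryPt (z : EuclideanSpace ℝ (Fin 2)) : E3 := !₂[0, z 0, z 1]

/-- The integral of a 2-form over `∂M`, computed in the boundary charts that the atlas induces.
The minus sign is that of the induced orientation (outward normal first): the outward normal
is `-∂₀`, hence `(∂₁, ∂₂)` is a negatively oriented frame of the boundary. -/
def bdryIntegral (O : OrientedAtlas M) (α : DForm M B 2) : B :=
  -∑ i, ∫ z in {z : EuclideanSpace ℝ (Fin 2) | bdryPt z ∈ ((O.chart i).extend (𝓡∂ 3)).target},
    O.ρ i (((O.chart i).extend (𝓡∂ 3)).symm (bdryPt z)) •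
      chartRep (O.chart i) α (bdryPt z) ![stdVec 1, stdVec 2]

end Integral

/-! ### Supercommutative coefficients -/

/-- A Banach superalgebra `B = 𝒜 0 ⊕ 𝒜 1` is supercommutative if even elements are central
and odd elements anticommute; the even and the odd part are closed.
Grassmann algebras are the basic examples. -/
structure IsSupercommutative {B : Type*} [NormedRing B] [NormedAlgebra ℂ B]
    (𝒜 : ZMod 2 → Submodule ℂ B) : Prop where
  closed : ∀ i, IsClosed (𝒜 i : Set B)
  even_comm : ∀ a ∈ 𝒜 0, ∀ b : B, a * b = b * a
  odd_anticomm : ∀ a ∈ 𝒜 1, ∀ b ∈ 𝒜 1, a * b = -(b * a)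

/-! ### Conventions for Lorentz vectors and Majorana spinors in three dimensions -/

/-- The Minkowski metric `diag (-1, 1, 1)`. -/
def η (a b : Fin 3) : ℂ := Matrix.diagonal ![-1, 1, 1] a b

/-- The Levi-Civita symbol with `ε 0 1 2 = 1`. -/
def ε (a b c : Fin 3) : ℂ :=
  ((b.val : ℂ) - a.val) * ((c.val : ℂ) - a.val) * ((c.val : ℂ) - b.val) / 2

/-- The gamma matrices `Γ_a` (lower index) in the Majorana representation. -/
def Γ : Fin 3 → Matrix (Fin 2) (Fin 2) ℂ :=
  ![!![0, 1; -1, 0], !![0, 1; 1, 0], !![1, 0; 0, -1]]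

/-- `Γ^a = η^{ab} Γ_b`. -/
def Γup (a : Fin 3) : Matrix (Fin 2) (Fin 2) ℂ := ∑ b, η a b • Γ b

/-- `Γ_{ab} = ½ [Γ_a, Γ_b]`. -/
def Γ₂ (a b : Fin 3) : Matrix (Fin 2) (Fin 2) ℂ := (1 / 2 : ℂ) • (Γ a * Γ b - Γ b * Γ a)

/-- The charge conjugation matrix, `ψ̄ = ψᵀ C = -i ψᵀ Γ₀`, where `Γ₀` is the timelike
gamma matrix. -/
def chargeConj : Matrix (Fin 2) (Fin 2) ℂ := -Complex.I • Γ 0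

/-- `(Γ^a)_{αβ}`, with `χ̄ Γ^a ψ = χ̄^α (Γ^a)_{αβ} ψ̄^β`. -/
def Γlow (a : Fin 3) : Matrix (Fin 2) (Fin 2) ℂ := Γup a * (chargeConj⁻¹).transpose

/-- The Majorana conjugate of a spinor, `ψ̄^α = ψ_β C^{βα}`. -/
def bar {N : Type*} [AddCommGroup N] [Module ℂ N] (ψ : Fin 2 → N) : Fin 2 → N :=
  fun α => ∑ β, chargeConj β α • ψ β

/-! ### The super-Poincaré algebra, realized by supermatrices of format `4 | 2`

The basis consists of the vectors `e_a`, of the scalar `1` (even), and of the spinors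
`f_α` (odd). The nonzero (anti)commutators of the generators are
`[J_ab, J_cd] = η_bc J_ad + η_ad J_bc - η_bd J_ac - η_ac J_bd`,
`[J_ab, P_c] = η_bc P_a - η_ac P_b`, `[Q_α, J_ab] = ½ (Γ_ab)_α^β Q_β`,
`{Q_α, Q_β} = -(i/2) (Γ^a)_{αβ} P_a`. -/

abbrev Idx : Type := Fin 3 ⊕ Fin 1 ⊕ Fin 2

/-- Translations: `P_a 1 = e_a`. -/
def genP (a : Fin 3) : Matrix Idx Idx ℂ
  | .inl c, .inr (.inl _) => if c = a then 1 else 0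
  | _, _ => 0

/-- Lorentz rotations: `J_ab e_d = η_bd e_a - η_ad e_b`, `J_ab f_α = -½ (Γ_ab)_α^β f_β`. -/
def genJ (a b : Fin 3) : Matrix Idx Idx ℂ
  | .inl c, .inl d => (if c = a then η b d else 0) - (if c = b then η a d else 0)
  | .inr (.inr β), .inr (.inr α) => -(1 / 2) * Γ₂ a b α β
  | _, _ => 0

/-- Supercharges: `Q_α 1 = f_α`, `Q_α f_β = -(i/4) (Γ^a)_{αβ} e_a`. -/
def genQ (α : Fin 2) : Matrix Idx Idx ℂ
  | .inr (.inr β), .inr (.inl _) => if β = α then 1 else 0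
  | .inl a, .inr (.inr β) => -(Complex.I / 4) * Γlow a α β
  | _, _ => 0

/-- `-1` on the odd rows, `1` on the even rows. -/
def rowSign : Idx → ℂ
  | .inr (.inr _) => -1
  | _ => 1

/-- The element `p^a P_a + ½ j^{ab} J_ab + q^α Q_α`, with even coefficients `p`, `j` and odd
coefficients `q`; as for all supermatrices, an odd scalar on the left acts on the odd rows with
a minus sign, so that `(q Q_α) (q' Q_β) = -q q' Q_α Q_β`. -/
def superElt {N : Type*} [AddCommGroup N] [Module ℂ N]
    (p : Fin 3 → N) (j : Fin 3 → Fin 3 → N) (q : Fin 2 → N) : Matrix Idx Idx N := fun r s =>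
  ∑ a, genP a r s • p a + (1 / 2 : ℂ) • ∑ a, ∑ b, genJ a b r s • j a b
    + ∑ α, (rowSign r * genQ α r s) • q α

/-- The component `p^a` of `p^a P_a + ½ j^{ab} J_ab + q^α Q_α`. -/
def compP {N : Type*} (Z : Matrix Idx Idx N) (a : Fin 3) : N := Z (.inl a) (.inr (.inl 0))

/-- The component `j^{ab}` of `p^a P_a + ½ j^{ab} J_ab + q^α Q_α`, for antisymmetric `j`. -/
def compJ {N : Type*} [AddCommGroup N] [Module ℂ N] (Z : Matrix Idx Idx N) (a b : Fin 3) : N :=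
  ∑ d, η d b • Z (.inl a) (.inl d)

/-- The component `q^α` of `p^a P_a + ½ j^{ab} J_ab + q^α Q_α`. -/
def compQ {N : Type*} [AddCommGroup N] (Z : Matrix Idx Idx N) (α : Fin 2) : N :=
  -Z (.inr (.inr α)) (.inr (.inl 0))

section Gauge

variable {M : Type*} [TopologicalSpace M] [ChartedSpace (EuclideanHalfSpace 3) M]
variable {B : Type*} [NormedRing B] [NormedAlgebra ℂ B] {k : ℕ}

/-! ### Gauge theory with supermatrix-valued forms -/

/-- The exterior derivative of a matrix of forms. -/
def matD (Z : Matrix Idx Idx (DForm M B k)) : Matrix Idx Idx (DForm M B (k + 1)) := Z.map extD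

/-- The wedge product of a matrix of 1-forms with a matrix of `k`-forms. -/
def matWedge (Z : Matrix Idx Idx (DForm M B 1)) (Y : Matrix Idx Idx (DForm M B k)) :
    Matrix Idx Idx (DForm M B (k + 1)) := fun r s => ∑ t, wedge (Z r t) (Y t s)

/-- The curvature `F = dA + A ∧ A`. -/
def curvature (A : Matrix Idx Idx (DForm M B 1)) : Matrix Idx Idx (DForm M B 2) :=
  matD A + matWedge A A

/-- The gauge transform `g⁻¹ A g + g⁻¹ dg` of a gauge potential by a group-valued function. -/
def gaugeTransform (g : M → Matrix Idx Idx B) (A : Matrix Idx Idx (DForm M B 1)) :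
    Matrix Idx Idx (DForm M B 1) := fun r s =>
  (∑ t, ∑ u, lmul (fun x => Ring.inverse (g x) r t) (rmul (A t u) (fun x => g x u s)))
    + ∑ t, lmul (fun x => Ring.inverse (g x) r t) (dFun fun x => g x t s)

/-- The invariant bilinear form `⟨Z ∧ Y⟩` whose only nonzero components are
`⟨J_ab P_c⟩ = ⟨P_c J_ab⟩ = ε_abc` and `⟨Q_α Q_β⟩ = -i C_{αβ}`, `(C_{αβ}) = C⁻¹`.
The minus sign of the last summand comes from moving the odd coefficient of the second factor
past the generator in the first one. -/
def pairing (Z : Matrix Idx Idx (DForm M B 1)) (Y : Matrix Idx Idx (DForm M B k)) :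
    DForm M B (k + 1) :=
  (∑ a, ∑ b, ∑ c, (1 / 2 * ε a b c) •
      (wedge (compJ Z a b) (compP Y c) + wedge (compP Z c) (compJ Y a b)))
    - ∑ α, ∑ β, (-Complex.I * chargeConj⁻¹ α β) • wedge (compQ Z α) (compQ Y β)

/-- The transgression 3-form `T_{A ← A'} = 2 ∫₀¹ ⟨Θ ∧ F_t⟩ dt`, where `Θ = A - A'` and
`F_t` is the curvature of `A_t = A' + t Θ`. -/
def transgression (A A' : Matrix Idx Idx (DForm M B 1)) : DForm M B 3 := fun x =>
  (2 : ℝ) • ∫ t in (0 : ℝ)..1, pairing (A - A') (curvature (A' + t • (A - A'))) x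

/-- The Chern–Simons form `T_{A ← 0}`. -/
def chernSimons (A : Matrix Idx Idx (DForm M B 1)) : DForm M B 3 := transgression A 0

/-- The boundary form `Q_{A ← A' ← 0} = 2 ∫₀¹ dt ∫₀ᵗ ds ⟨(A - A') ∧ A'⟩`. -/
def boundaryForm (A A' : Matrix Idx Idx (DForm M B 1)) : DForm M B 2 := fun x =>
  (2 : ℝ) • ∫ t in (0 : ℝ)..1, ∫ _s in (0 : ℝ)..t, pairing (A - A') A' x

/-- The transgression action `κ ∫_M T_{A ← A'}`. -/
def transgressionAction (O : OrientedAtlas M) (κ : ℂ) (A A' : Matrix Idx Idx (DForm M B 1)) : B :=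
  integral O (κ • transgression A A')

/-! ### Lorentz covariant derivatives -/

/-- `D_ω φ^a = dφ^a + ω^a_b φ^b`. -/
def covDVec (w : Fin 3 → Fin 3 → DForm M B 1) (φ : Fin 3 → M → B) (a : Fin 3) : DForm M B 1 :=
  dFun (φ a) + ∑ b, ∑ c, η c b • rmul (w a c) (φ b)

/-- `D_ω χ = dχ + ¼ ω^{ab} Γ_ab χ` for a spinor-valued function. -/
def covDSpinor (w : Fin 3 → Fin 3 → DForm M B 1) (χ : Fin 2 → M → B) (α : Fin 2) : DForm M B 1 :=
  dFun (χ α) + (1 / 4 : ℂ) • ∑ a, ∑ b, ∑ β, Γ₂ a b α β • rmul (w a b) (χ β)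

/-- `D_ω ψ = dψ + ¼ ω^{ab} ∧ Γ_ab ψ` for a spinor-valued 1-form. -/
def covDSpinorForm (w : Fin 3 → Fin 3 → DForm M B 1) (ψ : Fin 2 → DForm M B 1) (α : Fin 2) :
    DForm M B 2 :=
  extD (ψ α) + (1 / 4 : ℂ) • ∑ a, ∑ b, ∑ β, Γ₂ a b α β • wedge (w a b) (ψ β)

/-- The Lorentz curvature `R^{ab} = dω^{ab} + ω^a_c ∧ ω^{cb}`. -/
def lorentzCurv (w : Fin 3 → Fin 3 → DForm M B 1) (a b : Fin 3) : DForm M B 2 :=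
  extD (w a b) + ∑ c, ∑ d, η d c • wedge (w a d) (w c b)

end Gauge

/-! ### The fields -/

/-- The fields of the theory on `M`: the dreibein `e`, the spin connection `w` (written `ω` in the
formulas), the gravitino `ψ`, and the coset fields `φ` (even vector) and `χ` (odd spinor). -/
structure Fields (M : Type*) [TopologicalSpace M] [ChartedSpace (EuclideanHalfSpace 3) M]
    {B : Type*} [NormedRing B] [NormedAlgebra ℂ B] (𝒜 : ZMod 2 → Submodule ℂ B) where
  e : Fin 3 → DForm M B 1
  w : Fin 3 → Fin 3 → DForm M B 1
  ψ : Fin 2 → DForm M B 1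
  φ : Fin 3 → M → B
  χ : Fin 2 → M → B
  smooth_e : ∀ a, IsSmoothForm (e a)
  smooth_w : ∀ a b, IsSmoothForm (w a b)
  smooth_ψ : ∀ α, IsSmoothForm (ψ α)
  smooth_φ : ∀ a, ContMDiff (𝓡∂ 3) 𝓘(ℝ, B) ∞ (φ a)
  smooth_χ : ∀ α, ContMDiff (𝓡∂ 3) 𝓘(ℝ, B) ∞ (χ α)
  even_e : ∀ a x v, e a x v ∈ 𝒜 0
  even_w : ∀ a b x v, w a b x v ∈ 𝒜 0
  odd_ψ : ∀ α x v, ψ α x v ∈ 𝒜 1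
  even_φ : ∀ a x, φ a x ∈ 𝒜 0
  odd_χ : ∀ α x, χ α x ∈ 𝒜 1
  antisymm_w : ∀ a b, w a b = -w b a

namespace Fields

variable {M : Type*} [TopologicalSpace M] [ChartedSpace (EuclideanHalfSpace 3) M]
variable {B : Type*} [NormedRing B] [NormedAlgebra ℂ B] {𝒜 : ZMod 2 → Submodule ℂ B}

/-- The linear gauge potential `A = e^a P_a + ½ ω^{ab} J_ab + ψ̄ Q`. -/
def gaugePotential (Φ : Fields M 𝒜) : Matrix Idx Idx (DForm M B 1) :=
  superElt Φ.e Φ.w (bar Φ.ψ)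

/-- The coset element `g = exp (-χ̄ Q) exp (-φ^a P_a)`. -/
def coset (Φ : Fields M 𝒜) (x : M) : Matrix Idx Idx B :=
  NormedSpace.exp (-superElt (fun _ => (0 : B)) (fun _ _ => 0) (bar fun α => Φ.χ α x)) *
    NormedSpace.exp (-superElt (fun a => Φ.φ a x) (fun _ _ => (0 : B)) (fun _ => 0))

/-- The nonlinear gauge potential `g⁻¹ A g + g⁻¹ dg`. -/
def nonlinearPotential (Φ : Fields M 𝒜) : Matrix Idx Idx (DForm M B 1) :=
  gaugeTransform Φ.coset Φ.gaugePotential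

/-- `V^a = e^a - D_ω φ^a + (i/2) χ̄ Γ^a ψ - (i/4) χ̄ Γ^a D_ω χ`. -/
def V (Φ : Fields M 𝒜) (a : Fin 3) : DForm M B 1 :=
  Φ.e a - covDVec Φ.w Φ.φ a
    + (Complex.I / 2) • ∑ α, ∑ β, Γup a α β • lmul (bar Φ.χ α) (Φ.ψ β)
    - (Complex.I / 4) • ∑ α, ∑ β, Γup a α β • lmul (bar Φ.χ α) (covDSpinor Φ.w Φ.χ β)

/-- `W^{ab} = ω^{ab}`. -/
def W (Φ : Fields M 𝒜) : Fin 3 → Fin 3 → DForm M B 1 := Φ.w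

/-- `Ψ = ψ - D_ω χ`. -/
def Ψ (Φ : Fields M 𝒜) (α : Fin 2) : DForm M B 1 := Φ.ψ α - covDSpinor Φ.w Φ.χ α

/-- The Lagrangian `ε_abc R^{ab} φ^c - 2 i ψ̄ ∧ D_ω χ` of two-dimensional topological
supergravity. -/
def topologicalLagrangian (Φ : Fields M 𝒜) : DForm M B 2 :=
  (∑ a, ∑ b, ∑ c, ε a b c • rmul (lorentzCurv Φ.w a b) (Φ.φ c))
    - (2 * Complex.I) • ∑ α, wedge (bar Φ.ψ α) (covDSpinor Φ.w Φ.χ α)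

/-- The bulk Lagrangian `ε_abc e^c ∧ R^{ab} - i ψ̄ ∧ D_ω ψ` of three-dimensional supergravity;
`e^c ∧ R^{ab} = R^{ab} ∧ e^c`, as both factors are even. -/
def supergravityLagrangian (Φ : Fields M 𝒜) : DForm M B 3 :=
  (∑ a, ∑ b, ∑ c, ε a b c • wedge (Φ.e c) (lorentzCurv Φ.w a b))
    - Complex.I • ∑ α, wedge (bar Φ.ψ α) (covDSpinorForm Φ.w Φ.ψ α)

end Fields

end TopSugra

end

open TopSugra

open scoped Manifold ContDiff

noncomputable section

namespace TopSugra

set_option linter.unusedSectionVars false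

/-! ### Coordinate expressions of forms and chart independence of the exterior derivative. -/

section Charts

open Set Filter Topology

variable {M : Type*} [TopologicalSpace M] [ChartedSpace (EuclideanHalfSpace 3) M]
variable {B : Type*} [NormedRing B] [NormedAlgebra ℂ B] {k : ℕ}
variable {c c' : OpenPartialHomeomorph M (EuclideanHalfSpace 3)}

/-! Each integral statement is an identity between forms, integrated with Stokes' theorem
(`integral_extD`). Stokes is obtained from a partition of unity and the divergence theorem on a box
in the half-space (`halfSpace_stokes`).

Expanding the curvature of `Ā + tΘ` in `t` and integrating turns the transgression form into a
polynomial in `Ā`, `Θ` and their differentials (`IsPotential.transgression_eq`). Invariance of the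
bilinear form makes the cubic form `⟨X ∧ (Y ∧ Z + Z ∧ Y)⟩` totally symmetric (`cubicC_swap`). The
cubic terms therefore combine to the difference of two Chern–Simons forms, and the remaining
quadratic terms are `d⟨Θ ∧ Ā⟩` (`transgression_eq_sub`). The supergravity Lagrangian comes from the
Chern–Simons form by integrating `ω ∧ de` by parts (`chernSimonsC_eq`).

In the `4|2` representation, elements built from `P` and `Q` alone multiply to zero once their odd
coefficients anticommute. Hence the exponentials stop at first order, `g = 1 - (φ^a P_a + χ̄ Q)` has
inverse `1 + (φ^a P_a + χ̄ Q)`, and the nonlinear potential is a finite matrix computation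
(`coset_conj`).

The coset contains no Lorentz generator, so `Θ` has no Lorentz component. Its cubic self-coupling
vanishes and the transgression form is `2⟨Θ ∧ F⟩ - ⟨Θ ∧ DΘ⟩`, with `F` and `D` those of the linear
potential. The Bianchi identity (`bianchi`) and the fact that `D_ω` squares to the curvature on `χ`
(`covDSpinor_sq`) show that this is `d` of the topological Lagrangian: the terms of `V` bilinear in
spinors have exactly the coefficients that cancel the curvature terms created by `D_ω D_ω χ`
(`transgressionC_eq`).

These computations are done in abstract modules with products `m`, `n` subject only to the sign
rules `SuperExterior`; differential forms enter as an instance (`superExterior_wedge`). -/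

lemma minSmoothness_two_le_infty : minSmoothness ℝ 2 ≤ (∞ : WithTop ℕ∞) := by
  simpa using WithTop.coe_le_coe.2 (le_top : (2 : ℕ∞) ≤ ⊤)

/-- The derivative of the inverse of a chart, within the half-space. -/
abbrev chartD (c : OpenPartialHomeomorph M (EuclideanHalfSpace 3)) (y : E3) : E3 →L[ℝ] E3 :=
  mfderivWithin 𝓘(ℝ, E3) (𝓡∂ 3) (c.extend (𝓡∂ 3)).symm (range (𝓡∂ 3)) y

/-- The change of coordinates between two charts. -/
abbrev transition (c c' : OpenPartialHomeomorph M (EuclideanHalfSpace 3)) : E3 → E3 :=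
  c'.extend (𝓡∂ 3) ∘ (c.extend (𝓡∂ 3)).symm

lemma chartRep_apply (c : OpenPartialHomeomorph M (EuclideanHalfSpace 3)) (α : DForm M B k)
    (y : E3) : chartRep c α y =
      (α ((c.extend (𝓡∂ 3)).symm y)).compContinuousLinearMap (chartD c y) := rfl

lemma mem_range_of_mem_target {y : E3} (hy : y ∈ (c.extend (𝓡∂ 3)).target) :
    y ∈ range (𝓡∂ 3) := c.extend_target_subset_range hy

/-- The target is not open in `E3` at boundary points, only relative to the half-space. This lets
derivatives within the target be exchanged for derivatives within the half-space. -/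
lemma target_mem_nhdsWithin {y : E3} (hy : y ∈ (c.extend (𝓡∂ 3)).target) :
    (c.extend (𝓡∂ 3)).target ∈ 𝓝[range (𝓡∂ 3)] y := by
  have h := c.extend_target_mem_nhdsWithin (I := 𝓡∂ 3) (y := (c.extend (𝓡∂ 3)).symm y)
    (by simpa using (c.extend (𝓡∂ 3)).map_target hy)
  rwa [(c.extend (𝓡∂ 3)).right_inv hy] at h

lemma uniqueDiffWithinAt_range {y : E3} (hy : y ∈ (c.extend (𝓡∂ 3)).target) :
    UniqueDiffWithinAt ℝ (range (𝓡∂ 3)) y :=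
  (𝓡∂ 3).uniqueDiffOn y (mem_range_of_mem_target hy)

lemma uniqueDiffOn_target : UniqueDiffOn ℝ (c.extend (𝓡∂ 3)).target := fun _ hy =>
  (uniqueDiffWithinAt_range hy).mono_nhds (nhdsWithin_le_of_mem (target_mem_nhdsWithin hy))

lemma symm_mem_source {y : E3} (hy : y ∈ (c.extend (𝓡∂ 3)).target) :
    (c.extend (𝓡∂ 3)).symm y ∈ c.source := by
  simpa using (c.extend (𝓡∂ 3)).map_target hy

lemma extend_mem_target {x : M} (hx : x ∈ c.source) :
    c.extend (𝓡∂ 3) x ∈ (c.extend (𝓡∂ 3)).target :=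
  (c.extend (𝓡∂ 3)).map_source (by simpa using hx)

lemma mem_transition_source {y : E3} (hy : y ∈ (c.extend (𝓡∂ 3)).target)
    (hy' : (c.extend (𝓡∂ 3)).symm y ∈ c'.source) :
    y ∈ ((𝓡∂ 3).extendCoordChange c c').source := by
  simpa [ModelWithCorners.extendCoordChange, PartialEquiv.trans_source] using And.intro hy hy'

lemma transition_mem_range (y : E3) : transition c c' y ∈ range (𝓡∂ 3) := by
  simp [transition]

lemma symm_transition {y : E3} (hy' : (c.extend (𝓡∂ 3)).symm y ∈ c'.source) :
    (c'.extend (𝓡∂ 3)).symm (transition c c' y) = (c.extend (𝓡∂ 3)).symm y :=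
  c'.extend_left_inv hy'

lemma contDiffWithinAt_transition (hc : c ∈ IsManifold.maximalAtlas (𝓡∂ 3) ∞ M)
    (hc' : c' ∈ IsManifold.maximalAtlas (𝓡∂ 3) ∞ M) {y : E3}
    (hy : y ∈ (c.extend (𝓡∂ 3)).target) (hy' : (c.extend (𝓡∂ 3)).symm y ∈ c'.source) :
    ContDiffWithinAt ℝ ∞ (transition c c') (range (𝓡∂ 3)) y :=
  (𝓡∂ 3).contDiffWithinAt_extendCoordChange hc hc' (mem_transition_source hy hy')

lemma symm_mem_nhdsWithin {y : E3} (hy : y ∈ (c.extend (𝓡∂ 3)).target)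
    {s : Set M} (hs : IsOpen s) (hy' : (c.extend (𝓡∂ 3)).symm y ∈ s) :
    (c.extend (𝓡∂ 3)).symm ⁻¹' s ∈ 𝓝[range (𝓡∂ 3)] y :=
  (c.continuousAt_extend_symm' hy).preimage_mem_nhds (hs.mem_nhds hy') |>
    mem_nhdsWithin_of_mem_nhds

variable [IsManifold (𝓡∂ 3) ∞ M]

lemma mdifferentiableWithinAt_symm (hc : c ∈ IsManifold.maximalAtlas (𝓡∂ 3) ∞ M) {y : E3}
    (hy : y ∈ (c.extend (𝓡∂ 3)).target) :
    MDifferentiableWithinAt 𝓘(ℝ, E3) (𝓡∂ 3) (c.extend (𝓡∂ 3)).symm (range (𝓡∂ 3)) y := by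
  have h := contMDiffOn_extend_symm hc y (by rwa [← c.extend_target'])
  rw [← c.extend_target'] at h
  exact (h.mono_of_mem_nhdsWithin (target_mem_nhdsWithin hy)).mdifferentiableWithinAt (by simp)

lemma mdifferentiableAt_extend (hc : c ∈ IsManifold.maximalAtlas (𝓡∂ 3) ∞ M) {x : M}
    (hx : x ∈ c.source) : MDifferentiableAt (𝓡∂ 3) 𝓘(ℝ, E3) (c.extend (𝓡∂ 3)) x :=
  (c.contMDiffAt_extend hc hx).mdifferentiableAt (by simp)

/-- The chain rule for the inverse of a chart and a change of coordinates. -/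
lemma chartD_transition (hc : c ∈ IsManifold.maximalAtlas (𝓡∂ 3) ∞ M)
    (hc' : c' ∈ IsManifold.maximalAtlas (𝓡∂ 3) ∞ M) {y : E3}
    (hy : y ∈ (c.extend (𝓡∂ 3)).target) (hy' : (c.extend (𝓡∂ 3)).symm y ∈ c'.source) :
    chartD c y = (chartD c' (transition c c' y)).comp
      (fderivWithin ℝ (transition c c') (range (𝓡∂ 3)) y) := by
  have hev : (c'.extend (𝓡∂ 3)).symm ∘ transition c c' =ᶠ[𝓝[range (𝓡∂ 3)] y]
      (c.extend (𝓡∂ 3)).symm := by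
    filter_upwards [symm_mem_nhdsWithin hy c'.open_source hy'] with z hz
    exact symm_transition hz
  have hu : UniqueMDiffWithinAt 𝓘(ℝ, E3) (range (𝓡∂ 3)) y :=
    (uniqueDiffWithinAt_range hy).uniqueMDiffWithinAt
  have h1 := mfderivWithin_comp y (I := 𝓘(ℝ, E3)) (I' := 𝓘(ℝ, E3)) (I'' := 𝓡∂ 3)
    (g := (c'.extend (𝓡∂ 3)).symm) (f := transition c c')
    (s := range (𝓡∂ 3)) (u := range (𝓡∂ 3))
    (mdifferentiableWithinAt_symm hc' (extend_mem_target hy'))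
    ((contDiffWithinAt_transition hc hc' hy hy').differentiableWithinAt
      (by simp)).mdifferentiableWithinAt
    (fun z _ => transition_mem_range z) hu
  rw [mfderivWithin_eq_fderivWithin] at h1
  rw [chartD, ← hev.mfderivWithin_eq (symm_transition hy')]
  exact h1

/-- The pull-back law between two charts, an instance of the chain rule `chartD_transition`. Both
the chart independence of `extD` and the change of variables in integrals rest on it. -/
lemma chartRep_transition (hc : c ∈ IsManifold.maximalAtlas (𝓡∂ 3) ∞ M)
    (hc' : c' ∈ IsManifold.maximalAtlas (𝓡∂ 3) ∞ M) (α : DForm M B k) {y : E3}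
    (hy : y ∈ (c.extend (𝓡∂ 3)).target) (hy' : (c.extend (𝓡∂ 3)).symm y ∈ c'.source) :
    chartRep c α y = (chartRep c' α (transition c c' y)).compContinuousLinearMap
      (fderivWithin ℝ (transition c c') (range (𝓡∂ 3)) y) := by
  rw [chartRep_apply, chartRep_apply, symm_transition hy', chartD_transition hc hc' hy hy']
  rfl

/-- `extD` is defined through the derivative of the preferred chart; read in another chart, that
derivative becomes the Jacobian of the change of coordinates. -/
lemma mfderiv_extend_comp_chartD (hc : c ∈ IsManifold.maximalAtlas (𝓡∂ 3) ∞ M)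
    (hc' : c' ∈ IsManifold.maximalAtlas (𝓡∂ 3) ∞ M) {y : E3}
    (hy : y ∈ (c.extend (𝓡∂ 3)).target) (hy' : (c.extend (𝓡∂ 3)).symm y ∈ c'.source) :
    (mfderiv (𝓡∂ 3) 𝓘(ℝ, E3) (c'.extend (𝓡∂ 3)) ((c.extend (𝓡∂ 3)).symm y) : E3 →L[ℝ] E3).comp
      (chartD c y) = fderivWithin ℝ (transition c c') (range (𝓡∂ 3)) y := by
  have hu : UniqueMDiffWithinAt 𝓘(ℝ, E3) (range (𝓡∂ 3)) y :=
    (uniqueDiffWithinAt_range hy).uniqueMDiffWithinAt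
  have h1 := mfderiv_comp_mfderivWithin y (I := 𝓘(ℝ, E3)) (I' := 𝓡∂ 3) (I'' := 𝓘(ℝ, E3))
    (mdifferentiableAt_extend hc' hy') (mdifferentiableWithinAt_symm hc hy) hu
  rw [mfderivWithin_eq_fderivWithin] at h1
  exact h1.symm

/-- One-sided inversion is enough to recover a form from its coordinate expression, which reduces
identities of forms to identities in charts. -/
lemma chartD_comp_mfderiv_extend (hc : c ∈ IsManifold.maximalAtlas (𝓡∂ 3) ∞ M) {x : M}
    (hx : x ∈ c.source) :
    (chartD c (c.extend (𝓡∂ 3) x)).comp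
      (mfderiv (𝓡∂ 3) 𝓘(ℝ, E3) (c.extend (𝓡∂ 3)) x : E3 →L[ℝ] E3)
      = ContinuousLinearMap.id ℝ E3 := by
  have hev : (c.extend (𝓡∂ 3)).symm ∘ (c.extend (𝓡∂ 3)) =ᶠ[𝓝 x] id := by
    filter_upwards [c.open_source.mem_nhds hx] with z hz
    exact c.extend_left_inv hz
  have h1 : mfderivWithin (𝓡∂ 3) (𝓡∂ 3)
      ((c.extend (𝓡∂ 3)).symm ∘ (c.extend (𝓡∂ 3))) univ x = _ :=
    mfderivWithin_comp x (I := 𝓡∂ 3) (I' := 𝓘(ℝ, E3)) (I'' := 𝓡∂ 3)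
    (g := (c.extend (𝓡∂ 3)).symm) (f := c.extend (𝓡∂ 3)) (s := univ) (u := range (𝓡∂ 3))
    (mdifferentiableWithinAt_symm hc (extend_mem_target hx))
    (mdifferentiableAt_extend hc hx).mdifferentiableWithinAt
    (fun z _ => by simp) (uniqueMDiffWithinAt_univ _)
  rw [mfderivWithin_univ, mfderivWithin_univ, hev.mfderiv_eq, mfderiv_id] at h1
  exact h1.symm

lemma eq_chartRep_comp (hc : c ∈ IsManifold.maximalAtlas (𝓡∂ 3) ∞ M) {x : M}
    (hx : x ∈ c.source) (α : DForm M B k) :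
    α x = (chartRep c α (c.extend (𝓡∂ 3) x)).compContinuousLinearMap
      (mfderiv (𝓡∂ 3) 𝓘(ℝ, E3) (c.extend (𝓡∂ 3)) x : E3 →L[ℝ] E3) := by
  rw [chartRep_apply, OpenPartialHomeomorph.extend_left_inv _ hx]
  exact (congrArg (α x).compContinuousLinearMap (chartD_comp_mfderiv_extend hc hx)).symm

/-- Two forms are equal if their coordinate expressions are. -/
lemma DForm.ext_chartRep {α β : DForm M B k}
    (h : ∀ c ∈ IsManifold.maximalAtlas (𝓡∂ 3) ∞ M, ∀ y ∈ (c.extend (𝓡∂ 3)).target,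
      chartRep c α y = chartRep c β y) : α = β := by
  funext x
  have hx := mem_chart_source (EuclideanHalfSpace 3) x
  have hc := IsManifold.chart_mem_maximalAtlas (I := 𝓡∂ 3) (n := ∞) x
  rw [eq_chartRep_comp hc hx α, eq_chartRep_comp hc hx β, h _ hc _ (extend_mem_target hx)]

lemma IsSmoothForm.contDiffWithinAt {α : DForm M B k} (hα : IsSmoothForm α)
    (hc : c ∈ IsManifold.maximalAtlas (𝓡∂ 3) ∞ M) {y : E3}
    (hy : y ∈ (c.extend (𝓡∂ 3)).target) :
    ContDiffWithinAt ℝ ∞ (chartRep c α) (range (𝓡∂ 3)) y :=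
  (hα c hc y hy).mono_of_mem_nhdsWithin (target_mem_nhdsWithin hy)

lemma IsSmoothForm.differentiableWithinAt {α : DForm M B k} (hα : IsSmoothForm α)
    (hc : c ∈ IsManifold.maximalAtlas (𝓡∂ 3) ∞ M) {y : E3}
    (hy : y ∈ (c.extend (𝓡∂ 3)).target) :
    DifferentiableWithinAt ℝ (chartRep c α) (range (𝓡∂ 3)) y :=
  (hα.contDiffWithinAt hc hy).differentiableWithinAt (by simp)

/-- The exterior derivative is computed by the same formula in every chart. -/
lemma chartRep_extD {α : DForm M B k} (hα : IsSmoothForm α)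
    (hc : c ∈ IsManifold.maximalAtlas (𝓡∂ 3) ∞ M) {y : E3}
    (hy : y ∈ (c.extend (𝓡∂ 3)).target) :
    chartRep c (extD α) y = extDerivWithin (chartRep c α) (range (𝓡∂ 3)) y := by
  set x := (c.extend (𝓡∂ 3)).symm y with hxdef
  have hx := mem_chart_source (EuclideanHalfSpace 3) x
  have hc' := IsManifold.chart_mem_maximalAtlas (I := 𝓡∂ 3) (n := ∞) x
  have hxr := mem_range_of_mem_target hy
  have hev : chartRep c α =ᶠ[𝓝[range (𝓡∂ 3)] y] fun z =>
      (chartRep (chartAt (EuclideanHalfSpace 3) x) α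
        (transition c (chartAt (EuclideanHalfSpace 3) x) z)).compContinuousLinearMap
      (fderivWithin ℝ (transition c (chartAt (EuclideanHalfSpace 3) x)) (range (𝓡∂ 3)) z) := by
    filter_upwards [symm_mem_nhdsWithin hy (chartAt (EuclideanHalfSpace 3) x).open_source hx,
      target_mem_nhdsWithin hy] with z hz hz'
    exact chartRep_transition hc hc' α hz' hz
  -- Naturality of the exterior derivative under the change of coordinates. On the boundary it needs
  -- the half-space to lie in the closure of its interior.
  have hp := extDerivWithin_pullback (r := ∞) (t := range (𝓡∂ 3)) (x := y)
    (f := transition c (chartAt (EuclideanHalfSpace 3) x))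
    (hα.differentiableWithinAt hc' (extend_mem_target hx))
    (contDiffWithinAt_transition hc hc' hy hx) minSmoothness_two_le_infty (𝓡∂ 3).uniqueDiffOn
    ((𝓡∂ 3).range_subset_closure_interior hxr) hxr (fun z _ => transition_mem_range z)
  rw [hev.extDerivWithin_eq_of_mem hxr, hp, ← mfderiv_extend_comp_chartD hc hc' hy hx]
  rfl

end Charts

/-! ### Products of alternating forms at a point, as continuous bilinear maps. -/

section Pointwise

variable {B : Type*} [NormedRing B] [NormedAlgebra ℂ B] {k : ℕ}

/-- The wedge product of alternating forms on `E3`, as a continuous bilinear map. -/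
def wedgeL (B : Type*) [NormedRing B] [NormedAlgebra ℂ B] (k : ℕ) :
    (E3 [⋀^Fin 1]→L[ℝ] B) →L[ℝ] (E3 [⋀^Fin k]→L[ℝ] B) →L[ℝ] (E3 [⋀^Fin (k + 1)]→L[ℝ] B) :=
  (ContinuousLinearMap.compL ℝ _ _ _
      (ContinuousAlternatingMap.alternatizeUncurryFinCLM (n := k) ℝ E3 B)).comp
    (((ContinuousLinearMap.compL ℝ E3 (B →L[ℝ] B) (E3 [⋀^Fin k]→L[ℝ] B)).comp
        (ContinuousLinearMap.compContinuousAlternatingMapCLM ℝ E3 B B (Fin k)).flip).flip.comp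
      ((ContinuousLinearMap.compL ℝ E3 B (B →L[ℝ] B) (ContinuousLinearMap.mul ℝ B)).comp
        (ContinuousAlternatingMap.ofSubsingletonLIE (𝕜 := ℝ) (E := E3) (F := B)
          (0 : Fin 1)).symm.toContinuousLinearEquiv.toContinuousLinearMap))

/-- Left multiplication of alternating forms by elements of `B`. -/
def lmulL (B : Type*) [NormedRing B] [NormedAlgebra ℂ B] (k : ℕ) :
    B →L[ℝ] (E3 [⋀^Fin k]→L[ℝ] B) →L[ℝ] (E3 [⋀^Fin k]→L[ℝ] B) :=
  (ContinuousLinearMap.compContinuousAlternatingMapCLM ℝ E3 B B (Fin k)).comp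
    (ContinuousLinearMap.mul ℝ B)

/-- Right multiplication of alternating forms by elements of `B`. -/
def rmulL (B : Type*) [NormedRing B] [NormedAlgebra ℂ B] (k : ℕ) :
    B →L[ℝ] (E3 [⋀^Fin k]→L[ℝ] B) →L[ℝ] (E3 [⋀^Fin k]→L[ℝ] B) :=
  (ContinuousLinearMap.compContinuousAlternatingMapCLM ℝ E3 B B (Fin k)).comp
    (ContinuousLinearMap.mul ℝ B).flip

lemma contDiff_wedgeL (k : ℕ) : ContDiff ℝ ∞ (wedgeL B k) := ContinuousLinearMap.contDiff _

lemma contDiff_lmulL (k : ℕ) : ContDiff ℝ ∞ (lmulL B k) := ContinuousLinearMap.contDiff _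

lemma contDiff_rmulL (k : ℕ) : ContDiff ℝ ∞ (rmulL B k) := ContinuousLinearMap.contDiff _

lemma contDiff_alternatizeUncurryFinCLM (k : ℕ) :
    ContDiff ℝ ∞ (ContinuousAlternatingMap.alternatizeUncurryFinCLM (n := k) ℝ E3 B) :=
  ContinuousLinearMap.contDiff _

lemma contDiff_ofSubsingletonLIE : ContDiff ℝ ∞
    (ContinuousAlternatingMap.ofSubsingletonLIE (𝕜 := ℝ) (E := E3) (F := B) (0 : Fin 1)) :=
  LinearIsometryEquiv.contDiff _

@[simp] lemma lmulL_apply (f : B) (a : E3 [⋀^Fin k]→L[ℝ] B) (v : Fin k → E3) :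
    lmulL B k f a v = f * a v := rfl

lemma wedgeL_apply (a : E3 [⋀^Fin 1]→L[ℝ] B) (b : E3 [⋀^Fin k]→L[ℝ] B) (v : Fin (k + 1) → E3) :
    wedgeL B k a b v = ∑ i, (-1) ^ i.val • (a (fun _ => v i) * b (i.removeNth v)) :=
  ContinuousAlternatingMap.alternatizeUncurryFin_apply _ _

lemma wedgeL_one_apply (a b : E3 [⋀^Fin 1]→L[ℝ] B) (u v : E3) :
    wedgeL B 1 a b ![u, v] = a ![u] * b ![v] - a ![v] * b ![u] := by
  have h (w : E3) : (fun _ : Fin 1 => w) = ![w] := by ext i; fin_cases i; rfl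
  have h0 : (0 : Fin 2).removeNth ![u, v] = ![v] := by ext i; fin_cases i; rfl
  have h1 : (1 : Fin 2).removeNth ![u, v] = ![u] := by ext i; fin_cases i; rfl
  rw [wedgeL_apply, Fin.sum_univ_two, h0, h1]
  simp [h, sub_eq_add_neg]

lemma removeNth_three (u v w : E3) : (0 : Fin 3).removeNth ![u, v, w] = ![v, w] ∧
    (1 : Fin 3).removeNth ![u, v, w] = ![u, w] ∧ (2 : Fin 3).removeNth ![u, v, w] = ![u, v] := by
  refine ⟨?_, ?_, ?_⟩ <;> ext i <;> fin_cases i <;> rfl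

lemma wedgeL_two_apply (a : E3 [⋀^Fin 1]→L[ℝ] B) (b : E3 [⋀^Fin (1 + 1)]→L[ℝ] B)
    (u v w : E3) : wedgeL B (1 + 1) a b ![u, v, w] =
      a ![u] * b ![v, w] - a ![v] * b ![u, w] + a ![w] * b ![u, v] := by
  have h (w : E3) : (fun _ : Fin 1 => w) = ![w] := by ext i; fin_cases i; rfl
  obtain ⟨h0, h1, h2⟩ := removeNth_three u v w
  rw [wedgeL_apply, Fin.sum_univ_three, h0, h1, h2]
  simp [h, sub_eq_add_neg]

lemma alternatizeUncurryFin_one_apply (D : E3 →L[ℝ] E3 [⋀^Fin 1]→L[ℝ] B) (u v : E3) :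
    ContinuousAlternatingMap.alternatizeUncurryFin D ![u, v] = D u ![v] - D v ![u] := by
  have h0 : (0 : Fin 2).removeNth ![u, v] = ![v] := by ext i; fin_cases i; rfl
  have h1 : (1 : Fin 2).removeNth ![u, v] = ![u] := by ext i; fin_cases i; rfl
  rw [ContinuousAlternatingMap.alternatizeUncurryFin_apply, Fin.sum_univ_two, h0, h1]
  simp [sub_eq_add_neg]

lemma alternatizeUncurryFin_two_apply (D : E3 →L[ℝ] E3 [⋀^Fin 2]→L[ℝ] B) (u v w : E3) :
    ContinuousAlternatingMap.alternatizeUncurryFin D ![u, v, w] =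
      D u ![v, w] - D v ![u, w] + D w ![u, v] := by
  obtain ⟨h0, h1, h2⟩ := removeNth_three u v w
  rw [ContinuousAlternatingMap.alternatizeUncurryFin_apply, Fin.sum_univ_three, h0, h1, h2]
  simp [sub_eq_add_neg]

lemma alternating_ext_two {a b : E3 [⋀^Fin 2]→L[ℝ] B} (h : ∀ u v, a ![u, v] = b ![u, v]) :
    a = b := by
  ext v
  have hv : v = ![v 0, v 1] := by ext i; fin_cases i <;> rfl
  rw [hv]; exact h _ _

lemma alternating_ext_three {a b : E3 [⋀^Fin 3]→L[ℝ] B}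
    (h : ∀ u v w, a ![u, v, w] = b ![u, v, w]) : a = b := by
  ext v
  have hv : v = ![v 0, v 1, v 2] := by ext i; fin_cases i <;> rfl
  rw [hv]; exact h _ _ _

lemma wedgeL_compContinuousLinearMap (a : E3 [⋀^Fin 1]→L[ℝ] B) (b : E3 [⋀^Fin k]→L[ℝ] B)
    (D : E3 →L[ℝ] E3) : (wedgeL B k a b).compContinuousLinearMap D =
      wedgeL B k (a.compContinuousLinearMap D) (b.compContinuousLinearMap D) := by
  ext v
  rw [ContinuousAlternatingMap.compContinuousLinearMap_apply, wedgeL_apply, wedgeL_apply]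
  rfl

end Pointwise

/-! ### Smoothness of the operations on forms, and the calculus of the exterior derivative. -/

section Operations

open Set Filter Topology

variable {M : Type*} [TopologicalSpace M] [ChartedSpace (EuclideanHalfSpace 3) M]
variable {B : Type*} [NormedRing B] [NormedAlgebra ℂ B] {k : ℕ}
variable {c : OpenPartialHomeomorph M (EuclideanHalfSpace 3)}

lemma lmul_eq (f : M → B) (α : DForm M B k) (x : M) : lmul f α x = lmulL B k (f x) (α x) := rfl

lemma chartRep_wedge (α : DForm M B 1) (β : DForm M B k) (y : E3) :
    chartRep c (wedge α β) y = wedgeL B k (chartRep c α y) (chartRep c β y) :=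
  wedgeL_compContinuousLinearMap _ _ _

lemma chartRep_lmul (f : M → B) (α : DForm M B k) (y : E3) :
    chartRep c (lmul f α) y = lmulL B k (f ((c.extend (𝓡∂ 3)).symm y)) (chartRep c α y) := rfl

lemma chartRep_add (α β : DForm M B k) : chartRep c (α + β) = chartRep c α + chartRep c β := rfl

lemma chartRep_smul (a : ℂ) (α : DForm M B k) : chartRep c (a • α) = a • chartRep c α := rfl

/-- The coordinate expression of a function is smooth. -/
lemma contDiffOn_comp_symm {F : Type*} [NormedAddCommGroup F] [NormedSpace ℝ F] {f : M → F}
    (hf : ContMDiff (𝓡∂ 3) 𝓘(ℝ, F) ∞ f)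
    (hc : c ∈ IsManifold.maximalAtlas (𝓡∂ 3) ∞ M) :
    ContDiffOn ℝ ∞ (f ∘ (c.extend (𝓡∂ 3)).symm) (c.extend (𝓡∂ 3)).target := by
  rw [← contMDiffOn_iff_contDiffOn, c.extend_target']
  exact hf.comp_contMDiffOn (contMDiffOn_extend_symm hc)

lemma contDiffWithinAt_comp_symm {F : Type*} [NormedAddCommGroup F] [NormedSpace ℝ F] {f : M → F}
    (hf : ContMDiff (𝓡∂ 3) 𝓘(ℝ, F) ∞ f)
    (hc : c ∈ IsManifold.maximalAtlas (𝓡∂ 3) ∞ M) {y : E3}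
    (hy : y ∈ (c.extend (𝓡∂ 3)).target) :
    ContDiffWithinAt ℝ ∞ (f ∘ (c.extend (𝓡∂ 3)).symm) (range (𝓡∂ 3)) y :=
  (contDiffOn_comp_symm hf hc y hy).mono_of_mem_nhdsWithin (target_mem_nhdsWithin hy)

namespace IsSmoothForm

lemma add {α β : DForm M B k} (hα : IsSmoothForm α) (hβ : IsSmoothForm β) :
    IsSmoothForm (α + β) := fun c hc => (hα c hc).add (hβ c hc)

lemma smul {α : DForm M B k} (a : ℂ) (hα : IsSmoothForm α) : IsSmoothForm (a • α) :=
  fun c hc => (hα c hc).const_smul a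

lemma zero : IsSmoothForm (0 : DForm M B k) := fun _ _ => contDiffOn_const (c := 0)

lemma neg {α : DForm M B k} (hα : IsSmoothForm α) : IsSmoothForm (-α) :=
  fun c hc => (hα c hc).neg

lemma sub {α β : DForm M B k} (hα : IsSmoothForm α) (hβ : IsSmoothForm β) :
    IsSmoothForm (α - β) := fun c hc => (hα c hc).sub (hβ c hc)

lemma sum {ι : Type*} (s : Finset ι) {α : ι → DForm M B k} (h : ∀ i, IsSmoothForm (α i)) :
    IsSmoothForm (∑ i ∈ s, α i) := by
  classical
  induction s using Finset.induction_on with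
  | empty => simpa using zero
  | insert i s hi ih => rw [Finset.sum_insert hi]; exact (h i).add ih

lemma wedge {α : DForm M B 1} {β : DForm M B k} (hα : IsSmoothForm α) (hβ : IsSmoothForm β) :
    IsSmoothForm (wedge α β) := fun c hc =>
  ((ContDiff.comp_contDiffOn (g := wedgeL B k) (contDiff_wedgeL k) (hα c hc)).clm_apply (hβ c hc)).congr
    fun y _ => chartRep_wedge α β y

lemma lmul {f : M → B} {α : DForm M B k} (hf : ContMDiff (𝓡∂ 3) 𝓘(ℝ, B) ∞ f)
    (hα : IsSmoothForm α) : IsSmoothForm (lmul f α) := fun c hc =>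
  ContDiffOn.clm_apply (f := fun y => lmulL B k (f ((c.extend (𝓡∂ 3)).symm y)))
    (ContDiff.comp_contDiffOn (g := lmulL B k) (contDiff_lmulL k) (contDiffOn_comp_symm hf hc)) (hα c hc)

lemma rmul {f : M → B} {α : DForm M B k} (hf : ContMDiff (𝓡∂ 3) 𝓘(ℝ, B) ∞ f)
    (hα : IsSmoothForm α) : IsSmoothForm (rmul α f) := fun c hc =>
  ContDiffOn.clm_apply (f := fun y => rmulL B k (f ((c.extend (𝓡∂ 3)).symm y)))
    (ContDiff.comp_contDiffOn (g := rmulL B k) (contDiff_rmulL k) (contDiffOn_comp_symm hf hc)) (hα c hc)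

end IsSmoothForm

/-- Smoothness is known only on the target, while the derivative is taken within the half-space; the
two derivatives agree because the target is a relative neighbourhood of its points. -/
lemma contDiffOn_fderivWithin_range {F : Type*} [NormedAddCommGroup F] [NormedSpace ℝ F]
    {f : E3 → F} (hf : ContDiffOn ℝ ∞ f (c.extend (𝓡∂ 3)).target) :
    ContDiffOn ℝ ∞ (fderivWithin ℝ f (range (𝓡∂ 3))) (c.extend (𝓡∂ 3)).target :=
  (hf.fderivWithin uniqueDiffOn_target (m := ∞) (by simp)).congr fun y hy =>
    (fderivWithin_of_mem_nhdsWithin (target_mem_nhdsWithin hy)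
      (uniqueDiffWithinAt_range hy) ((hf.differentiableOn (by simp)) y hy))

variable [IsManifold (𝓡∂ 3) ∞ M]

lemma IsSmoothForm.extD {α : DForm M B k} (hα : IsSmoothForm α) : IsSmoothForm (extD α) :=
  fun c hc => (ContDiff.comp_contDiffOn
    (g := ContinuousAlternatingMap.alternatizeUncurryFinCLM (n := k) ℝ E3 B)
    (contDiff_alternatizeUncurryFinCLM k)
    (contDiffOn_fderivWithin_range (hα c hc))).congr fun _ hy => chartRep_extD hα hc hy

lemma chartRep_dFun {f : M → B} (hf : ContMDiff (𝓡∂ 3) 𝓘(ℝ, B) ∞ f)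
    (hc : c ∈ IsManifold.maximalAtlas (𝓡∂ 3) ∞ M) {y : E3}
    (hy : y ∈ (c.extend (𝓡∂ 3)).target) :
    chartRep c (dFun f) y = ContinuousAlternatingMap.ofSubsingleton ℝ E3 B (0 : Fin 1)
      (fderivWithin ℝ (f ∘ (c.extend (𝓡∂ 3)).symm) (range (𝓡∂ 3)) y) := by
  have h1 := mfderiv_comp_mfderivWithin y (I := 𝓘(ℝ, E3)) (I' := 𝓡∂ 3) (I'' := 𝓘(ℝ, B))
    (hf.mdifferentiableAt (x := (c.extend (𝓡∂ 3)).symm y) (by simp))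
    (mdifferentiableWithinAt_symm hc hy) (uniqueDiffWithinAt_range hy).uniqueMDiffWithinAt
  rw [mfderivWithin_eq_fderivWithin] at h1
  rw [h1]
  rfl

lemma IsSmoothForm.dFun {f : M → B} (hf : ContMDiff (𝓡∂ 3) 𝓘(ℝ, B) ∞ f) :
    IsSmoothForm (dFun f) := fun _ hc =>
  (ContDiff.comp_contDiffOn (g := ContinuousAlternatingMap.ofSubsingletonLIE (𝕜 := ℝ) (E := E3) (F := B) (0 : Fin 1))
    contDiff_ofSubsingletonLIE
    (contDiffOn_fderivWithin_range (contDiffOn_comp_symm hf hc))).congr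
      fun _ hy => chartRep_dFun hf hc hy

/-! ### Rules for the exterior derivative -/

lemma extD_add {α β : DForm M B k} (hα : IsSmoothForm α) (hβ : IsSmoothForm β) :
    extD (α + β) = extD α + extD β := DForm.ext_chartRep fun c hc y hy => by
  rw [chartRep_extD (hα.add hβ) hc hy, chartRep_add, chartRep_add, Pi.add_apply,
    chartRep_extD hα hc hy, chartRep_extD hβ hc hy,
    extDerivWithin_add (uniqueDiffWithinAt_range hy) (hα.differentiableWithinAt hc hy)
      (hβ.differentiableWithinAt hc hy)]

lemma extD_smul {α : DForm M B k} (a : ℂ) (hα : IsSmoothForm α) :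
    extD (a • α) = a • extD α := DForm.ext_chartRep fun c hc y hy => by
  rw [chartRep_extD (hα.smul a) hc hy, chartRep_smul, chartRep_smul, Pi.smul_apply,
    chartRep_extD hα hc hy, extDerivWithin, extDerivWithin,
    fderivWithin_const_smul (uniqueDiffWithinAt_range hy) (hα.differentiableWithinAt hc hy),
    ContinuousAlternatingMap.alternatizeUncurryFin_smul]

lemma extD_zero : extD (0 : DForm M B k) = 0 := by
  have h := extD_smul 0 (IsSmoothForm.zero (M := M) (B := B) (k := k))
  rw [show (0 : ℂ) • (0 : DForm M B k) = 0 from zero_smul ℂ (0 : DForm M B k)] at h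
  exact h.trans (zero_smul ℂ (extD (0 : DForm M B k)))

lemma extD_neg {α : DForm M B k} (hα : IsSmoothForm α) : extD (-α) = -extD α := by
  rw [show -α = (-1 : ℂ) • α by module, extD_smul (-1) hα]
  module

lemma extD_sub {α β : DForm M B k} (hα : IsSmoothForm α) (hβ : IsSmoothForm β) :
    extD (α - β) = extD α - extD β := by
  rw [sub_eq_add_neg, extD_add hα hβ.neg, extD_neg hβ, sub_eq_add_neg]

lemma extD_sum {ι : Type*} (s : Finset ι) {α : ι → DForm M B k} (h : ∀ i, IsSmoothForm (α i)) :
    extD (∑ i ∈ s, α i) = ∑ i ∈ s, extD (α i) := by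
  classical
  induction s using Finset.induction_on with
  | empty => simpa using extD_zero
  | insert i s hi ih =>
    rw [Finset.sum_insert hi, Finset.sum_insert hi, extD_add (h i) (.sum s h), ih]

/-- The factor `f` stays on the left in both terms, so no parity assumption and no sign enter. -/
lemma extD_lmul {f : M → B} {α : DForm M B k} (hf : ContMDiff (𝓡∂ 3) 𝓘(ℝ, B) ∞ f)
    (hα : IsSmoothForm α) : extD (lmul f α) = wedge (dFun f) α + lmul f (extD α) :=
  DForm.ext_chartRep fun c hc y hy => by
    have hu := uniqueDiffWithinAt_range hy
    have h1 : fderivWithin ℝ (chartRep c (lmul f α)) (range (𝓡∂ 3)) y = _ :=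
      ((lmulL B k).hasFDerivWithinAt_of_bilinear
        ((contDiffWithinAt_comp_symm hf hc hy).differentiableWithinAt (by simp)).hasFDerivWithinAt
        (hα.differentiableWithinAt hc hy).hasFDerivWithinAt).fderivWithin hu
    rw [chartRep_extD (hα.lmul hf) hc hy, chartRep_add, Pi.add_apply, chartRep_wedge,
      chartRep_lmul, chartRep_dFun hf hc hy, chartRep_extD hα hc hy, extDerivWithin, h1]
    ext v
    rw [ContinuousAlternatingMap.alternatizeUncurryFin_apply, ContinuousAlternatingMap.add_apply,
      wedgeL_apply, lmulL_apply, extDerivWithin,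
      ContinuousAlternatingMap.alternatizeUncurryFin_apply, Finset.mul_sum,
      ← Finset.sum_add_distrib]
    refine Finset.sum_congr rfl fun i _ => ?_
    rw [mul_smul_comm, ← smul_add]
    exact congrArg _ (add_comm _ _)

lemma extD_extD {α : DForm M B k} (hα : IsSmoothForm α) : extD (extD α) = 0 :=
  DForm.ext_chartRep fun c hc y hy => by
    have hev : chartRep c (extD α) =ᶠ[𝓝[range (𝓡∂ 3)] y]
        extDerivWithin (chartRep c α) (range (𝓡∂ 3)) := by
      filter_upwards [target_mem_nhdsWithin hy] with z hz using chartRep_extD hα hc hz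
    have hr := mem_range_of_mem_target hy
    rw [chartRep_extD hα.extD hc hy, hev.extDerivWithin_eq_of_mem hr,
      extDerivWithin_extDerivWithin_apply (hα.contDiffWithinAt hc hy) minSmoothness_two_le_infty
        (𝓡∂ 3).uniqueDiffOn ((𝓡∂ 3).range_subset_closure_interior hr) hr]
    rfl

/-- In a chart, `dFun f` is the exterior derivative of `f` regarded as a 0-form, so the claim is
again that the exterior derivative squares to zero. -/
lemma extD_dFun {f : M → B} (hf : ContMDiff (𝓡∂ 3) 𝓘(ℝ, B) ∞ f) : extD (dFun f) = 0 :=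
  DForm.ext_chartRep fun c hc y hy => by
    have hev : chartRep c (dFun f) =ᶠ[𝓝[range (𝓡∂ 3)] y]
        extDerivWithin (fun z => ContinuousAlternatingMap.constOfIsEmpty ℝ E3 (Fin 0)
          ((f ∘ (c.extend (𝓡∂ 3)).symm) z)) (range (𝓡∂ 3)) := by
      filter_upwards [target_mem_nhdsWithin hy] with z hz
      rw [chartRep_dFun hf hc hz, extDerivWithin_constOfIsEmpty _ (uniqueDiffWithinAt_range hz)]
    have hr := mem_range_of_mem_target hy
    have hs : ContDiffWithinAt ℝ ∞ (fun z => ContinuousAlternatingMap.constOfIsEmpty ℝ E3 (Fin 0)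
          ((f ∘ (c.extend (𝓡∂ 3)).symm) z)) (range (𝓡∂ 3)) y :=
      (ContinuousAlternatingMap.constOfIsEmptyLIE ℝ E3 B (Fin 0)).contDiff.comp_contDiffWithinAt
        (contDiffWithinAt_comp_symm hf hc hy)
    rw [chartRep_extD (.dFun hf) hc hy, hev.extDerivWithin_eq_of_mem hr,
      extDerivWithin_extDerivWithin_apply hs minSmoothness_two_le_infty
        (𝓡∂ 3).uniqueDiffOn ((𝓡∂ 3).range_subset_closure_interior hr) hr]
    rfl

/-- The graded Leibniz rule for 1-forms whose values commute up to the scalar `s`. -/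
lemma extD_wedge {α β : DForm M B 1} (hα : IsSmoothForm α) (hβ : IsSmoothForm β) (s : ℂ)
    (h : ∀ x y u v, α x u * β y v = s • (β y v * α x u)) :
    extD (wedge α β) = s • wedge β (extD α) - wedge α (extD β) :=
  DForm.ext_chartRep fun c hc y hy => by
    have hu := uniqueDiffWithinAt_range hy
    set a := chartRep c α with ha
    set b := chartRep c β with hb
    have hda := (hα.differentiableWithinAt hc hy).hasFDerivWithinAt
    have hdb := (hβ.differentiableWithinAt hc hy).hasFDerivWithinAt
    have h1 : fderivWithin ℝ (chartRep c (wedge α β)) (range (𝓡∂ 3)) y =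
        (wedgeL B 1).precompR E3 (a y) (fderivWithin ℝ b (range (𝓡∂ 3)) y) +
        (wedgeL B 1).precompL E3 (fderivWithin ℝ a (range (𝓡∂ 3)) y) (b y) := by
      rw [show chartRep c (wedge α β) = fun y => wedgeL B 1 (a y) (b y) from
        funext fun y => chartRep_wedge α β y]
      exact ((wedgeL B 1).hasFDerivWithinAt_of_bilinear hda hdb).fderivWithin hu
    -- `wedge` takes its 1-form on the left, so `dα ∧ β` has to be written as `s • β ∧ dα`. The sign
    -- rule passes to the derivative of `a` because the linear map `L`, with `b` frozen at `y`,
    -- annihilates `a` at every point; this is why `h` compares values at two different points.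
    have hcomm : ∀ u v w, fderivWithin ℝ a (range (𝓡∂ 3)) y u ![v] * b y ![w] =
        s • (b y ![w] * fderivWithin ℝ a (range (𝓡∂ 3)) y u ![v]) := by
      intro u v w
      let L : (E3 [⋀^Fin 1]→L[ℝ] B) →L[ℝ] B :=
        ((ContinuousLinearMap.mul ℝ B).flip (b y ![w]) - s • ContinuousLinearMap.mul ℝ B (b y ![w]))
          ∘L ContinuousAlternatingMap.apply ℝ E3 B ![v]
      have h2 := (L.hasFDerivAt.comp_hasFDerivWithinAt y hda).fderivWithin hu
      have h3 : L ∘ a = 0 := by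
        funext z
        exact sub_eq_zero.2 (h _ _ _ _)
      rw [h3, fderivWithin_zero] at h2
      exact sub_eq_zero.1 (congrArg (fun f : E3 →L[ℝ] B => f u) h2).symm
    rw [chartRep_extD (hα.wedge hβ) hc hy, sub_eq_add_neg, chartRep_add, chartRep_smul,
      ← neg_one_smul ℂ, chartRep_smul, Pi.add_apply, Pi.smul_apply, Pi.smul_apply, chartRep_wedge,
      chartRep_wedge, chartRep_extD hα hc hy, chartRep_extD hβ hc hy, extDerivWithin, h1]
    refine alternating_ext_three fun u v w => ?_
    simp only [ContinuousAlternatingMap.add_apply, ContinuousAlternatingMap.smul_apply,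
      alternatizeUncurryFin_two_apply, _root_.add_apply,
      ContinuousLinearMap.precompR_apply, ContinuousLinearMap.precompL_apply, wedgeL_one_apply,
      wedgeL_two_apply, extDerivWithin, alternatizeUncurryFin_one_apply, hcomm, mul_sub,
      ← ha, ← hb, ContinuousLinearMap.compL_apply, ContinuousLinearMap.comp_apply]
    module

/-- The differential of a function with values in a closed subspace has values there. -/
lemma dFun_mem {S : Submodule ℝ B} (hS : IsClosed (S : Set B)) {f : M → B}
    (hf : ContMDiff (𝓡∂ 3) 𝓘(ℝ, B) ∞ f) (h : ∀ x, f x ∈ S) (x : M) (v : Fin 1 → E3) :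
    dFun f x v ∈ S := by
  have hx := mem_chart_source (EuclideanHalfSpace 3) x
  have hc := IsManifold.chart_mem_maximalAtlas (I := 𝓡∂ 3) (n := ∞) x
  have hy := extend_mem_target hx
  have : IsClosed (S : Set B) := hS
  rw [eq_chartRep_comp hc hx (dFun f), chartRep_dFun hf hc hy]
  set f' := f ∘ ((chartAt (EuclideanHalfSpace 3) x).extend (𝓡∂ 3)).symm
  have hd : DifferentiableWithinAt ℝ f' (range (𝓡∂ 3)) _ :=
    (contDiffWithinAt_comp_symm hf hc hy).differentiableWithinAt (by simp)
  -- Closedness of `S` makes the quotient a normed space. The projection kills `f'`, hence also its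
  -- derivative.
  let L : B →L[ℝ] B ⧸ S := ⟨S.mkQ, S.continuous_mkQ⟩
  have h2 := (L.hasFDerivAt.comp_hasFDerivWithinAt _ hd.hasFDerivWithinAt).fderivWithin
    (uniqueDiffWithinAt_range hy)
  have h3 : L ∘ f' = 0 := by
    funext z
    exact (Submodule.Quotient.mk_eq_zero S).2 (h _)
  rw [h3, fderivWithin_zero] at h2
  exact (Submodule.Quotient.mk_eq_zero S).1 (congrArg (fun f : E3 →L[ℝ] B ⧸ S => f _) h2).symm

end Operations

/-! ### Change of variables for integrals of 3-forms. -/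

section ChangeOfVariables

open Set Filter Topology MeasureTheory

variable {M : Type*} [TopologicalSpace M] [ChartedSpace (EuclideanHalfSpace 3) M]
variable {B : Type*} [NormedRing B] [NormedAlgebra ℂ B] {k : ℕ}
variable {c c' : OpenPartialHomeomorph M (EuclideanHalfSpace 3)}

/-- The standard frame of the model space. -/
abbrev stdFrame : Fin 3 → E3 := ![stdVec 0, stdVec 1, stdVec 2]

/-- A top-degree alternating form is determined by its value on a basis, so it is a multiple of the
determinant form, which scales by `D.det`. -/
lemma top_form_comp (a : E3 [⋀^Fin 3]→L[ℝ] B) (D : E3 →L[ℝ] E3) :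
    a.compContinuousLinearMap D stdFrame = D.det • a stdFrame := by
  let e := (EuclideanSpace.basisFun (Fin 3) ℝ).toBasis
  have he : stdFrame = e := by
    funext i
    fin_cases i <;> simp [e, stdFrame]
  let g : E3 [⋀^Fin 3]→ₗ[ℝ] B :=
    (LinearMap.toSpanSingleton ℝ B (a stdFrame)).compAlternatingMap e.det
  have hg : a.toAlternatingMap = g := by
    -- Only injective families of basis vectors have to be tested. These are permutations of the
    -- basis, and both forms pick up the same sign.
    refine Module.Basis.ext_alternating e fun v hv => ?_
    let σ : Equiv.Perm (Fin 3) := Equiv.ofBijective v (Finite.injective_iff_bijective.1 hv)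
    have h1 := a.toAlternatingMap.map_perm e σ
    have h2 := g.map_perm e σ
    have h3 : a.toAlternatingMap e = g e := by
      rw [show g e = e.det e • a stdFrame from rfl, e.det_self, one_smul, he]
      rfl
    exact (h1.trans (by rw [h3])).trans h2.symm
  have h4 : a.toAlternatingMap (D ∘ stdFrame) = g (D ∘ stdFrame) := by rw [hg]
  refine h4.trans ?_
  have h5 : e.det (D ∘ stdFrame) = D.det := by
    rw [he]
    have := e.det_comp (D : E3 →ₗ[ℝ] E3) e
    rw [e.det_self, mul_one] at this
    exact this
  simp only [g, LinearMap.compAlternatingMap_apply, LinearMap.toSpanSingleton_apply, h5]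

lemma measurableSet_target : MeasurableSet (c.extend (𝓡∂ 3)).target := by
  rw [c.extend_target]
  exact ((c.open_target.preimage (𝓡∂ 3).continuous_symm).measurableSet).inter
    (𝓡∂ 3).isClosed_range.measurableSet

lemma integrableOn_target {F : Type*} [NormedAddCommGroup F] {f : E3 → F} {K : Set E3}
    (hf : ContinuousOn f (c.extend (𝓡∂ 3)).target) (hK : IsCompact K)
    (hKt : K ⊆ (c.extend (𝓡∂ 3)).target) (h0 : ∀ y ∈ (c.extend (𝓡∂ 3)).target \ K, f y = 0) :
    IntegrableOn f (c.extend (𝓡∂ 3)).target :=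
  ((hf.mono hKt).integrableOn_compact hK).of_forall_sdiff_eq_zero measurableSet_target h0

variable [IsManifold (𝓡∂ 3) ∞ M]

/-- The integral of a 3-form that is supported in the domains of two charts is the same in both
of them. -/
lemma integral_chartRep_eq (hc : c ∈ IsManifold.maximalAtlas (𝓡∂ 3) ∞ M)
    (hc' : c' ∈ IsManifold.maximalAtlas (𝓡∂ 3) ∞ M)
    (hdet : ∀ x ∈ c.source ∩ c'.source,
      0 < (fderivWithin ℝ (transition c c') (range (𝓡∂ 3)) (c.extend (𝓡∂ 3) x)).det)
    (f : M → ℝ) (α : DForm M B 3) (h : ∀ x ∈ c.source \ c'.source, f x • α x = 0)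
    (h' : ∀ x ∈ c'.source \ c.source, f x • α x = 0) :
    ∫ y in (c.extend (𝓡∂ 3)).target,
        f ((c.extend (𝓡∂ 3)).symm y) • chartRep c α y stdFrame =
      ∫ y in (c'.extend (𝓡∂ 3)).target,
        f ((c'.extend (𝓡∂ 3)).symm y) • chartRep c' α y stdFrame := by
  -- Outside the overlap of the two charts the integrand vanishes, so both integrals live on the
  -- overlap.
  have hzero : ∀ (d d' : OpenPartialHomeomorph M (EuclideanHalfSpace 3)),
      (∀ x ∈ d.source \ d'.source, f x • α x = 0) →
      ∀ y ∈ (d.extend (𝓡∂ 3)).target \ ((𝓡∂ 3).extendCoordChange d d').source,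
        f ((d.extend (𝓡∂ 3)).symm y) • chartRep d α y stdFrame = 0 := by
    rintro d d' hd y ⟨hy, hy'⟩
    have h1 := hd ((d.extend (𝓡∂ 3)).symm y)
      ⟨symm_mem_source hy, fun hn => hy' (mem_transition_source hy hn)⟩
    exact congrArg (fun g : E3 [⋀^Fin 3]→L[ℝ] B => g fun i => chartD d y (stdFrame i)) h1
  have hsub : ∀ (d d' : OpenPartialHomeomorph M (EuclideanHalfSpace 3)),
      ((𝓡∂ 3).extendCoordChange d d').source ⊆ (d.extend (𝓡∂ 3)).target := by
    intro d d' y hy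
    exact hy.1
  have himg : transition c c' '' ((𝓡∂ 3).extendCoordChange c c').source =
      ((𝓡∂ 3).extendCoordChange c' c).source :=
    ((𝓡∂ 3).extendCoordChange c c').image_source_eq_target
  have hinj : InjOn (transition c c') ((𝓡∂ 3).extendCoordChange c c').source :=
    ((𝓡∂ 3).extendCoordChange c c').injOn
  have hmeas : MeasurableSet ((𝓡∂ 3).extendCoordChange c c').source := by
    rw [(𝓡∂ 3).extendCoordChange_source, (𝓡∂ 3).image_eq]
    exact (((OpenPartialHomeomorph.open_source _).preimage
      (𝓡∂ 3).continuous_symm).measurableSet).inter (𝓡∂ 3).isClosed_range.measurableSet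
  refine (setIntegral_eq_of_subset_of_forall_sdiff_eq_zero measurableSet_target (hsub c c')
    (hzero c c' h)).trans (Eq.trans ?_ (setIntegral_eq_of_subset_of_forall_sdiff_eq_zero
      measurableSet_target (hsub c' c) (hzero c' c h')).symm)
  -- The Jacobian formula holds with derivatives within the overlap, boundary points included. The
  -- absolute value disappears because the charts are oriented.
  rw [← himg, integral_image_eq_integral_abs_det_fderiv_smul volume hmeas
    (f' := fun y => fderivWithin ℝ (transition c c') (range (𝓡∂ 3)) y) ?_ hinj]
  · refine setIntegral_congr_fun hmeas fun y hy => ?_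
    have hy1 : y ∈ (c.extend (𝓡∂ 3)).target := hy.1
    have hy2 : (c.extend (𝓡∂ 3)).symm y ∈ c'.source := by
      simpa [OpenPartialHomeomorph.extend_source] using hy.2
    have hpos := hdet _ ⟨symm_mem_source hy1, hy2⟩
    rw [(c.extend (𝓡∂ 3)).right_inv hy1] at hpos
    rw [chartRep_transition hc hc' α hy1 hy2, top_form_comp, symm_transition hy2,
      abs_of_pos hpos, smul_comm]
  · intro y hy
    have hy1 : y ∈ (c.extend (𝓡∂ 3)).target := hy.1
    have hy2 : (c.extend (𝓡∂ 3)).symm y ∈ c'.source := by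
      simpa [OpenPartialHomeomorph.extend_source] using hy.2
    exact ((contDiffWithinAt_transition hc hc' hy1 hy2).differentiableWithinAt
      (by simp)).hasFDerivWithinAt.mono fun z hz => mem_range_of_mem_target hz.1

end ChangeOfVariables

/-! ### Integrability in charts and linearity of the integral. -/

section IntegralLinear

open Set Filter Topology MeasureTheory

variable {M : Type*} [TopologicalSpace M] [CompactSpace M]
  [ChartedSpace (EuclideanHalfSpace 3) M]
variable {B : Type*} [NormedRing B] [NormedAlgebra ℂ B] {k : ℕ}
variable {c : OpenPartialHomeomorph M (EuclideanHalfSpace 3)} (O : OrientedAtlas M)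

/-- The support of a function of the partition of unity, in its chart. -/
def OrientedAtlas.suppImage (i : Fin O.n) : Set E3 :=
  (O.chart i).extend (𝓡∂ 3) '' tsupport (O.ρ i)

lemma OrientedAtlas.isCompact_suppImage (i : Fin O.n) : IsCompact (O.suppImage i) :=
  (isClosed_tsupport _).isCompact.image_of_continuousOn
    (((O.chart i).continuousOn_extend).mono (by
      rw [OpenPartialHomeomorph.extend_source]; exact O.subordinate i))

lemma OrientedAtlas.suppImage_subset (i : Fin O.n) :
    O.suppImage i ⊆ ((O.chart i).extend (𝓡∂ 3)).target := by
  rintro _ ⟨x, hx, rfl⟩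
  exact extend_mem_target (O.subordinate i hx)

lemma OrientedAtlas.symm_notMem_tsupport {i : Fin O.n} {y : E3}
    (hy : y ∈ ((O.chart i).extend (𝓡∂ 3)).target \ O.suppImage i) :
    ((O.chart i).extend (𝓡∂ 3)).symm y ∉ tsupport (O.ρ i) := fun h =>
  hy.2 ⟨_, h, ((O.chart i).extend (𝓡∂ 3)).right_inv hy.1⟩

lemma OrientedAtlas.sum_eq_one (x : M) : ∑ i, O.ρ i x = 1 := by
  rw [← finsum_eq_sum_of_fintype]
  exact O.ρ.sum_eq_one (mem_univ x)

lemma OrientedAtlas.continuousOn_comp_symm (i j : Fin O.n) :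
    ContinuousOn (fun y => O.ρ j (((O.chart i).extend (𝓡∂ 3)).symm y))
      ((O.chart i).extend (𝓡∂ 3)).target :=
  (O.ρ j).contMDiff.continuous.comp_continuousOn (O.chart i).continuousOn_extend_symm

lemma IsSmoothForm.continuousOn_apply {α : DForm M B k} (hα : IsSmoothForm α)
    (hc : c ∈ IsManifold.maximalAtlas (𝓡∂ 3) ∞ M) (v : Fin k → E3) :
    ContinuousOn (fun y => chartRep c α y v) (c.extend (𝓡∂ 3)).target :=
  (ContinuousAlternatingMap.apply ℝ E3 B v).continuous.comp_continuousOn (hα c hc).continuousOn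

lemma integrableOn_chartRep {α : DForm M B k} (hα : IsSmoothForm α) (i : Fin O.n)
    (v : Fin k → E3) : IntegrableOn (fun y => O.ρ i (((O.chart i).extend (𝓡∂ 3)).symm y) •
      chartRep (O.chart i) α y v) ((O.chart i).extend (𝓡∂ 3)).target :=
  integrableOn_target ((O.continuousOn_comp_symm i i).smul
    (hα.continuousOn_apply (O.chart_mem i) v)) (O.isCompact_suppImage i) (O.suppImage_subset i)
    fun y hy => by rw [image_eq_zero_of_notMem_tsupport (O.symm_notMem_tsupport hy), zero_smul]

lemma integral_add {α β : DForm M B 3} (hα : IsSmoothForm α) (hβ : IsSmoothForm β) :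
    integral O (α + β) = integral O α + integral O β := by
  rw [integral, integral, integral, ← Finset.sum_add_distrib]
  refine Finset.sum_congr rfl fun i _ => ?_
  rw [← MeasureTheory.integral_add (integrableOn_chartRep O hα i _)
    (integrableOn_chartRep O hβ i _)]
  refine integral_congr_ae (Eventually.of_forall fun y => ?_)
  exact smul_add _ _ _

lemma integral_smul (a : ℂ) (α : DForm M B 3) : integral O (a • α) = a • integral O α := by
  rw [integral, integral, Finset.smul_sum]
  refine Finset.sum_congr rfl fun i _ => ?_
  rw [← MeasureTheory.integral_smul]
  refine integral_congr_ae (Eventually.of_forall fun y => ?_)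
  exact smul_comm _ _ _

lemma integral_sub {α β : DForm M B 3} (hα : IsSmoothForm α) (hβ : IsSmoothForm β) :
    integral O (α - β) = integral O α - integral O β := by
  rw [show α - β = α + (-1 : ℂ) • β by module, integral_add O hα (hβ.smul _), integral_smul,
    neg_one_smul, sub_eq_add_neg]

lemma integral_sum {ι : Type*} (s : Finset ι) {α : ι → DForm M B 3}
    (h : ∀ i, IsSmoothForm (α i)) : integral O (∑ i ∈ s, α i) = ∑ i ∈ s, integral O (α i) := by
  classical
  induction s using Finset.induction_on with
  | empty =>
    have h := integral_smul O 0 (0 : DForm M B 3)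
    rwa [show (0 : ℂ) • (0 : DForm M B 3) = 0 from zero_smul ℂ (0 : DForm M B 3), zero_smul] at h
  | insert i s hi ih =>
    rw [Finset.sum_insert hi, Finset.sum_insert hi, integral_add O (h i) (.sum s h), ih]

end IntegralLinear

/-! ### Stokes' theorem on the half-space. -/

section HalfSpace

open Set Filter Topology MeasureTheory

variable {B : Type*} [NormedRing B] [NormedAlgebra ℂ B]

lemma mem_range_model {y : E3} : y ∈ range (𝓡∂ 3) ↔ 0 ≤ y 0 := by
  rw [range_modelWithCornersEuclideanHalfSpace]; rfl

lemma continuous_bdryPt : Continuous bdryPt := by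
  unfold bdryPt
  refine (PiLp.continuous_toLp 2 _).comp (continuous_pi fun i => ?_)
  fin_cases i
  · exact continuous_const
  · exact (continuous_apply (0 : Fin 2)).comp (PiLp.continuous_ofLp 2 _)
  · exact (continuous_apply (1 : Fin 2)).comp (PiLp.continuous_ofLp 2 _)

/-- Stokes' theorem for a compactly supported 2-form on the half-space. -/
lemma halfSpace_stokes {β : E3 → E3 [⋀^Fin 2]→L[ℝ] B} {R : ℝ} (hR : 0 < R)
    (hβ : ContDiffOn ℝ ∞ β (range (𝓡∂ 3)))
    (h0 : ∀ y ∈ range (𝓡∂ 3), R ≤ ‖y‖ → β y = 0) :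
    ∫ y in range (𝓡∂ 3), extDerivWithin β (range (𝓡∂ 3)) y stdFrame =
      -∫ z, β (bdryPt z) ![stdVec 1, stdVec 2] := by
  let Y : (Fin 3 → ℝ) ≃L[ℝ] E3 := (PiLp.continuousLinearEquiv 2 ℝ fun _ : Fin 3 => ℝ).symm
  have hY (x : Fin 3 → ℝ) (i : Fin 3) : Y x i = x i := rfl
  let D : E3 → E3 →L[ℝ] E3 [⋀^Fin 2]→L[ℝ] B := fderivWithin ℝ β (range (𝓡∂ 3))
  -- The alternating signs make the divergence of the vector field with components `f i` equal to
  -- the coefficient of the exterior derivative.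
  let s : Fin 3 → ℝ := ![1, -1, 1]
  let v : Fin 3 → Fin 2 → E3 :=
    ![![stdVec 1, stdVec 2], ![stdVec 0, stdVec 2], ![stdVec 0, stdVec 1]]
  let A (i : Fin 3) : E3 [⋀^Fin 2]→L[ℝ] B →L[ℝ] B := s i • ContinuousAlternatingMap.apply ℝ E3 B (v i)
  let f (i : Fin 3) (x : Fin 3 → ℝ) : B := A i (β (Y x))
  let f' (i : Fin 3) (x : Fin 3 → ℝ) : (Fin 3 → ℝ) →L[ℝ] B :=
    (A i ∘L D (Y x)) ∘L (Y : (Fin 3 → ℝ) →L[ℝ] E3)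
  -- A half-box containing the part of the ball of radius `R` in the half-space. Its lower face in
  -- direction `0` lies on the boundary plane.
  let a : Fin 3 → ℝ := ![0, -R, -R]
  let b : Fin 3 → ℝ := ![R, R, R]
  have hle : a ≤ b := by
    intro i; fin_cases i <;> simp [a, b] <;> linarith
  have hbox : ∀ x ∈ Icc a b, Y x ∈ range (𝓡∂ 3) := fun x hx =>
    mem_range_model.2 (by rw [hY]; exact hx.1 0)
  have hfar : ∀ x : Fin 3 → ℝ, ∀ i, R ≤ |x i| → R ≤ ‖Y x‖ := fun x i hi =>
    hi.trans (by simpa [hY] using PiLp.norm_apply_le (Y x) i)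
  have hDc : ContinuousOn D (range (𝓡∂ 3)) :=
    hβ.continuousOn_fderivWithin (𝓡∂ 3).uniqueDiffOn (by simp)
  have hcontf' : ∀ i, ContinuousOn (fun x => f' i x (Pi.single i 1)) (Icc a b) := by
    intro i
    have h1 : ContinuousOn (fun x => D (Y x) (Y (Pi.single i 1))) (Icc a b) :=
      (hDc.comp Y.continuous.continuousOn hbox).clm_apply continuousOn_const
    exact (A i).continuous.comp_continuousOn h1
  have hdiv := integral_divergence_of_hasFDerivAt_off_countable' a b hle f f' ∅ countable_empty
    (fun i => (A i).continuous.comp_continuousOn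
      (hβ.continuousOn.comp Y.continuous.continuousOn hbox)) ?_ ?_
  rotate_left
  -- Differentiability is required only inside the open box. There `x 0 > 0`, so the derivative
  -- within the half-space is a genuine derivative.
  · rintro x ⟨hx, -⟩ i
    have hx0 : 0 < x 0 := by simpa [a] using (hx 0 (mem_univ _)).1
    have hint : range (𝓡∂ 3) ∈ 𝓝 (Y x) := by
      rw [mem_nhds_iff]
      exact ⟨_, interior_subset, isOpen_interior, by
        rw [interior_range_modelWithCornersEuclideanHalfSpace]; exact hx0⟩
    have hd : HasFDerivAt β (D (Y x)) (Y x) :=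
      ((hβ.differentiableOn (by simp)) _ (mem_of_mem_nhds hint)).hasFDerivWithinAt.hasFDerivAt hint
    exact (A i).hasFDerivAt.comp x (hd.comp x Y.hasFDerivAt)
  · exact (continuousOn_finsetSum _ fun i _ => hcontf' i).integrableOn_compact isCompact_Icc
  have hYs (i : Fin 3) : Y (Pi.single i 1) = stdVec i := by
    ext j
    rw [hY]
    simp [stdVec, Pi.single_apply]
  have hsum (x : Fin 3 → ℝ) : ∑ i, f' i x (Pi.single i 1) =
      extDerivWithin β (range (𝓡∂ 3)) (Y x) stdFrame := by
    rw [Fin.sum_univ_three, extDerivWithin, stdFrame, alternatizeUncurryFin_two_apply]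
    simp [f', A, s, v, hYs, D, sub_eq_add_neg]
  have hpre : MeasurePreserving Y volume volume := PiLp.volume_preserving_toLp (Fin 3)
  have hemb : MeasurableEmbedding Y := Y.toHomeomorph.measurableEmbedding
  have hlhs : ∫ y in range (𝓡∂ 3), extDerivWithin β (range (𝓡∂ 3)) y stdFrame =
      ∫ x in Icc a b, ∑ i, f' i x (Pi.single i 1) := by
    simp only [hsum]
    rw [← hpre.setIntegral_preimage_emb hemb]
    refine setIntegral_eq_of_subset_of_forall_sdiff_eq_zero
      ((𝓡∂ 3).isClosed_range.measurableSet.preimage hemb.measurable) hbox ?_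
    rintro x ⟨hx, hx'⟩
    have hlt : R < ‖Y x‖ := by
      by_contra! hcon
      refine hx' ⟨fun i => ?_, fun i => ?_⟩
      · have h1 := mem_range_model.1 hx
        have h2 := abs_le.1 ((PiLp.norm_apply_le (Y x) i).trans hcon)
        rw [hY] at h1 h2
        fin_cases i
        · exact h1
        · exact h2.1
        · exact h2.1
      · have h2 := abs_le.1 ((PiLp.norm_apply_le (Y x) i).trans hcon)
        rw [hY] at h2
        fin_cases i
        · exact h2.2
        · exact h2.2
        · exact h2.2
    have hev : β =ᶠ[𝓝[range (𝓡∂ 3)] Y x] fun _ => 0 := by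
      filter_upwards [self_mem_nhdsWithin, mem_nhdsWithin_of_mem_nhds
        ((isOpen_lt continuous_const continuous_norm).mem_nhds hlt)] with y hy hy'
      exact h0 y hy (le_of_lt hy')
    rw [extDerivWithin, hev.fderivWithin_eq_of_mem hx, fderivWithin_const_apply]
    exact congrArg (fun g : E3 [⋀^Fin 3]→L[ℝ] B => g stdFrame)
      (map_zero (ContinuousAlternatingMap.alternatizeUncurryFinCLM (n := 2) ℝ E3 B))
  -- On each of the other five faces some coordinate has absolute value `R`, so the form vanishes
  -- there.
  have hface : ∀ (i : Fin 3) (t : ℝ) (z : Fin 2 → ℝ), R ≤ |t| →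
      z ∈ Icc (a ∘ i.succAbove) (b ∘ i.succAbove) → a i ≤ t → t ≤ b i →
      f i (i.insertNth t z) = 0 := by
    intro i t z ht hz hat htb
    have hmem : i.insertNth t z ∈ Icc a b := by
      constructor
      · rw [Fin.le_insertNth_iff]; exact ⟨hat, hz.1⟩
      · rw [Fin.insertNth_le_iff]; exact ⟨htb, hz.2⟩
    have hz0 : β (Y (i.insertNth t z)) = 0 :=
      h0 _ (hbox _ hmem) (hfar _ i (by rwa [Fin.insertNth_apply_same]))
    simp only [f, hz0, map_zero]
  have hface0 : ∀ (i : Fin 3) (t : ℝ), R ≤ |t| → a i ≤ t → t ≤ b i →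
      ∫ z in Icc (a ∘ i.succAbove) (b ∘ i.succAbove), f i (i.insertNth t z) = 0 := by
    intro i t ht hat htb
    rw [setIntegral_congr_fun measurableSet_Icc fun z hz => hface i t z ht hz hat htb]
    simp
  have hbd : ∀ z : Fin 2 → ℝ, Y ((0 : Fin 3).insertNth 0 z) = bdryPt (WithLp.toLp 2 z) := by
    intro z
    ext j
    rw [hY]
    fin_cases j <;> rfl
  have hback : ∫ z in Icc (a ∘ (0 : Fin 3).succAbove) (b ∘ (0 : Fin 3).succAbove),
      f 0 ((0 : Fin 3).insertNth (a 0) z) = ∫ z, β (bdryPt z) ![stdVec 1, stdVec 2] := by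
    have hf0 (z : Fin 2 → ℝ) : f 0 ((0 : Fin 3).insertNth (a 0) z) =
        β (bdryPt (WithLp.toLp 2 z)) ![stdVec 1, stdVec 2] := by
      rw [← hbd]
      simp [f, A, s, v, a]
    simp only [hf0]
    rw [← (PiLp.volume_preserving_toLp (Fin 2)).integral_comp
      (MeasurableEquiv.toLp 2 (Fin 2 → ℝ)).measurableEmbedding]
    refine setIntegral_eq_integral_of_forall_compl_eq_zero fun z hz => ?_
    have hr : bdryPt (WithLp.toLp 2 z) ∈ range (𝓡∂ 3) := mem_range_model.2 le_rfl
    have hnorm : R ≤ ‖bdryPt (WithLp.toLp 2 z)‖ := by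
      by_contra! hcon
      have h1 := abs_le.1 ((PiLp.norm_apply_le (bdryPt (WithLp.toLp 2 z)) 1).trans hcon.le)
      have h2 := abs_le.1 ((PiLp.norm_apply_le (bdryPt (WithLp.toLp 2 z)) 2).trans hcon.le)
      refine hz ⟨fun i => ?_, fun i => ?_⟩
      · fin_cases i
        · exact h1.1
        · exact h2.1
      · fin_cases i
        · exact h1.2
        · exact h2.2
    rw [h0 _ hr hnorm]
    rfl
  -- Only the face `y 0 = 0` survives. It is a lower face, so the divergence theorem counts it
  -- negatively.
  rw [hlhs, hdiv, Fin.sum_univ_three, hback, hface0 0 (b 0), hface0 1 (b 1), hface0 1 (a 1),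
    hface0 2 (b 2), hface0 2 (a 2)]
  · simp
  all_goals simp [a, b, abs_of_pos hR] <;> linarith

end HalfSpace

/-! ### Globalization of Stokes' theorem by the partition of unity. -/

section Stokes

open Set Filter Topology MeasureTheory

variable {M : Type*} [TopologicalSpace M] [CompactSpace M]
  [ChartedSpace (EuclideanHalfSpace 3) M] [IsManifold (𝓡∂ 3) ∞ M]
variable {B : Type*} [NormedRing B] [NormedAlgebra ℂ B] {k : ℕ}
variable (O : OrientedAtlas M)

lemma extDerivWithin_eq_zero {β : E3 → E3 [⋀^Fin k]→L[ℝ] B} {s : Set E3} {y : E3} (hy : y ∈ s)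
    (h : β =ᶠ[𝓝[s] y] fun _ => 0) : extDerivWithin β s y = 0 := by
  rw [extDerivWithin, h.fderivWithin_eq_of_mem hy, fderivWithin_const_apply]
  exact map_zero (ContinuousAlternatingMap.alternatizeUncurryFinCLM (n := k) ℝ E3 B)

/-- A function of the partition of unity, with values in `B`. -/
def OrientedAtlas.cutoff (B : Type*) [NormedRing B] [NormedAlgebra ℂ B] (j : Fin O.n) (x : M) : B :=
  O.ρ j x • (1 : B)

lemma OrientedAtlas.contMDiff_cutoff (j : Fin O.n) :
    ContMDiff (𝓡∂ 3) 𝓘(ℝ, B) ∞ (O.cutoff B j) :=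
  (O.ρ j).contMDiff.smul contMDiff_const

lemma OrientedAtlas.lmul_cutoff (j : Fin O.n) (α : DForm M B k) (x : M) :
    lmul (O.cutoff B j) α x = O.ρ j x • α x := by
  ext v
  rw [lmul_eq, lmulL_apply, OrientedAtlas.cutoff, smul_one_mul]
  rfl

lemma OrientedAtlas.chartRep_lmul_cutoff {c : OpenPartialHomeomorph M (EuclideanHalfSpace 3)}
    (j : Fin O.n) (α : DForm M B k) (y : E3) :
    chartRep c (lmul (O.cutoff B j) α) y =
      O.ρ j ((c.extend (𝓡∂ 3)).symm y) • chartRep c α y := by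
  rw [chartRep_apply, O.lmul_cutoff]
  rfl

lemma OrientedAtlas.sum_lmul_cutoff (α : DForm M B k) :
    ∑ j, lmul (O.cutoff B j) α = α := by
  funext x
  rw [Finset.sum_apply]
  simp only [O.lmul_cutoff]
  rw [← Finset.sum_smul, O.sum_eq_one, one_smul]

/-- In every chart, a form that is cut off vanishes near the points outside of the support. -/
lemma OrientedAtlas.chartRep_lmul_cutoff_eventuallyEq
    {c : OpenPartialHomeomorph M (EuclideanHalfSpace 3)} (j : Fin O.n) (α : DForm M B k) {y : E3}
    (hy : y ∈ (c.extend (𝓡∂ 3)).target) (hj : (c.extend (𝓡∂ 3)).symm y ∉ tsupport (O.ρ j)) :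
    chartRep c (lmul (O.cutoff B j) α) =ᶠ[𝓝[range (𝓡∂ 3)] y] fun _ => 0 := by
  filter_upwards [symm_mem_nhdsWithin hy (isClosed_tsupport _).isOpen_compl hj] with z hz
  rw [O.chartRep_lmul_cutoff, image_eq_zero_of_notMem_tsupport hz]
  exact zero_smul ℝ (chartRep c α z)

/-- The exterior derivative is local: the complement of the closed support is open, so the cut-off
form vanishes on a neighbourhood of `x`. -/
lemma OrientedAtlas.extD_lmul_cutoff_eq_zero {β : DForm M B k} (hβ : IsSmoothForm β)
    (j : Fin O.n) {x : M} (hx : x ∉ tsupport (O.ρ j)) :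
    extD (lmul (O.cutoff B j) β) x = 0 := by
  have hxs := mem_chart_source (EuclideanHalfSpace 3) x
  have hc := IsManifold.chart_mem_maximalAtlas (I := 𝓡∂ 3) (n := ∞) x
  have hy := extend_mem_target hxs
  have hx' : ((chartAt (EuclideanHalfSpace 3) x).extend (𝓡∂ 3)).symm
      ((chartAt (EuclideanHalfSpace 3) x).extend (𝓡∂ 3) x) ∉ tsupport (O.ρ j) := by
    rwa [OpenPartialHomeomorph.extend_left_inv _ hxs]
  rw [eq_chartRep_comp hc hxs (extD (lmul (O.cutoff B j) β)),
    chartRep_extD (hβ.lmul (O.contMDiff_cutoff j)) hc hy, extDerivWithin_eq_zero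
      (mem_range_of_mem_target hy) (O.chartRep_lmul_cutoff_eventuallyEq j β hy hx')]
  rfl

/-- Stokes' theorem for a form that is supported in a chart of the atlas. -/
lemma OrientedAtlas.chart_stokes {β : DForm M B 2} (hβ : IsSmoothForm β) (j : Fin O.n) :
    ∫ y in ((O.chart j).extend (𝓡∂ 3)).target,
        chartRep (O.chart j) (extD (lmul (O.cutoff B j) β)) y stdFrame =
      -∫ z in {z : EuclideanSpace ℝ (Fin 2) |
          bdryPt z ∈ ((O.chart j).extend (𝓡∂ 3)).target},
        O.ρ j (((O.chart j).extend (𝓡∂ 3)).symm (bdryPt z)) •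
          chartRep (O.chart j) β (bdryPt z) ![stdVec 1, stdVec 2] := by
  set T := ((O.chart j).extend (𝓡∂ 3)).target with hT
  set γ := lmul (O.cutoff B j) β with hγ
  have hγs : IsSmoothForm γ := hβ.lmul (O.contMDiff_cutoff j)
  have hTr : T ⊆ range (𝓡∂ 3) := fun y hy => mem_range_of_mem_target hy
  -- Extension by zero to the whole half-space. It stays smooth because the support of the cutoff is
  -- compact inside the target: every point is in the support, hence in the target, or has a
  -- neighbourhood where `θ` vanishes.
  let θ : E3 → E3 [⋀^Fin 2]→L[ℝ] B := T.indicator (chartRep (O.chart j) γ)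
  have hθT : ∀ y ∈ T, θ =ᶠ[𝓝[range (𝓡∂ 3)] y] chartRep (O.chart j) γ := by
    intro y hy
    filter_upwards [target_mem_nhdsWithin hy] with z hz using indicator_of_mem hz _
  have hzero : ∀ y ∉ O.suppImage j, θ y = 0 := by
    intro y hy
    by_cases hyT : y ∈ T
    · simp only [θ, indicator_of_mem hyT, hγ, O.chartRep_lmul_cutoff]
      rw [image_eq_zero_of_notMem_tsupport (O.symm_notMem_tsupport ⟨hyT, hy⟩)]
      exact zero_smul ℝ (chartRep (O.chart j) β y)
    · exact indicator_of_notMem hyT _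
  have hev : ∀ y ∉ O.suppImage j, θ =ᶠ[𝓝[range (𝓡∂ 3)] y] fun _ => 0 := by
    intro y hy
    filter_upwards [mem_nhdsWithin_of_mem_nhds
      ((O.isCompact_suppImage j).isClosed.isOpen_compl.mem_nhds hy)] with z hz using hzero z hz
  have hsmooth : ContDiffOn ℝ ∞ θ (range (𝓡∂ 3)) := by
    intro y hy
    by_cases hyK : y ∈ O.suppImage j
    · have hyT := O.suppImage_subset j hyK
      exact (hγs.contDiffWithinAt (O.chart_mem j) hyT).congr_of_eventuallyEq_of_mem (hθT y hyT) hy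
    · exact contDiffWithinAt_const.congr_of_eventuallyEq_of_mem (hev y hyK) hy
  obtain ⟨R, hR, hKR⟩ := (O.isCompact_suppImage j).isBounded.subset_ball_lt 0 0
  have hst := halfSpace_stokes hR hsmooth fun y _ hy => hzero y fun hyK => by
    have := hKR hyK
    rw [mem_ball_zero_iff] at this
    linarith
  have hleft : ∫ y in range (𝓡∂ 3), extDerivWithin θ (range (𝓡∂ 3)) y stdFrame =
      ∫ y in T, chartRep (O.chart j) (extD γ) y stdFrame := by
    rw [setIntegral_eq_of_subset_of_forall_sdiff_eq_zero (𝓡∂ 3).isClosed_range.measurableSet hTr]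
    · refine setIntegral_congr_fun measurableSet_target fun y hy => ?_
      rw [chartRep_extD hγs (O.chart_mem j) hy, (hθT y hy).extDerivWithin_eq_of_mem (hTr hy)]
    · rintro y ⟨hy, hyT⟩
      rw [extDerivWithin_eq_zero hy (hev y fun h => hyT (O.suppImage_subset j h))]
      rfl
  have hm : MeasurableSet {z : EuclideanSpace ℝ (Fin 2) | bdryPt z ∈ T} :=
    continuous_bdryPt.measurable measurableSet_target
  rw [← hleft, hst, ← integral_indicator hm]
  congr 2
  funext z
  by_cases hz : bdryPt z ∈ T
  · rw [indicator_of_mem (show z ∈ {z | bdryPt z ∈ T} from hz)]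
    simp only [θ, indicator_of_mem hz, hγ, O.chartRep_lmul_cutoff]
    rfl
  · rw [indicator_of_notMem (show z ∉ {z | bdryPt z ∈ T} from hz)]
    simp only [θ, indicator_of_notMem hz]
    rfl

/-- The integral of a form that is cut off is an integral over one chart. -/
lemma OrientedAtlas.integral_extD_lmul_cutoff {β : DForm M B 2} (hβ : IsSmoothForm β)
    (j : Fin O.n) : integral O (extD (lmul (O.cutoff B j) β)) =
      ∫ y in ((O.chart j).extend (𝓡∂ 3)).target,
        chartRep (O.chart j) (extD (lmul (O.cutoff B j) β)) y stdFrame := by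
  set γ := extD (lmul (O.cutoff B j) β) with hγ
  have hγs : IsSmoothForm γ := (hβ.lmul (O.contMDiff_cutoff j)).extD
  have hγ0 : ∀ x ∉ tsupport (O.ρ j), γ x = 0 := fun x hx => O.extD_lmul_cutoff_eq_zero hβ j hx
  -- The product of `ρ i` and `γ` is supported in both charts `i` and `j`, so every summand of the
  -- integral can be moved to chart `j`, where the functions `ρ i` add up to `1`.
  have h1 (i : Fin O.n) : ∫ y in ((O.chart i).extend (𝓡∂ 3)).target,
        O.ρ i (((O.chart i).extend (𝓡∂ 3)).symm y) • chartRep (O.chart i) γ y stdFrame =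
      ∫ y in ((O.chart j).extend (𝓡∂ 3)).target,
        O.ρ i (((O.chart j).extend (𝓡∂ 3)).symm y) • chartRep (O.chart j) γ y stdFrame := by
    refine integral_chartRep_eq (O.chart_mem i) (O.chart_mem j) (O.oriented i j) _ γ ?_ ?_
    · rintro x ⟨-, hx⟩
      rw [hγ0 x fun h => hx (O.subordinate j h)]
      exact smul_zero (A := E3 [⋀^Fin 3]→L[ℝ] B) (O.ρ i x)
    · rintro x ⟨-, hx⟩
      rw [image_eq_zero_of_notMem_tsupport fun h => hx (O.subordinate i h)]
      exact zero_smul ℝ (γ x)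
  have hint (i : Fin O.n) : IntegrableOn (fun y =>
      O.ρ i (((O.chart j).extend (𝓡∂ 3)).symm y) • chartRep (O.chart j) γ y stdFrame)
      ((O.chart j).extend (𝓡∂ 3)).target := by
    refine integrableOn_target ((O.continuousOn_comp_symm j i).smul
      (hγs.continuousOn_apply (O.chart_mem j) _)) (O.isCompact_suppImage j) (O.suppImage_subset j)
      fun y hy => ?_
    rw [chartRep_apply, hγ0 _ (O.symm_notMem_tsupport hy)]
    exact smul_zero _
  rw [integral, Finset.sum_congr rfl fun i _ => h1 i, ← integral_finsetSum _ fun i _ => hint i]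
  refine integral_congr_ae (Eventually.of_forall fun y => ?_)
  simp only [← Finset.sum_smul, O.sum_eq_one, one_smul]

/-- **Stokes' theorem** on a compact oriented 3-manifold with boundary. -/
theorem integral_extD {β : DForm M B 2} (hβ : IsSmoothForm β) :
    integral O (extD β) = bdryIntegral O β := by
  have hs (j : Fin O.n) : IsSmoothForm (lmul (O.cutoff B j) β) := hβ.lmul (O.contMDiff_cutoff j)
  -- Only the left side is decomposed: the definition of `bdryIntegral` already weights chart `j` by
  -- `ρ j`, so no change of boundary charts is needed.
  conv_lhs => rw [← O.sum_lmul_cutoff β]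
  rw [extD_sum _ hs, integral_sum O _ fun j => (hs j).extD, bdryIntegral, ← Finset.sum_neg_distrib]
  refine Finset.sum_congr rfl fun j _ => ?_
  rw [O.integral_extD_lmul_cutoff hβ, O.chart_stokes hβ]

end Stokes

/-! ### Bilinearity and exchange rules of the wedge product. -/

section Bilinearity

variable {M : Type*} [TopologicalSpace M] [ChartedSpace (EuclideanHalfSpace 3) M]
variable {B : Type*} [NormedRing B] [NormedAlgebra ℂ B] {k : ℕ}

lemma DForm.ext_apply {α β : DForm M B k} (h : ∀ x v, α x v = β x v) : α = β := by
  funext x; ext v; exact h x v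

lemma wedge_apply (α : DForm M B 1) (β : DForm M B k) (x : M) (v : Fin (k + 1) → E3) :
    wedge α β x v = ∑ i, (-1) ^ i.val • (α x (fun _ => v i) * β x (i.removeNth v)) :=
  wedgeL_apply _ _ _

lemma lmul_apply (f : M → B) (α : DForm M B k) (x : M) (v : Fin k → E3) :
    lmul f α x v = f x * α x v := rfl

lemma rmul_apply (f : M → B) (α : DForm M B k) (x : M) (v : Fin k → E3) :
    rmul α f x v = α x v * f x := rfl

lemma DForm.add_apply (α β : DForm M B k) (x : M) (v : Fin k → E3) :
    (α + β) x v = α x v + β x v := rfl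

lemma DForm.sub_apply (α β : DForm M B k) (x : M) (v : Fin k → E3) :
    (α - β) x v = α x v - β x v := rfl

lemma DForm.smul_apply (a : ℂ) (α : DForm M B k) (x : M) (v : Fin k → E3) :
    (a • α) x v = a • α x v := rfl

lemma DForm.sum_apply {ι : Type*} (s : Finset ι) (α : ι → DForm M B k) (x : M)
    (v : Fin k → E3) : (∑ i ∈ s, α i) x v = ∑ i ∈ s, α i x v := by
  classical
  induction s using Finset.induction_on with
  | empty => rfl
  | insert i s hi ih => rw [Finset.sum_insert hi, Finset.sum_insert hi, DForm.add_apply, ih]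

/-- The wedge product as a bilinear map. -/
def wedgeBilin (M : Type*) [TopologicalSpace M] [ChartedSpace (EuclideanHalfSpace 3) M]
    (B : Type*) [NormedRing B] [NormedAlgebra ℂ B] (k : ℕ) :
    DForm M B 1 →ₗ[ℂ] DForm M B k →ₗ[ℂ] DForm M B (k + 1) :=
  LinearMap.mk₂ ℂ wedge
    (fun α α' β => DForm.ext_apply fun x v => by
      simp only [wedge_apply, DForm.add_apply, add_mul, smul_add, Finset.sum_add_distrib])
    (fun a α β => DForm.ext_apply fun x v => by
      simp only [wedge_apply, DForm.smul_apply, smul_mul_assoc, Finset.smul_sum]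
      exact Finset.sum_congr rfl fun i _ => smul_comm _ _ _)
    (fun α β β' => DForm.ext_apply fun x v => by
      simp only [wedge_apply, DForm.add_apply, mul_add, smul_add, Finset.sum_add_distrib])
    (fun a α β => DForm.ext_apply fun x v => by
      simp only [wedge_apply, DForm.smul_apply, mul_smul_comm, Finset.smul_sum]
      exact Finset.sum_congr rfl fun i _ => smul_comm _ _ _)

lemma wedge_add_left (α α' : DForm M B 1) (β : DForm M B k) :
    wedge (α + α') β = wedge α β + wedge α' β := (wedgeBilin M B k).map_add₂ α α' β

lemma wedge_neg_left (α : DForm M B 1) (β : DForm M B k) :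
    wedge (-α) β = -wedge α β := (wedgeBilin M B k).map_neg₂ α β

lemma wedge_smul_left (a : ℂ) (α : DForm M B 1) (β : DForm M B k) :
    wedge (a • α) β = a • wedge α β := (wedgeBilin M B k).map_smul₂ a α β

lemma wedge_zero_left (β : DForm M B k) : wedge (0 : DForm M B 1) β = 0 :=
  (wedgeBilin M B k).map_zero₂ β

lemma wedge_sub_right (α : DForm M B 1) (β β' : DForm M B k) :
    wedge α (β - β') = wedge α β - wedge α β' := (wedgeBilin M B k α).map_sub β β'

lemma wedge_neg_right (α : DForm M B 1) (β : DForm M B k) :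
    wedge α (-β) = -wedge α β := (wedgeBilin M B k α).map_neg β

lemma wedge_smul_right (a : ℂ) (α : DForm M B 1) (β : DForm M B k) :
    wedge α (a • β) = a • wedge α β := (wedgeBilin M B k α).map_smul a β

lemma wedge_zero_right (α : DForm M B 1) : wedge α (0 : DForm M B k) = 0 :=
  (wedgeBilin M B k α).map_zero

/-- Exchanging the values contributes `s`, and exchanging the two form degrees contributes `-1`.
Thus even 1-forms anticommute and odd ones commute. -/
lemma wedge_comm_of (s : ℂ) {α β : DForm M B 1}
    (h : ∀ x u v, α x u * β x v = s • (β x v * α x u)) : wedge α β = -s • wedge β α :=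
  funext fun x => alternating_ext_two fun u v => by
    change wedgeL B 1 (α x) (β x) ![u, v] = -s • wedgeL B 1 (β x) (α x) ![u, v]
    rw [wedgeL_one_apply, wedgeL_one_apply, h, h]
    module

lemma wedge_left_comm_of (s : ℂ) {α β γ : DForm M B 1}
    (h : ∀ x u v, α x u * β x v = s • (β x v * α x u)) :
    wedge α (wedge β γ) = -s • wedge β (wedge α γ) :=
  funext fun x => alternating_ext_three fun u v w => by
    change wedgeL B (1 + 1) (α x) (wedgeL B 1 (β x) (γ x)) ![u, v, w] =
      -s • wedgeL B (1 + 1) (β x) (wedgeL B 1 (α x) (γ x)) ![u, v, w]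
    simp only [wedgeL_two_apply, wedgeL_one_apply, mul_sub, ← mul_assoc, h]
    simp only [smul_mul_assoc]
    module

lemma wedge_lmul_left (f : M → B) (α : DForm M B 1) (β : DForm M B k) :
    wedge (lmul f α) β = lmul f (wedge α β) := DForm.ext_apply fun x v => by
  simp only [wedge_apply, lmul_apply, mul_assoc, Finset.mul_sum, mul_smul_comm]

lemma wedge_lmul_right_of (s : ℂ) {f : M → B} {α : DForm M B 1} (β : DForm M B k)
    (h : ∀ x v, α x v * f x = s • (f x * α x v)) :
    wedge α (lmul f β) = s • lmul f (wedge α β) := DForm.ext_apply fun x v => by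
  simp only [wedge_apply, lmul_apply, DForm.smul_apply, Finset.mul_sum, Finset.smul_sum,
    ← mul_assoc, h, smul_mul_assoc, mul_smul_comm]
  exact Finset.sum_congr rfl fun i _ => smul_comm _ _ _

/-- Multiplication of forms by functions, as a bilinear map. -/
def lmulBilin (M : Type*) [TopologicalSpace M] [ChartedSpace (EuclideanHalfSpace 3) M]
    (B : Type*) [NormedRing B] [NormedAlgebra ℂ B] (k : ℕ) :
    (M → B) →ₗ[ℂ] DForm M B k →ₗ[ℂ] DForm M B k :=
  LinearMap.mk₂ ℂ lmul
    (fun _ _ _ => DForm.ext_apply fun _ _ => add_mul _ _ _)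
    (fun a f α => DForm.ext_apply fun x v => smul_mul_assoc a (f x) (α x v))
    (fun _ _ _ => DForm.ext_apply fun _ _ => mul_add _ _ _)
    (fun a f α => DForm.ext_apply fun x v => mul_smul_comm a (f x) (α x v))

lemma lmul_smul_left (a : ℂ) (f : M → B) (α : DForm M B k) :
    lmul (a • f) α = a • lmul f α := (lmulBilin M B k).map_smul₂ a f α

end Bilinearity

/-! ### Parity of forms and the resulting sign rules. -/

section Parity

variable {M : Type*} [TopologicalSpace M] [ChartedSpace (EuclideanHalfSpace 3) M]
variable {B : Type*} [NormedRing B] [NormedAlgebra ℂ B] {k : ℕ}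
variable {𝒜 : ZMod 2 → Submodule ℂ B}

/-- The values of a form are homogeneous of degree `i`. -/
def DForm.HasParity (𝒜 : ZMod 2 → Submodule ℂ B) (i : ZMod 2) (α : DForm M B k) : Prop :=
  ∀ x v, α x v ∈ 𝒜 i

namespace DForm.HasParity

variable {i j : ZMod 2} {α β : DForm M B k}

lemma zero : HasParity 𝒜 i (0 : DForm M B k) := fun _ _ => (𝒜 i).zero_mem

lemma add (hα : HasParity 𝒜 i α) (hβ : HasParity 𝒜 i β) : HasParity 𝒜 i (α + β) :=
  fun x v => (𝒜 i).add_mem (hα x v) (hβ x v)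

lemma sub (hα : HasParity 𝒜 i α) (hβ : HasParity 𝒜 i β) : HasParity 𝒜 i (α - β) :=
  fun x v => (𝒜 i).sub_mem (hα x v) (hβ x v)

lemma smul (a : ℂ) (hα : HasParity 𝒜 i α) : HasParity 𝒜 i (a • α) :=
  fun x v => (𝒜 i).smul_mem a (hα x v)

lemma sum {ι : Type*} (s : Finset ι) {α : ι → DForm M B k} (h : ∀ m, HasParity 𝒜 i (α m)) :
    HasParity 𝒜 i (∑ m ∈ s, α m) := fun x v => by
  rw [DForm.sum_apply]
  exact (𝒜 i).sum_mem fun m _ => h m x v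

lemma rmul [GradedAlgebra 𝒜] {f : M → B} (hα : HasParity 𝒜 i α) (hf : ∀ x, f x ∈ 𝒜 j) :
    HasParity 𝒜 (i + j) (rmul α f) := fun x v => SetLike.mul_mem_graded (hα x v) (hf x)

lemma lmul [GradedAlgebra 𝒜] {f : M → B} (hf : ∀ x, f x ∈ 𝒜 i) (hα : HasParity 𝒜 j α) :
    HasParity 𝒜 (i + j) (lmul f α) := fun x v => SetLike.mul_mem_graded (hf x) (hα x v)

lemma bar {ψ : Fin 2 → DForm M B k} (h : ∀ m, HasParity 𝒜 i (ψ m)) (m : Fin 2) :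
    HasParity 𝒜 i (bar ψ m) := sum _ fun n => (h n).smul _

end DForm.HasParity

namespace IsSupercommutative

lemma dFun [IsManifold (𝓡∂ 3) ∞ M] (h𝒜 : IsSupercommutative 𝒜) {i : ZMod 2} {f : M → B}
    (hf : ContMDiff (𝓡∂ 3) 𝓘(ℝ, B) ∞ f)
    (h : ∀ x, f x ∈ 𝒜 i) : DForm.HasParity 𝒜 i (dFun f) := fun x v =>
  dFun_mem (S := (𝒜 i).restrictScalars ℝ) (h𝒜.closed i) hf h x v

lemma even_wedge_comm (h𝒜 : IsSupercommutative 𝒜)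
    {α : DForm M B 1} (hα : DForm.HasParity 𝒜 0 α) (β : DForm M B 1) :
    wedge α β = -wedge β α := by
  rw [wedge_comm_of 1 fun x u v => by rw [one_smul, h𝒜.even_comm _ (hα x u)]]
  module

lemma even_wedge_left_comm (h𝒜 : IsSupercommutative 𝒜)
    {α : DForm M B 1} (hα : DForm.HasParity 𝒜 0 α) (β γ : DForm M B 1) :
    wedge α (wedge β γ) = -wedge β (wedge α γ) := by
  rw [wedge_left_comm_of 1 fun x u v => by rw [one_smul, h𝒜.even_comm _ (hα x u)]]
  module

lemma odd_wedge_comm (h𝒜 : IsSupercommutative 𝒜) {α β : DForm M B 1} (hα : DForm.HasParity 𝒜 1 α)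
    (hβ : DForm.HasParity 𝒜 1 β) : wedge α β = wedge β α := by
  rw [wedge_comm_of (-1) fun x u v => by
    rw [h𝒜.odd_anticomm _ (hα x u) _ (hβ x v)]; module]
  module

lemma odd_wedge_left_comm (h𝒜 : IsSupercommutative 𝒜)
    {α β : DForm M B 1} (hα : DForm.HasParity 𝒜 1 α)
    (hβ : DForm.HasParity 𝒜 1 β) (γ : DForm M B 1) :
    wedge α (wedge β γ) = wedge β (wedge α γ) := by
  rw [wedge_left_comm_of (-1) fun x u v => by
    rw [h𝒜.odd_anticomm _ (hα x u) _ (hβ x v)]; module]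
  module

lemma extD_even_wedge [IsManifold (𝓡∂ 3) ∞ M] (h𝒜 : IsSupercommutative 𝒜)
    {α β : DForm M B 1} (hα : IsSmoothForm α)
    (hβ : IsSmoothForm β) (h : DForm.HasParity 𝒜 0 α) :
    extD (wedge α β) = wedge β (extD α) - wedge α (extD β) := by
  rw [extD_wedge hα hβ 1 fun x y u v => by rw [one_smul, h𝒜.even_comm _ (h x u)]]
  module

lemma extD_odd_wedge [IsManifold (𝓡∂ 3) ∞ M] (h𝒜 : IsSupercommutative 𝒜)
    {α β : DForm M B 1} (hα : IsSmoothForm α)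
    (hβ : IsSmoothForm β) (h : DForm.HasParity 𝒜 1 α) (h' : DForm.HasParity 𝒜 1 β) :
    extD (wedge α β) = -wedge β (extD α) - wedge α (extD β) := by
  rw [extD_wedge hα hβ (-1) fun x y u v => by
    rw [h𝒜.odd_anticomm _ (h x u) _ (h' y v)]; module]
  module

lemma rmul_even (h𝒜 : IsSupercommutative 𝒜)
    {f : M → B} (hf : ∀ x, f x ∈ 𝒜 0) (α : DForm M B k) : rmul α f = lmul f α :=
  DForm.ext_apply fun x _ => (h𝒜.even_comm _ (hf x) _).symm

lemma even_rmul (h𝒜 : IsSupercommutative 𝒜)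
    {α : DForm M B k} (hα : DForm.HasParity 𝒜 0 α) (f : M → B) :
    rmul α f = lmul f α :=
  DForm.ext_apply fun x v => h𝒜.even_comm _ (hα x v) _

lemma odd_wedge_lmul (h𝒜 : IsSupercommutative 𝒜)
    {α : DForm M B 1} (hα : DForm.HasParity 𝒜 1 α) {f : M → B}
    (hf : ∀ x, f x ∈ 𝒜 1) (β : DForm M B k) : wedge α (lmul f β) = -lmul f (wedge α β) := by
  rw [wedge_lmul_right_of (-1) β fun x v => by
    rw [h𝒜.odd_anticomm _ (hα x v) _ (hf x)]; module]
  module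

end IsSupercommutative

end Parity

/-! ### Explicit entries of the metric, the Levi-Civita symbol and the gamma matrices. -/

section Tables

open Complex

lemma Γ_entries : (Γ 0 0 0 = 0 ∧ Γ 0 0 1 = 1 ∧ Γ 0 1 0 = -1 ∧ Γ 0 1 1 = 0) ∧
    (Γ 1 0 0 = 0 ∧ Γ 1 0 1 = 1 ∧ Γ 1 1 0 = 1 ∧ Γ 1 1 1 = 0) ∧
    (Γ 2 0 0 = 1 ∧ Γ 2 0 1 = 0 ∧ Γ 2 1 0 = 0 ∧ Γ 2 1 1 = -1) :=
  ⟨⟨rfl, rfl, rfl, rfl⟩, ⟨rfl, rfl, rfl, rfl⟩, ⟨rfl, rfl, rfl, rfl⟩⟩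

lemma η_entries : (η 0 0 = -1 ∧ η 0 1 = 0 ∧ η 0 2 = 0) ∧ (η 1 0 = 0 ∧ η 1 1 = 1 ∧ η 1 2 = 0) ∧
    (η 2 0 = 0 ∧ η 2 1 = 0 ∧ η 2 2 = 1) := by
  refine ⟨⟨?_, ?_, ?_⟩, ⟨?_, ?_, ?_⟩, ?_, ?_, ?_⟩ <;> rw [η, Matrix.diagonal_apply] <;> rfl

lemma ε_entries : ε 0 1 2 = 1 ∧ ε 1 2 0 = 1 ∧ ε 2 0 1 = 1 ∧ ε 1 0 2 = -1 ∧ ε 0 2 1 = -1 ∧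
    ε 2 1 0 = -1 := by
  refine ⟨?_, ?_, ?_, ?_, ?_, ?_⟩ <;> norm_num [ε]

lemma ε_eq_zero (a b : Fin 3) : ε a a b = 0 ∧ ε a b a = 0 ∧ ε b a a = 0 := by
  refine ⟨?_, ?_, ?_⟩ <;> simp [ε]

lemma chargeConj_entries : chargeConj 0 0 = 0 ∧ chargeConj 0 1 = -I ∧ chargeConj 1 0 = I ∧
    chargeConj 1 1 = 0 := by
  simp only [chargeConj, Matrix.smul_apply, Γ_entries, smul_eq_mul, mul_zero, mul_one, mul_neg,
    neg_neg, and_self]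

/-- In this representation `chargeConj` is the second Pauli matrix, whose square is `1`. -/
lemma chargeConj_inv : chargeConj⁻¹ = chargeConj := by
  refine Matrix.inv_eq_left_inv (Matrix.ext fun i j => ?_)
  rw [Matrix.mul_apply, Fin.sum_univ_two]
  revert i j
  simp only [Fin.forall_fin_two, chargeConj_entries]
  simp

lemma Γup_eq : Γup 0 = -Γ 0 ∧ Γup 1 = Γ 1 ∧ Γup 2 = Γ 2 := by
  simp only [Γup, Fin.sum_univ_three, η_entries]
  refine ⟨?_, ?_, ?_⟩ <;> module

/-- All three matrices are symmetric, as the anticommutator of the supercharges demands. This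
symmetry makes products of supertranslations vanish in `translation_mul_translation`. -/
lemma Γlow_entries :
    (Γlow 0 0 0 = I ∧ Γlow 0 0 1 = 0 ∧ Γlow 0 1 0 = 0 ∧ Γlow 0 1 1 = I) ∧
    (Γlow 1 0 0 = -I ∧ Γlow 1 0 1 = 0 ∧ Γlow 1 1 0 = 0 ∧ Γlow 1 1 1 = I) ∧
    (Γlow 2 0 0 = 0 ∧ Γlow 2 0 1 = I ∧ Γlow 2 1 0 = I ∧ Γlow 2 1 1 = 0) := by
  simp only [Γlow, Γup_eq, chargeConj_inv, Matrix.mul_apply, Fin.sum_univ_two, Matrix.neg_apply,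
    Matrix.transpose_apply, Γ_entries, chargeConj_entries]
  refine ⟨⟨?_, ?_, ?_, ?_⟩, ⟨?_, ?_, ?_, ?_⟩, ?_, ?_, ?_, ?_⟩ <;> ring

lemma Γ₂_entries :
    (Γ₂ 0 1 0 0 = 1 ∧ Γ₂ 0 1 0 1 = 0 ∧ Γ₂ 0 1 1 0 = 0 ∧ Γ₂ 0 1 1 1 = -1) ∧
    (Γ₂ 0 2 0 0 = 0 ∧ Γ₂ 0 2 0 1 = -1 ∧ Γ₂ 0 2 1 0 = -1 ∧ Γ₂ 0 2 1 1 = 0) ∧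
    (Γ₂ 1 2 0 0 = 0 ∧ Γ₂ 1 2 0 1 = -1 ∧ Γ₂ 1 2 1 0 = 1 ∧ Γ₂ 1 2 1 1 = 0) := by
  simp only [Γ₂, Matrix.mul_apply, Fin.sum_univ_two, Matrix.sub_apply, Matrix.smul_apply,
    smul_eq_mul, Γ_entries]
  refine ⟨⟨?_, ?_, ?_, ?_⟩, ⟨?_, ?_, ?_, ?_⟩, ?_, ?_, ?_, ?_⟩ <;> norm_num

lemma Γ₂_swap : Γ₂ 1 0 = -Γ₂ 0 1 ∧ Γ₂ 2 0 = -Γ₂ 0 2 ∧ Γ₂ 2 1 = -Γ₂ 1 2 := by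
  simp only [Γ₂]
  refine ⟨?_, ?_, ?_⟩ <;> module

lemma Γ₂_diag (a : Fin 3) : Γ₂ a a = 0 := by
  rw [Γ₂, sub_self, smul_zero]

end Tables

/-! ### Entries of supermatrices and recovery of their components. -/

section Components

lemma forall_fin_three {P : Fin 3 → Prop} : (∀ i, P i) ↔ P 0 ∧ P 1 ∧ P 2 :=
  ⟨fun h => ⟨h 0, h 1, h 2⟩, fun ⟨h0, h1, h2⟩ i => by fin_cases i <;> assumption⟩

variable {N : Type*} [AddCommGroup N] [Module ℂ N]
variable {p p' : Fin 3 → N} {j j' : Fin 3 → Fin 3 → N} {q q' : Fin 2 → N}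

lemma diag_eq_zero_of_antisymm (hj : ∀ a b, j a b = -j b a) (a : Fin 3) : j a a = 0 := by
  have h : j a a + j a a = 0 := by nth_rewrite 2 [hj]; exact add_neg_cancel _
  rw [show j a a = (1 / 2 : ℂ) • (j a a + j a a) by module, h, smul_zero]

lemma superElt_vec (a : Fin 3) : superElt p j q (.inl a) (.inr (.inl 0)) = p a := by
  simp [superElt, genP, genJ, genQ]

/-- Antisymmetry makes the pairs `(a, b)` and `(b, a)` contribute equally, which absorbs the factor
`1 / 2`; since the metric is diagonal, lowering the index is multiplication by `η d d`. -/
lemma superElt_lorentz (hj : ∀ a b, j a b = -j b a) (a d : Fin 3) :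
    superElt p j q (.inl a) (.inl d) = η d d • j a d := by
  have h0 := diag_eq_zero_of_antisymm hj
  revert a d
  simp only [forall_fin_three, superElt, genP, genJ, genQ, Fin.sum_univ_three, zero_smul,
    smul_zero, mul_zero, Finset.sum_const_zero, η_entries, h0, hj 1 0, hj 2 0, hj 2 1]
  refine ⟨⟨?_, ?_, ?_⟩, ⟨?_, ?_, ?_⟩, ?_, ?_, ?_⟩ <;> simp <;> module

lemma superElt_vec_spinor (a : Fin 3) (β : Fin 2) :
    superElt p j q (.inl a) (.inr (.inr β)) = ∑ α, (-(Complex.I / 4) * Γlow a α β) • q α := by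
  simp [superElt, genP, genJ, genQ, rowSign]

lemma superElt_scalar (s : Idx) : superElt p j q (.inr (.inl 0)) s = 0 := by
  rcases s with s | s | s <;> simp [superElt, genP, genJ, genQ]

lemma superElt_spinor_vec (β : Fin 2) (a : Fin 3) :
    superElt p j q (.inr (.inr β)) (.inl a) = 0 := by
  simp [superElt, genP, genJ, genQ]

lemma superElt_spinor_scalar (β : Fin 2) :
    superElt p j q (.inr (.inr β)) (.inr (.inl 0)) = -q β := by
  simp [superElt, genP, genJ, genQ, rowSign]

lemma superElt_spinor (hj : ∀ a b, j a b = -j b a) (β α : Fin 2) :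
    superElt p j q (.inr (.inr β)) (.inr (.inr α)) =
      -(1 / 2 : ℂ) • (Γ₂ 0 1 α β • j 0 1 + Γ₂ 0 2 α β • j 0 2 + Γ₂ 1 2 α β • j 1 2) := by
  have h0 := diag_eq_zero_of_antisymm hj
  simp only [superElt, genP, genJ, genQ, zero_smul, mul_zero, Finset.sum_const_zero,
    Fin.sum_univ_three, h0, hj 1 0, hj 2 0, hj 2 1, Γ₂_swap, Matrix.neg_apply]
  module

lemma compP_superElt : compP (superElt p j q) = p := funext superElt_vec

lemma compQ_superElt : compQ (superElt p j q) = q := funext fun α => by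
  rw [compQ, superElt_spinor_scalar, neg_neg]

lemma compJ_superElt (hj : ∀ a b, j a b = -j b a) : compJ (superElt p j q) = j := by
  funext a b
  revert a b
  simp only [forall_fin_three, compJ, superElt_lorentz hj, Fin.sum_univ_three, η_entries]
  simp

end Components

/-! ### Products and the invariant form, expressed in components. -/

section Pairing

variable {M : Type*} [TopologicalSpace M] [ChartedSpace (EuclideanHalfSpace 3) M]
variable {B : Type*} [NormedRing B] [NormedAlgebra ℂ B] {k : ℕ}
variable {p p' : Fin 3 → DForm M B 1} {j j' : Fin 3 → Fin 3 → DForm M B 1}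
  {q q' : Fin 2 → DForm M B 1}

lemma matWedge_apply (Z : Matrix Idx Idx (DForm M B 1)) (Y : Matrix Idx Idx (DForm M B k))
    (r s : Idx) : matWedge Z Y r s = (∑ c, wedge (Z r (.inl c)) (Y (.inl c) s)) +
      (wedge (Z r (.inr (.inl 0))) (Y (.inr (.inl 0)) s) +
        ∑ β, wedge (Z r (.inr (.inr β))) (Y (.inr (.inr β)) s)) := by
  simp only [matWedge, Fintype.sum_sum_type, Finset.univ_unique, Finset.sum_singleton]
  rfl

/-- A product of two elements need not lie in the algebra, but `pairing` reads only its `P`, `J` and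
`Q` components. Here `p ∧ j'` is absent because the scalar row of a supermatrix is zero. -/
lemma compP_matWedge (hj : ∀ a b, j a b = -j b a) (a : Fin 3) :
    compP (matWedge (superElt p j q) (superElt p' j' q')) a =
      (∑ c, η c c • wedge (j a c) (p' c)) +
        ∑ α, ∑ β, (Complex.I / 4 * Γlow a α β) • wedge (q α) (q' β) := by
  simp only [compP, matWedge_apply, superElt_lorentz hj, superElt_vec, superElt_scalar,
    superElt_vec_spinor, superElt_spinor_scalar, wedge_zero_right, wedge_smul_left,
    wedge_neg_right, wedge_add_left, Fin.sum_univ_two, Fin.sum_univ_three]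
  module

lemma compQ_matWedge (hj : ∀ a b, j a b = -j b a) (α : Fin 2) :
    compQ (matWedge (superElt p j q) (superElt p' j' q')) α =
      -(1 / 2 : ℂ) • ∑ β, (Γ₂ 0 1 β α • wedge (j 0 1) (q' β) + Γ₂ 0 2 β α • wedge (j 0 2) (q' β) +
        Γ₂ 1 2 β α • wedge (j 1 2) (q' β)) := by
  simp only [compQ, matWedge_apply, superElt_scalar, superElt_spinor_vec,
    superElt_spinor hj, superElt_spinor_scalar, wedge_zero_right, wedge_zero_left, wedge_smul_left,
    wedge_add_left, wedge_neg_right, Fin.sum_univ_two, Fin.sum_univ_three]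
  module

lemma compJ_matWedge (hj : ∀ a b, j a b = -j b a) (hj' : ∀ a b, j' a b = -j' b a) (a b : Fin 3) :
    compJ (matWedge (superElt p j q) (superElt p' j' q')) a b =
      ∑ c, η c c • wedge (j a c) (j' c b) := by
  simp only [compJ, matWedge_apply, superElt_lorentz hj, superElt_lorentz hj', superElt_scalar,
    superElt_spinor_vec, wedge_zero_right, wedge_smul_left, wedge_smul_right, Fin.sum_univ_two,
    Fin.sum_univ_three]
  revert b
  simp only [forall_fin_three, η_entries]
  refine ⟨?_, ?_, ?_⟩ <;> module

/-- The second argument will be a curvature, a matrix product not known to be antisymmetric in its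
Lorentz part; hence the antisymmetrized differences. -/
lemma pairing_superElt (hj : ∀ a b, j a b = -j b a) (Y : Matrix Idx Idx (DForm M B k)) :
    pairing (superElt p j q) Y =
      wedge (j 0 1) (compP Y 2) - wedge (j 0 2) (compP Y 1) + wedge (j 1 2) (compP Y 0) +
        (1 / 2 : ℂ) • (wedge (p 2) (compJ Y 0 1 - compJ Y 1 0) -
          wedge (p 1) (compJ Y 0 2 - compJ Y 2 0) + wedge (p 0) (compJ Y 1 2 - compJ Y 2 1)) +
        (wedge (q 0) (compQ Y 1) - wedge (q 1) (compQ Y 0)) := by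
  simp only [pairing, compJ_superElt hj, compP_superElt, compQ_superElt, Fin.sum_univ_three,
    Fin.sum_univ_two, ε_entries, ε_eq_zero, chargeConj_inv, chargeConj_entries,
    hj 1 0, hj 2 0, hj 2 1, wedge_neg_left, wedge_sub_right, mul_neg, neg_mul,
    Complex.I_mul_I, mul_zero]
  module

end Pairing

/-! ### Abstract component calculus and the symmetric cubic form. -/

section Algebra

variable {N₁ N₂ N₃ : Type*} [AddCommGroup N₁] [Module ℂ N₁] [AddCommGroup N₂] [Module ℂ N₂]
  [AddCommGroup N₃] [Module ℂ N₃]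

/-- Triples of components `p^a`, `j^{ab}`, `q^α`. -/
abbrev Comps (N : Type*) : Type _ := (Fin 3 → N) × (Fin 3 → Fin 3 → N) × (Fin 2 → N)

/-- The invariant form in components, for an antisymmetric first argument. -/
def pairC (n : N₁ →ₗ[ℂ] N₂ →ₗ[ℂ] N₃) : Comps N₁ →ₗ[ℂ] Comps N₂ →ₗ[ℂ] N₃ :=
  LinearMap.mk₂ ℂ (fun X Y => n (X.2.1 0 1) (Y.1 2) - n (X.2.1 0 2) (Y.1 1) + n (X.2.1 1 2) (Y.1 0)
      + (1 / 2 : ℂ) • (n (X.1 2) (Y.2.1 0 1 - Y.2.1 1 0) - n (X.1 1) (Y.2.1 0 2 - Y.2.1 2 0)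
        + n (X.1 0) (Y.2.1 1 2 - Y.2.1 2 1))
      + (n (X.2.2 0) (Y.2.2 1) - n (X.2.2 1) (Y.2.2 0)))
    (fun _ _ _ => by
      simp only [Prod.fst_add, Prod.snd_add, Pi.add_apply, map_add, LinearMap.add_apply]; module)
    (fun _ _ _ => by
      simp only [Prod.smul_fst, Prod.smul_snd, Pi.smul_apply, map_smul, LinearMap.smul_apply]
      module)
    (fun _ _ _ => by
      simp only [Prod.fst_add, Prod.snd_add, Pi.add_apply, map_add, map_sub]; module)
    (fun _ _ _ => by
      simp only [Prod.smul_fst, Prod.smul_snd, Pi.smul_apply, map_smul, map_sub]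
      module)

lemma pairC_apply (n : N₁ →ₗ[ℂ] N₂ →ₗ[ℂ] N₃) (X : Comps N₁) (Y : Comps N₂) : pairC n X Y =
    n (X.2.1 0 1) (Y.1 2) - n (X.2.1 0 2) (Y.1 1) + n (X.2.1 1 2) (Y.1 0)
      + (1 / 2 : ℂ) • (n (X.1 2) (Y.2.1 0 1 - Y.2.1 1 0) - n (X.1 1) (Y.2.1 0 2 - Y.2.1 2 0)
        + n (X.1 0) (Y.2.1 1 2 - Y.2.1 2 1))
      + (n (X.2.2 0) (Y.2.2 1) - n (X.2.2 1) (Y.2.2 0)) := rfl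

/-- The product of supermatrices in components, for an antisymmetric first argument. -/
def mulC (m : N₁ →ₗ[ℂ] N₁ →ₗ[ℂ] N₂) (X Y : Comps N₁) : Comps N₂ :=
  (fun a => (∑ c, η c c • m (X.2.1 a c) (Y.1 c)) +
      ∑ α, ∑ β, (Complex.I / 4 * Γlow a α β) • m (X.2.2 α) (Y.2.2 β),
    fun a b => ∑ c, η c c • m (X.2.1 a c) (Y.2.1 c b),
    fun α => -(1 / 2 : ℂ) • ∑ β, (Γ₂ 0 1 β α • m (X.2.1 0 1) (Y.2.2 β) +
      Γ₂ 0 2 β α • m (X.2.1 0 2) (Y.2.2 β) + Γ₂ 1 2 β α • m (X.2.1 1 2) (Y.2.2 β)))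

lemma mulC_add_left (m : N₁ →ₗ[ℂ] N₁ →ₗ[ℂ] N₂) (X X' Y : Comps N₁) :
    mulC m (X + X') Y = mulC m X Y + mulC m X' Y := by
  refine Prod.ext (funext fun a => ?_) (Prod.ext (funext fun a => funext fun b => ?_)
    (funext fun α => ?_)) <;>
  simp only [mulC, Prod.fst_add, Prod.snd_add, Pi.add_apply, map_add, LinearMap.add_apply,
    Fin.sum_univ_three, Fin.sum_univ_two] <;> module

lemma mulC_add_right (m : N₁ →ₗ[ℂ] N₁ →ₗ[ℂ] N₂) (X Y Y' : Comps N₁) :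
    mulC m X (Y + Y') = mulC m X Y + mulC m X Y' := by
  refine Prod.ext (funext fun a => ?_) (Prod.ext (funext fun a => funext fun b => ?_)
    (funext fun α => ?_)) <;>
  simp only [mulC, Prod.fst_add, Prod.snd_add, Pi.add_apply, map_add,
    Fin.sum_univ_three, Fin.sum_univ_two] <;> module

lemma mulC_smul_left (m : N₁ →ₗ[ℂ] N₁ →ₗ[ℂ] N₂) (a : ℂ) (X Y : Comps N₁) :
    mulC m (a • X) Y = a • mulC m X Y := by
  refine Prod.ext (funext fun a => ?_) (Prod.ext (funext fun a => funext fun b => ?_)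
    (funext fun α => ?_)) <;>
  simp only [mulC, Prod.smul_fst, Prod.smul_snd, Pi.smul_apply, map_smul, LinearMap.smul_apply,
    Fin.sum_univ_three, Fin.sum_univ_two] <;> module

lemma mulC_smul_right (m : N₁ →ₗ[ℂ] N₁ →ₗ[ℂ] N₂) (a : ℂ) (X Y : Comps N₁) :
    mulC m X (a • Y) = a • mulC m X Y := by
  refine Prod.ext (funext fun a => ?_) (Prod.ext (funext fun a => funext fun b => ?_)
    (funext fun α => ?_)) <;>
  simp only [mulC, Prod.smul_fst, Prod.smul_snd, Pi.smul_apply, map_smul,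
    Fin.sum_univ_three, Fin.sum_univ_two] <;> module

/-- The commutation rules of the exterior products `m`, `n` of even and odd 1-forms. -/
structure SuperExterior (m : N₁ →ₗ[ℂ] N₁ →ₗ[ℂ] N₂) (n : N₁ →ₗ[ℂ] N₂ →ₗ[ℂ] N₃)
    (E : ZMod 2 → Set N₁) : Prop where
  comm_even : ∀ a ∈ E 0, ∀ b, m a b = -m b a
  comm_odd : ∀ a ∈ E 1, ∀ b ∈ E 1, m a b = m b a
  left_comm_even : ∀ a ∈ E 0, ∀ b c, n a (m b c) = -n b (m a c)
  left_comm_odd : ∀ a ∈ E 1, ∀ b ∈ E 1, ∀ c, n a (m b c) = n b (m a c)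

/-- Components of an even element of the super-Poincaré algebra. -/
structure IsEvenComps (E : ZMod 2 → Set N₁) (X : Comps N₁) : Prop where
  even_p : ∀ a, X.1 a ∈ E 0
  even_j : ∀ a b, X.2.1 a b ∈ E 0
  odd_q : ∀ α, X.2.2 α ∈ E 1
  antisymm : ∀ a b, X.2.1 a b = -X.2.1 b a

variable {m : N₁ →ₗ[ℂ] N₁ →ₗ[ℂ] N₂} {n : N₁ →ₗ[ℂ] N₂ →ₗ[ℂ] N₃} {E : ZMod 2 → Set N₁}

/-- The cubic form `⟨X ∧ (Y ∧ Z + Z ∧ Y)⟩`. -/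
def cubicC (m : N₁ →ₗ[ℂ] N₁ →ₗ[ℂ] N₂) (n : N₁ →ₗ[ℂ] N₂ →ₗ[ℂ] N₃) (X Y Z : Comps N₁) : N₃ :=
  pairC n X (mulC m Y Z + mulC m Z Y)

-- This is the invariance of the bilinear form. Only couplings of type `JJP` and `JQQ` occur; in the
-- latter, `⟨J P⟩` with `{Q, Q} ∼ P` balances `⟨Q Q⟩` with `[Q, J] ∼ Q`. Together with `cubicC_comm`
-- it gives total symmetry.
set_option maxHeartbeats 4000000 in
lemma cubicC_swap (h : SuperExterior m n E) {X Y Z : Comps N₁} (hX : IsEvenComps E X)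
    (hY : IsEvenComps E Y) (hZ : IsEvenComps E Z) : cubicC m n X Y Z = cubicC m n Y X Z := by
  have hX0 := diag_eq_zero_of_antisymm hX.antisymm
  have hY0 := diag_eq_zero_of_antisymm hY.antisymm
  have hZ0 := diag_eq_zero_of_antisymm hZ.antisymm
  obtain ⟨p, j, q⟩ := X
  obtain ⟨p', j', q'⟩ := Y
  obtain ⟨p'', j'', q''⟩ := Z
  -- These rules bring every monomial to the order `X`, `Y`, `Z`: the `h`'s move components of `X`
  -- in front of those of `Y`, the `k`'s and `l`'s move components of `Z` to the end. Only complex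
  -- coefficients are left to compare.
  have h1 a b c d r := h.left_comm_even _ (hY.even_j a b) (j c d) r
  have h2 a b c r := h.left_comm_even _ (hY.even_j a b) (p c) r
  have h3 a b c r := h.left_comm_even _ (hY.even_j a b) (q c) r
  have h4 a c d r := h.left_comm_even _ (hY.even_p a) (j c d) r
  have h6 a c d r : n (q' a) (m (j c d) r) = -n (j c d) (m (q' a) r) := by
    rw [h.left_comm_even _ (hX.even_j c d), neg_neg]
  have h8 a c r := h.left_comm_odd _ (hY.odd_q a) _ (hX.odd_q c) r
  have k1 a b c d := h.comm_even _ (hZ.even_j a b) (j' c d)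
  have k2 a b c := h.comm_even _ (hZ.even_j a b) (p' c)
  have k3 a b c := h.comm_even _ (hZ.even_j a b) (q' c)
  have k6 a c := h.comm_odd _ (hZ.odd_q a) _ (hY.odd_q c)
  have l1 a b c d := h.comm_even _ (hZ.even_j a b) (j c d)
  have l2 a b c := h.comm_even _ (hZ.even_j a b) (p c)
  have l3 a b c := h.comm_even _ (hZ.even_j a b) (q c)
  have l6 a c := h.comm_odd _ (hZ.odd_q a) _ (hX.odd_q c)
  have aX := hX.antisymm
  have aY := hY.antisymm
  have aZ := hZ.antisymm
  simp only at hX0 hY0 hZ0 h1 h2 h3 h4 h6 h8 k1 k2 k3 k6 l1 l2 l3 l6 aX aY aZ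
  simp only [cubicC, pairC_apply, mulC,
    Fin.sum_univ_three, Fin.sum_univ_two, η_entries, Γlow_entries, Γ₂_entries, hX0, hY0, hZ0,
    aX 1 0, aX 2 0, aX 2 1, aY 1 0, aY 2 0, aY 2 1, aZ 1 0, aZ 2 0, aZ 2 1,
    map_add, map_sub, map_neg, map_smul, map_zero, LinearMap.neg_apply, LinearMap.zero_apply,
    smul_zero, zero_smul, mul_zero, add_zero, zero_add, neg_zero, neg_neg]
  simp only [k1, k2, k3, k6, l1, l2, l3, l6, map_neg, h1, h2, h3, h4, h6, h8]
  match_scalars <;> ring_nf <;> norm_num [Complex.I_sq]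

end Algebra

/-! ### Polynomial expressions for the Chern–Simons and transgression forms. -/

section Transgression

variable {N₁ N₂ N₃ : Type*} [AddCommGroup N₁] [Module ℂ N₁] [AddCommGroup N₂] [Module ℂ N₂]
  [AddCommGroup N₃] [Module ℂ N₃]
variable {m : N₁ →ₗ[ℂ] N₁ →ₗ[ℂ] N₂} {n : N₁ →ₗ[ℂ] N₂ →ₗ[ℂ] N₃} {E : ZMod 2 → Set N₁}

lemma cubicC_comm (X Y Z : Comps N₁) : cubicC m n X Y Z = cubicC m n X Z Y := by
  rw [cubicC, cubicC, add_comm]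

lemma cubicC_add_left (X X' Y Z : Comps N₁) :
    cubicC m n (X + X') Y Z = cubicC m n X Y Z + cubicC m n X' Y Z := by
  exact (pairC n).map_add₂ _ _ _

lemma cubicC_smul_left (a : ℂ) (X Y Z : Comps N₁) :
    cubicC m n (a • X) Y Z = a • cubicC m n X Y Z := by
  exact (pairC n).map_smul₂ _ _ _

lemma cubicC_add_right (X Y Y' Z : Comps N₁) :
    cubicC m n X (Y + Y') Z = cubicC m n X Y Z + cubicC m n X Y' Z := by
  simp only [cubicC, mulC_add_left, mulC_add_right, map_add]; abel

lemma cubicC_smul_right (a : ℂ) (X Y Z : Comps N₁) :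
    cubicC m n X (a • Y) Z = a • cubicC m n X Y Z := by
  simp only [cubicC, mulC_smul_left, mulC_smul_right, map_add, map_smul]; module

/-- This converts the usual coefficient `2 / 3` of the cubic Chern–Simons term into the `1 / 3` of
`chernSimonsC`. -/
lemma pairC_mulC_self (X Y : Comps N₁) :
    pairC n X (mulC m Y Y) = (1 / 2 : ℂ) • cubicC m n X Y Y := by
  rw [cubicC, map_add]; module

/-- The Chern–Simons form in components. -/
def chernSimonsC (m : N₁ →ₗ[ℂ] N₁ →ₗ[ℂ] N₂) (n : N₁ →ₗ[ℂ] N₂ →ₗ[ℂ] N₃) (X : Comps N₁)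
    (dX : Comps N₂) : N₃ :=
  pairC n X dX + (1 / 3 : ℂ) • cubicC m n X X X

/-- The transgression form in components, as a function of the potential `Y` and of the
difference `Z` of the two potentials. -/
def transgressionC (m : N₁ →ₗ[ℂ] N₁ →ₗ[ℂ] N₂) (n : N₁ →ₗ[ℂ] N₂ →ₗ[ℂ] N₃) (Z Y : Comps N₁)
    (dZ dY : Comps N₂) : N₃ :=
  (2 : ℂ) • pairC n Z dY + pairC n Z dZ + cubicC m n Z Y Y + cubicC m n Z Y Z
    + (1 / 3 : ℂ) • cubicC m n Z Z Z

lemma transgressionC_zero (X : Comps N₁) (dX : Comps N₂) :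
    transgressionC m n X 0 dX 0 = chernSimonsC m n X dX := by
  have h0 (Z : Comps N₁) : cubicC m n X 0 Z = 0 := by
    rw [← zero_smul ℂ (0 : Comps N₁), cubicC_smul_right, zero_smul]
  simp only [transgressionC, chernSimonsC, h0, map_zero]
  module

/-- With a symmetric cubic form the cubic terms obey the scalar identity `(x-y)y² + (x-y)²y +
(x-y)³/3 = (x³-y³)/3`. The last bracket is `d` of the pairing of `X - Y` with `Y`, by `extD_pairC`.
-/
lemma transgressionC_eq_sub (h : SuperExterior m n E) {X Y : Comps N₁} (hX : IsEvenComps E X)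
    (hY : IsEvenComps E Y) (dX dY : Comps N₂) :
    transgressionC m n (X - Y) Y (dX - dY) dY =
      chernSimonsC m n X dX - chernSimonsC m n Y dY
        - (pairC n Y (dX - dY) - pairC n (X - Y) dY) := by
  have hl (Z Z' : Comps N₁) : cubicC m n (X - Y) Z Z' = cubicC m n X Z Z' - cubicC m n Y Z Z' := by
    rw [sub_eq_add_neg, ← neg_one_smul ℂ Y, cubicC_add_left, cubicC_smul_left]; module
  have hr (Z Z' : Comps N₁) : cubicC m n Z (X - Y) Z' = cubicC m n Z X Z' - cubicC m n Z Y Z' := by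
    rw [sub_eq_add_neg, ← neg_one_smul ℂ Y, cubicC_add_right, cubicC_smul_right]; module
  have h1 : cubicC m n X Y X = cubicC m n X X Y := cubicC_comm _ _ _
  have h2 : cubicC m n Y X X = cubicC m n X X Y := by rw [cubicC_swap h hY hX hX, h1]
  have h3 : cubicC m n Y X Y = cubicC m n X Y Y := cubicC_swap h hY hX hY
  have h4 : cubicC m n Y Y X = cubicC m n X Y Y := by rw [cubicC_comm, h3]
  simp only [transgressionC, chernSimonsC, cubicC_comm _ Y (X - Y), hl, hr, map_sub,
    LinearMap.sub_apply]
  simp only [cubicC_comm _ _ (X - Y), hr, h1, h2, h3, h4]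
  module

/-- If the two potentials differ by `Z`, the transgression form in terms of the first one. -/
lemma transgressionC_sub (X Z : Comps N₁) (dX dZ : Comps N₂) :
    transgressionC m n Z (X - Z) dZ (dX - dZ) =
      (2 : ℂ) • pairC n Z dX - pairC n Z dZ + cubicC m n Z X X - cubicC m n Z X Z
        + (1 / 3 : ℂ) • cubicC m n Z Z Z := by
  have hr (Y Z' : Comps N₁) : cubicC m n Z (X - Z) Z' = cubicC m n Z X Z' - cubicC m n Z Z Z' := by
    rw [sub_eq_add_neg, ← neg_one_smul ℂ Z, cubicC_add_right, cubicC_smul_right]; module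
  simp only [transgressionC, map_sub, hr X, cubicC_comm _ _ (X - Z)]
  rw [cubicC_comm Z Z X]
  module

end Transgression

/-! ### From the Chern–Simons form to the supergravity Lagrangian. -/

section Lagrangians

variable {F N₁ N₂ N₃ : Type*} [AddCommGroup F] [Module ℂ F] [AddCommGroup N₁] [Module ℂ N₁]
  [AddCommGroup N₂] [Module ℂ N₂] [AddCommGroup N₃] [Module ℂ N₃]
variable {m : N₁ →ₗ[ℂ] N₁ →ₗ[ℂ] N₂} {n : N₁ →ₗ[ℂ] N₂ →ₗ[ℂ] N₃} {E : ZMod 2 → Set N₁}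

lemma bar_zero_one {N : Type*} [AddCommGroup N] [Module ℂ N] (ψ : Fin 2 → N) :
    bar ψ 0 = Complex.I • ψ 1 ∧ bar ψ 1 = -(Complex.I • ψ 0) := by
  simp only [bar, Fin.sum_univ_two, chargeConj_entries]
  refine ⟨?_, ?_⟩ <;> module

set_option maxHeartbeats 1000000 in
/-- The Chern–Simons form is the Lagrangian of supergravity up to an exact form. -/
lemma chernSimonsC_eq (h : SuperExterior m n E) {e : Fin 3 → N₁} {w : Fin 3 → Fin 3 → N₁}
    {ψ : Fin 2 → N₁} (de : Fin 3 → N₂) {dw : Fin 3 → Fin 3 → N₂} (dψ : Fin 2 → N₂)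
    (hX : IsEvenComps E (e, w, bar ψ)) (hψ : ∀ α, ψ α ∈ E 1) (hdw : ∀ a b, dw a b = -dw b a) :
    chernSimonsC m n (e, w, bar ψ) (de, dw, bar dψ) =
      (∑ a, ∑ b, ∑ c, ε a b c • n (e c) (dw a b + ∑ c, ∑ d, η d c • m (w a d) (w c b)))
        - Complex.I • ∑ α, n (bar ψ α)
          (dψ α + (1 / 4 : ℂ) • ∑ a, ∑ b, ∑ β, Γ₂ a b α β • m (w a b) (ψ β))
        - (1 / 2 : ℂ) • ∑ a, ∑ b, ∑ c, ε a b c • (n (e c) (dw a b) - n (w a b) (de c)) := by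
  have w0 := diag_eq_zero_of_antisymm hX.antisymm
  have aw := hX.antisymm
  have hw := hX.even_j
  -- Normal ordering as in `cubicC_swap`: components of `w` are moved in front of `e` and `ψ`, and
  -- products within `w` and within `ψ` are put in a fixed order.
  have h1 a b c r := h.left_comm_even _ (hw a b) (e c) r
  have h2 a b c r : n (ψ c) (m (w a b) r) = -n (w a b) (m (ψ c) r) := by
    rw [h.left_comm_even _ (hw a b), neg_neg]
  have h3 a b c := h.comm_even _ (hw a b) (e c)
  have h4 := h.comm_odd _ (hψ 1) _ (hψ 0)
  have h5 := h.comm_even _ (hw 1 2) (w 0 1)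
  have h6 := h.comm_even _ (hw 1 2) (w 0 2)
  have h7 := h.comm_even _ (hw 0 2) (w 0 1)
  simp only at w0 aw hw h1 h2 h3 h4 h5 h6 h7
  simp only [chernSimonsC, cubicC, pairC_apply, mulC,
    Fin.sum_univ_three, Fin.sum_univ_two, η_entries, Γlow_entries, Γ₂_entries, ε_entries,
    ε_eq_zero, Γ₂_swap, Γ₂_diag, Matrix.neg_apply, Matrix.zero_apply, w0, bar_zero_one,
    aw 1 0, aw 2 0, aw 2 1, hdw 1 0, hdw 2 0, hdw 2 1,
    map_add, map_sub, map_neg, map_smul, map_zero, LinearMap.neg_apply, LinearMap.zero_apply,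
    LinearMap.smul_apply, smul_zero, zero_smul, mul_zero, add_zero, zero_add, neg_zero, neg_neg]
  simp only [h3, h4, h5, h6, h7, map_neg, h1, h2]
  match_scalars <;> ring_nf <;> norm_num [Complex.I_sq]

end Lagrangians

/-! ### Curvature identities and exactness of the transgression form, in components. -/

section TopologicalLagrangian

variable {F N₁ N₂ N₃ : Type*} [AddCommGroup F] [Module ℂ F] [AddCommGroup N₁] [Module ℂ N₁]
  [AddCommGroup N₂] [Module ℂ N₂] [AddCommGroup N₃] [Module ℂ N₃]
variable {m : N₁ →ₗ[ℂ] N₁ →ₗ[ℂ] N₂} {n : N₁ →ₗ[ℂ] N₂ →ₗ[ℂ] N₃} {E : ZMod 2 → Set N₁}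
variable {w : Fin 3 → Fin 3 → N₁} {r dw : Fin 3 → Fin 3 → N₂}

lemma eq_zero_of_eq_neg_self {N : Type*} [AddCommGroup N] [Module ℂ N] {x : N} (h : x = -x) :
    x = 0 := by
  rw [show x = (1 / 2 : ℂ) • (x - -x) by module, ← h, sub_self, smul_zero]

lemma SuperExterior.even_sq_eq_zero (h : SuperExterior m n E) {a : N₁} (ha : a ∈ E 0) :
    m a a = 0 := eq_zero_of_eq_neg_self (h.comm_even a ha a)

lemma SuperExterior.even_mul_sq_eq_zero (h : SuperExterior m n E) {a : N₁} (ha : a ∈ E 0)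
    (b : N₁) : n a (m a b) = 0 := eq_zero_of_eq_neg_self (h.left_comm_even a ha a b)

/-- The Bianchi identity in components. -/
lemma bianchi (h : SuperExterior m n E) (hw : ∀ a b, w a b ∈ E 0) (aw : ∀ a b, w a b = -w b a)
    (adw : ∀ a b, dw a b = -dw b a)
    (hr : ∀ a b, r a b = dw a b + ∑ c, ∑ d, η d c • m (w a d) (w c b)) (a b : Fin 3) :
    ∑ c, ∑ d, η d c • (n (w c b) (dw a d) - n (w a d) (dw c b)) =
      ∑ c, ∑ d, η d c • (n (w c b) (r a d) - n (w a d) (r c b)) := by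
  have w0 := diag_eq_zero_of_antisymm aw
  have dw0 := diag_eq_zero_of_antisymm adw
  -- With repeated factors removed, the only cubic monomial in `w` is the product of its three
  -- independent components, and its contributions cancel.
  have hsq a b := h.even_sq_eq_zero (hw a b)
  have hsq' a b := h.even_mul_sq_eq_zero (hw a b)
  have h1 := h.left_comm_even _ (hw 1 2) (w 0 1)
  have h2 := h.left_comm_even _ (hw 1 2) (w 0 2)
  have h3 := h.left_comm_even _ (hw 0 2) (w 0 1)
  have h5 := h.comm_even _ (hw 1 2) (w 0 1)
  have h6 := h.comm_even _ (hw 1 2) (w 0 2)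
  have h7 := h.comm_even _ (hw 0 2) (w 0 1)
  revert a b
  simp only [hr, forall_fin_three, Fin.sum_univ_three, η_entries, w0, dw0, aw 1 0, aw 2 0, aw 2 1,
    adw 1 0, adw 2 0, adw 2 1,
    map_add, map_neg, map_smul, map_zero, LinearMap.neg_apply, LinearMap.zero_apply,
    smul_zero, zero_smul, add_zero, zero_add, neg_zero, neg_neg]
  simp only [h5, h6, h7, map_neg, h1, h2, h3, hsq, hsq', map_zero]
  refine ⟨⟨?_, ?_, ?_⟩, ⟨?_, ?_, ?_⟩, ?_, ?_, ?_⟩ <;> module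

variable {l₁ : F →ₗ[ℂ] N₁ →ₗ[ℂ] N₁} {l₂ : F →ₗ[ℂ] N₂ →ₗ[ℂ] N₂} {l₃ : F →ₗ[ℂ] N₃ →ₗ[ℂ] N₃}

set_option maxHeartbeats 1000000 in
/-- The square of the covariant derivative of a spinor is the curvature. -/
lemma covDSpinor_sq (h : SuperExterior m n E) (hw : ∀ a b, w a b ∈ E 0)
    (aw : ∀ a b, w a b = -w b a) (adw : ∀ a b, dw a b = -dw b a)
    (hr : ∀ a b, r a b = dw a b + ∑ c, ∑ d, η d c • m (w a d) (w c b))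
    (hl : ∀ f a b, m (l₁ f a) b = l₂ f (m a b)) {χ : Fin 2 → F} {u dχ : Fin 2 → N₁}
    (hu : ∀ α, u α = dχ α + (1 / 4 : ℂ) • ∑ a, ∑ b, ∑ β, Γ₂ a b α β • l₁ (χ β) (w a b))
    (α : Fin 2) :
    (1 / 4 : ℂ) • ∑ a, ∑ b, ∑ β, Γ₂ a b α β • (m (dχ β) (w a b) + l₂ (χ β) (dw a b)) =
      (1 / 4 : ℂ) • ∑ a, ∑ b, ∑ β, Γ₂ a b α β • (l₂ (χ β) (r a b) - m (w a b) (u β)) := by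
  have w0 := diag_eq_zero_of_antisymm aw
  have dw0 := diag_eq_zero_of_antisymm adw
  have hsq a b := h.even_sq_eq_zero (hw a b)
  have h5 := h.comm_even _ (hw 1 2) (w 0 1)
  have h6 := h.comm_even _ (hw 1 2) (w 0 2)
  have h7 := h.comm_even _ (hw 0 2) (w 0 1)
  have h8 a b c := h.comm_even _ (hw a b) (u c)
  -- Eliminating `dχ` in favour of the covariant derivative `u` leaves terms quadratic in `w`, which
  -- complete `dw` to `r`.
  have hu' β : dχ β = u β - (1 / 4 : ℂ) • ∑ a, ∑ b, ∑ γ, Γ₂ a b β γ • l₁ (χ γ) (w a b) := by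
    rw [hu, add_sub_cancel_right]
  revert α
  simp only [hr, h8, hu', Fin.forall_fin_two, Fin.sum_univ_three, Fin.sum_univ_two, Γ₂_entries,
    Γ₂_swap,
    Γ₂_diag, Matrix.neg_apply, Matrix.zero_apply, η_entries, w0, dw0, aw 1 0, aw 2 0, aw 2 1,
    adw 1 0, adw 2 0, adw 2 1, hl,
    map_add, map_sub, map_neg, map_smul, map_zero, LinearMap.neg_apply, LinearMap.zero_apply,
    LinearMap.add_apply, LinearMap.sub_apply, LinearMap.smul_apply,
    smul_zero, zero_smul, add_zero, zero_add, neg_zero, neg_neg]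
  simp only [h5, h6, h7, map_neg, hsq, map_zero]
  refine ⟨?_, ?_⟩ <;> module

set_option maxHeartbeats 2000000 in
/-- The transgression form of the linear and of the nonlinear potential is the exterior
derivative of the Lagrangian of topological supergravity. -/
lemma transgressionC_eq (h : SuperExterior m n E) {e θ dφ : Fin 3 → N₁} {ψ u : Fin 2 → N₁}
    {φ : Fin 3 → F} {χ : Fin 2 → F} (de dθ : Fin 3 → N₂) (dψ : Fin 2 → N₂) {du : Fin 2 → N₂}
    {dr : Fin 3 → Fin 3 → N₃}
    (hw : ∀ a b, w a b ∈ E 0) (aw : ∀ a b, w a b = -w b a)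
    (hψ : ∀ α, ψ α ∈ E 1) (hu : ∀ α, u α ∈ E 1)
    (hr : ∀ a b, r a b = dw a b + ∑ c, ∑ d, η d c • m (w a d) (w c b))
    (ar : ∀ a b, r a b = -r b a)
    (hdr : ∀ a b, dr a b = ∑ c, ∑ d, η d c • (n (w c b) (r a d) - n (w a d) (r c b)))
    (hdu : ∀ α, du α =
      (1 / 4 : ℂ) • ∑ a, ∑ b, ∑ β, Γ₂ a b α β • (l₂ (χ β) (r a b) - m (w a b) (u β)))
    (hθ : ∀ a, θ a = dφ a + (∑ b, ∑ c, η c b • l₁ (φ b) (w a c))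
      - (Complex.I / 2) • (∑ α, ∑ β, Γup a α β • l₁ (bar χ α) (ψ β))
      + (Complex.I / 4) • ∑ α, ∑ β, Γup a α β • l₁ (bar χ α) (u β))
    (hl : ∀ f a b, n (l₁ f a) b = l₃ f (n a b))
    (hl' : ∀ α, ∀ a ∈ E 1, ∀ b, n a (l₂ (χ α) b) = -l₃ (χ α) (n a b)) :
    transgressionC m n (θ, 0, bar u) ((e, w, bar ψ) - (θ, 0, bar u)) (dθ, 0, bar du)
        ((de, dw, bar dψ) - (dθ, 0, bar du)) =
      (∑ a, ∑ b, ∑ c, ε a b c • (n (dφ c) (r a b) + l₃ (φ c) (dr a b)))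
        - (2 * Complex.I) • ∑ α, (-n (u α) (bar dψ α) - n (bar ψ α) (du α)) := by
  have w0 := diag_eq_zero_of_antisymm aw
  have r0 := diag_eq_zero_of_antisymm ar
  -- The computation is expressed in the covariant quantities `r` and `u`.
  have hdw a b : dw a b = r a b - ∑ c, ∑ d, η d c • m (w a d) (w c b) := by
    rw [hr, add_sub_cancel_right]
  have h5 := h.comm_even _ (hw 1 2) (w 0 1)
  have h6 := h.comm_even _ (hw 1 2) (w 0 2)
  have h7 := h.comm_even _ (hw 0 2) (w 0 1)
  -- Odd 1-forms commute with each other, and moving both past the same even 1-form produces two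
  -- signs that cancel.
  have hsw {s t : N₁} (hs : s ∈ E 1) (ht : t ∈ E 1) a b :
      n s (m (w a b) t) = n t (m (w a b) s) := by
    rw [← neg_neg (n s _), ← h.left_comm_even _ (hw a b), h.comm_odd _ hs _ ht,
      h.left_comm_even _ (hw a b), neg_neg]
  have hu10 a b := hsw (hu 1) (hu 0) a b
  have hψu α β a b := hsw (hψ α) (hu β) a b
  have hlu α β b := hl' α _ (hu β) b
  have hlψ α β b := hl' α _ (hψ β) b
  -- Expanding around the linear potential is the economical choice: the difference has no Lorentz
  -- part, so `de`, `dθ` and its cubic self-coupling drop out.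
  rw [transgressionC_sub]
  simp only [cubicC, pairC_apply, mulC,
    Fin.sum_univ_three, Fin.sum_univ_two, η_entries, Γlow_entries, Γ₂_entries, ε_entries,
    ε_eq_zero, bar_zero_one, w0,
    Pi.zero_apply, aw 1 0, aw 2 0, aw 2 1,
    map_add, map_sub, map_neg, map_smul, map_zero, LinearMap.neg_apply, LinearMap.zero_apply,
    LinearMap.smul_apply, smul_zero, zero_smul, mul_zero, add_zero, zero_add, neg_zero,
    neg_neg, sub_self]
  simp only [hdu, hdr, hdw, hθ, bar_zero_one, Γup_eq, Γ_entries, Fin.sum_univ_three,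
    Fin.sum_univ_two, η_entries, Γ₂_entries, Γ₂_swap, Γ₂_diag, Matrix.neg_apply, Matrix.zero_apply,
    w0, r0, aw 1 0, aw 2 0, aw 2 1, ar 1 0, ar 2 0, ar 2 1, hl, hlu, hlψ, h5, h6, h7, hu10, hψu,
    map_add, map_sub, map_neg, map_smul, map_zero, LinearMap.neg_apply, LinearMap.zero_apply,
    LinearMap.add_apply, LinearMap.sub_apply,
    LinearMap.smul_apply, smul_zero, zero_smul, add_zero, zero_add, neg_zero,
    neg_neg, sub_self]
  match_scalars <;> ring_nf

end TopologicalLagrangian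

/-! ### Supermatrix-valued potentials as an instance of the component calculus. -/

section Potentials

variable {M : Type*} [TopologicalSpace M] [ChartedSpace (EuclideanHalfSpace 3) M]
variable {B : Type*} [NormedRing B] [NormedAlgebra ℂ B] {k : ℕ}
variable {𝒜 : ZMod 2 → Submodule ℂ B}

/-- The element of the super-Poincaré algebra with given components. -/
def superEltL (N : Type*) [AddCommGroup N] [Module ℂ N] : Comps N →ₗ[ℂ] Matrix Idx Idx N where
  toFun X := superElt X.1 X.2.1 X.2.2
  map_add' X Y := by
    ext r s
    simp only [superElt, Matrix.add_apply, Prod.fst_add, Prod.snd_add, Pi.add_apply, smul_add,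
      Finset.sum_add_distrib]
    abel
  map_smul' a X := by
    ext r s
    simp only [superElt, Matrix.smul_apply, Prod.smul_fst, Prod.smul_snd, Pi.smul_apply, smul_add,
      Finset.smul_sum, RingHom.id_apply, smul_comm a]

lemma superEltL_apply {N : Type*} [AddCommGroup N] [Module ℂ N] (X : Comps N) :
    superEltL N X = superElt X.1 X.2.1 X.2.2 := rfl

/-- The components of a supermatrix. -/
def comps (Z : Matrix Idx Idx (DForm M B k)) : Comps (DForm M B k) := (compP Z, compJ Z, compQ Z)

lemma comps_add (Z Y : Matrix Idx Idx (DForm M B k)) : comps (Z + Y) = comps Z + comps Y := by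
  refine Prod.ext rfl (Prod.ext (funext fun a => funext fun b => ?_) (funext fun α => ?_))
  · simp only [comps, compJ, Prod.snd_add, Prod.fst_add, Pi.add_apply, Matrix.add_apply, smul_add,
      Finset.sum_add_distrib]
  · simp only [comps, compQ, Prod.snd_add, Pi.add_apply, Matrix.add_apply, neg_add]

lemma comps_superElt {X : Comps (DForm M B k)} (hX : ∀ a b, X.2.1 a b = -X.2.1 b a) :
    comps (superEltL _ X) = X := by
  rw [comps, superEltL_apply, compP_superElt, compJ_superElt hX, compQ_superElt]

lemma comps_matWedge {X Y : Comps (DForm M B 1)} (hX : ∀ a b, X.2.1 a b = -X.2.1 b a)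
    (hY : ∀ a b, Y.2.1 a b = -Y.2.1 b a) :
    comps (matWedge (superEltL _ X) (superEltL _ Y)) = mulC (wedgeBilin M B 1) X Y :=
  Prod.ext (funext fun a => compP_matWedge hX a) (Prod.ext
    (funext fun a => funext fun b => compJ_matWedge hX hY a b)
    (funext fun α => compQ_matWedge hX α))

lemma pairing_eq_pairC {X : Comps (DForm M B 1)} (hX : ∀ a b, X.2.1 a b = -X.2.1 b a)
    (Y : Matrix Idx Idx (DForm M B k)) :
    pairing (superEltL _ X) Y = pairC (wedgeBilin M B k) X (comps Y) := pairing_superElt hX Y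

/-- The exterior derivatives of the components. -/
def dComps (X : Comps (DForm M B k)) : Comps (DForm M B (k + 1)) :=
  (fun a => extD (X.1 a), fun a b => extD (X.2.1 a b), fun α => extD (X.2.2 α))

/-- The 1-forms of a given parity. -/
def parityForms (M : Type*) [TopologicalSpace M] [ChartedSpace (EuclideanHalfSpace 3) M]
    (𝒜 : ZMod 2 → Submodule ℂ B) (i : ZMod 2) : Set (DForm M B 1) := {α | α.HasParity 𝒜 i}

lemma superExterior_wedge (h𝒜 : IsSupercommutative 𝒜) :
    SuperExterior (wedgeBilin M B 1) (wedgeBilin M B 2) (parityForms M 𝒜) where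
  comm_even _ ha b := h𝒜.even_wedge_comm ha b
  comm_odd _ ha _ hb := h𝒜.odd_wedge_comm ha hb
  left_comm_even _ ha b c := h𝒜.even_wedge_left_comm ha b c
  left_comm_odd _ ha _ hb c := h𝒜.odd_wedge_left_comm ha hb c

/-- Smooth gauge potentials with values in the super-Poincaré algebra, in components. -/
structure IsPotential (𝒜 : ZMod 2 → Submodule ℂ B) (X : Comps (DForm M B 1)) : Prop
    extends IsEvenComps (parityForms M 𝒜) X where
  smooth_p : ∀ a, IsSmoothForm (X.1 a)
  smooth_j : ∀ a b, IsSmoothForm (X.2.1 a b)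
  smooth_q : ∀ α, IsSmoothForm (X.2.2 α)

namespace IsPotential

variable [IsManifold (𝓡∂ 3) ∞ M] {X Y : Comps (DForm M B 1)}

lemma zero : IsPotential 𝒜 (0 : Comps (DForm M B 1)) where
  even_p _ := DForm.HasParity.zero
  even_j _ _ := DForm.HasParity.zero
  odd_q _ := DForm.HasParity.zero
  antisymm _ _ := neg_zero.symm
  smooth_p _ := IsSmoothForm.zero
  smooth_j _ _ := IsSmoothForm.zero
  smooth_q _ := IsSmoothForm.zero

lemma sub (hX : IsPotential 𝒜 X) (hY : IsPotential 𝒜 Y) : IsPotential 𝒜 (X - Y) where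
  even_p a := DForm.HasParity.sub (hX.even_p a) (hY.even_p a)
  even_j a b := DForm.HasParity.sub (hX.even_j a b) (hY.even_j a b)
  odd_q α := DForm.HasParity.sub (hX.odd_q α) (hY.odd_q α)
  antisymm a b := by
    change X.2.1 a b - Y.2.1 a b = -(X.2.1 b a - Y.2.1 b a)
    rw [hX.antisymm a b, hY.antisymm a b]; abel
  smooth_p a := (hX.smooth_p a).sub (hY.smooth_p a)
  smooth_j a b := (hX.smooth_j a b).sub (hY.smooth_j a b)
  smooth_q α := (hX.smooth_q α).sub (hY.smooth_q α)

lemma add (hX : IsPotential 𝒜 X) (hY : IsPotential 𝒜 Y) : IsPotential 𝒜 (X + Y) where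
  even_p a := DForm.HasParity.add (hX.even_p a) (hY.even_p a)
  even_j a b := DForm.HasParity.add (hX.even_j a b) (hY.even_j a b)
  odd_q α := DForm.HasParity.add (hX.odd_q α) (hY.odd_q α)
  antisymm a b := by
    change X.2.1 a b + Y.2.1 a b = -(X.2.1 b a + Y.2.1 b a)
    rw [hX.antisymm a b, hY.antisymm a b]; abel
  smooth_p a := (hX.smooth_p a).add (hY.smooth_p a)
  smooth_j a b := (hX.smooth_j a b).add (hY.smooth_j a b)
  smooth_q α := (hX.smooth_q α).add (hY.smooth_q α)

lemma smul (a : ℂ) (hX : IsPotential 𝒜 X) : IsPotential 𝒜 (a • X) where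
  even_p b := DForm.HasParity.smul a (hX.even_p b)
  even_j b c := DForm.HasParity.smul a (hX.even_j b c)
  odd_q α := DForm.HasParity.smul a (hX.odd_q α)
  antisymm b c := by
    change a • X.2.1 b c = -(a • X.2.1 c b)
    rw [hX.antisymm b c]; module
  smooth_p b := (hX.smooth_p b).smul a
  smooth_j b c := (hX.smooth_j b c).smul a
  smooth_q α := (hX.smooth_q α).smul a

lemma dComps_add (hX : IsPotential 𝒜 X) (hY : IsPotential 𝒜 Y) :
    dComps (X + Y) = dComps X + dComps Y :=
  Prod.ext (funext fun a => extD_add (hX.smooth_p a) (hY.smooth_p a)) (Prod.ext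
    (funext fun a => funext fun b => extD_add (hX.smooth_j a b) (hY.smooth_j a b))
    (funext fun α => extD_add (hX.smooth_q α) (hY.smooth_q α)))

lemma dComps_sub (hX : IsPotential 𝒜 X) (hY : IsPotential 𝒜 Y) :
    dComps (X - Y) = dComps X - dComps Y :=
  Prod.ext (funext fun a => extD_sub (hX.smooth_p a) (hY.smooth_p a)) (Prod.ext
    (funext fun a => funext fun b => extD_sub (hX.smooth_j a b) (hY.smooth_j a b))
    (funext fun α => extD_sub (hX.smooth_q α) (hY.smooth_q α)))

lemma dComps_smul (a : ℂ) (hX : IsPotential 𝒜 X) : dComps (a • X) = a • dComps X :=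
  Prod.ext (funext fun b => extD_smul a (hX.smooth_p b)) (Prod.ext
    (funext fun b => funext fun c => extD_smul a (hX.smooth_j b c))
    (funext fun α => extD_smul a (hX.smooth_q α)))

lemma dComps_zero : dComps (0 : Comps (DForm M B k)) = 0 :=
  Prod.ext (funext fun _ => extD_zero) (Prod.ext
    (funext fun _ => funext fun _ => extD_zero) (funext fun _ => extD_zero))

lemma comps_matD (hX : IsPotential 𝒜 X) : comps (matD (superEltL _ X)) = dComps X := by
  refine Prod.ext (funext fun a => ?_) (Prod.ext (funext fun a => funext fun b => ?_)
    (funext fun α => ?_))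
  · simp only [comps, compP, matD, Matrix.map_apply, superEltL_apply, superElt_vec]
    rfl
  · simp only [comps, compJ, matD, Matrix.map_apply, superEltL_apply, superElt_lorentz hX.antisymm,
      extD_smul _ (hX.smooth_j _ _), dComps, Fin.sum_univ_three]
    revert b
    simp only [forall_fin_three, η_entries]
    refine ⟨?_, ?_, ?_⟩ <;> module
  · simp only [comps, compQ, matD, Matrix.map_apply, superEltL_apply, superElt_spinor_scalar,
      extD_neg (hX.smooth_q _), neg_neg]
    rfl

lemma comps_curvature (hX : IsPotential 𝒜 X) :
    comps (curvature (superEltL _ X)) = dComps X + mulC (wedgeBilin M B 1) X X := by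
  rw [curvature, comps_add, hX.comps_matD, comps_matWedge hX.antisymm hX.antisymm]

/-- The integrand of the transgression form. -/
lemma pairing_curvature (hX : IsPotential 𝒜 X) (hY : IsPotential 𝒜 Y) (t : ℂ) :
    pairing (superEltL _ X) (curvature (superEltL _ (Y + t • X))) =
      (pairC (wedgeBilin M B 2) X (dComps Y)
        + (1 / 2 : ℂ) • cubicC (wedgeBilin M B 1) (wedgeBilin M B 2) X Y Y)
      + t • (pairC (wedgeBilin M B 2) X (dComps X)
        + cubicC (wedgeBilin M B 1) (wedgeBilin M B 2) X Y X)
      + t ^ 2 • ((1 / 2 : ℂ) • cubicC (wedgeBilin M B 1) (wedgeBilin M B 2) X X X) := by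
  rw [pairing_eq_pairC hX.antisymm, (hY.add (hX.smul t)).comps_curvature,
    hY.dComps_add (hX.smul t), hX.dComps_smul, map_add, pairC_mulC_self, map_add, map_smul]
  have h3 (Z : Comps (DForm M B 1)) : cubicC (wedgeBilin M B 1) (wedgeBilin M B 2) X Z (t • X) =
      t • cubicC (wedgeBilin M B 1) (wedgeBilin M B 2) X Z X := by
    rw [cubicC_comm, cubicC_smul_right, cubicC_comm]
  simp only [cubicC_add_right, cubicC_smul_right, cubicC_comm _ _ (Y + t • X), h3]
  rw [cubicC_comm X X Y]
  module

/-- The exterior derivative of the invariant form of two potentials. -/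
lemma extD_pairC (h𝒜 : IsSupercommutative 𝒜) (hX : IsPotential 𝒜 X) (hY : IsPotential 𝒜 Y) :
    extD (pairC (wedgeBilin M B 1) X Y) =
      pairC (wedgeBilin M B 2) Y (dComps X) - pairC (wedgeBilin M B 2) X (dComps Y) := by
  -- For an antisymmetric second argument the antisymmetrized differences cancel the factor `1 / 2`,
  -- leaving a signed sum of wedge products to which the graded Leibniz rules apply.
  have hp (Z Z' : Comps (DForm M B 1)) (hZ' : ∀ a b, Z'.2.1 a b = -Z'.2.1 b a) :
      pairC (wedgeBilin M B 1) Z Z' = wedge (Z.2.1 0 1) (Z'.1 2) - wedge (Z.2.1 0 2) (Z'.1 1)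
        + wedge (Z.2.1 1 2) (Z'.1 0) + wedge (Z.1 2) (Z'.2.1 0 1) - wedge (Z.1 1) (Z'.2.1 0 2)
        + wedge (Z.1 0) (Z'.2.1 1 2) + wedge (Z.2.2 0) (Z'.2.2 1) - wedge (Z.2.2 1) (Z'.2.2 0) := by
    rw [pairC_apply, hZ' 1 0, hZ' 2 0, hZ' 2 1]
    simp only [sub_neg_eq_add, map_add]
    change _ = wedgeBilin M B 1 _ _ - wedgeBilin M B 1 _ _ + wedgeBilin M B 1 _ _
      + wedgeBilin M B 1 _ _ - wedgeBilin M B 1 _ _ + wedgeBilin M B 1 _ _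
      + wedgeBilin M B 1 _ _ - wedgeBilin M B 1 _ _
    module
  have hd (Z Z' : Comps (DForm M B 1)) (hZ' : IsPotential 𝒜 Z') :
      pairC (wedgeBilin M B 2) Z (dComps Z') =
        wedge (Z.2.1 0 1) (extD (Z'.1 2)) - wedge (Z.2.1 0 2) (extD (Z'.1 1))
        + wedge (Z.2.1 1 2) (extD (Z'.1 0)) + wedge (Z.1 2) (extD (Z'.2.1 0 1))
        - wedge (Z.1 1) (extD (Z'.2.1 0 2)) + wedge (Z.1 0) (extD (Z'.2.1 1 2))
        + wedge (Z.2.2 0) (extD (Z'.2.2 1)) - wedge (Z.2.2 1) (extD (Z'.2.2 0)) := by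
    have h1 a b : extD (Z'.2.1 a b) = -extD (Z'.2.1 b a) := by
      rw [hZ'.antisymm a b, extD_neg (hZ'.smooth_j b a)]
    rw [pairC_apply]
    simp only [dComps]
    rw [h1 1 0, h1 2 0, h1 2 1]
    simp only [sub_neg_eq_add, map_add]
    change _ = wedgeBilin M B 2 _ _ - wedgeBilin M B 2 _ _ + wedgeBilin M B 2 _ _
      + wedgeBilin M B 2 _ _ - wedgeBilin M B 2 _ _ + wedgeBilin M B 2 _ _
      + wedgeBilin M B 2 _ _ - wedgeBilin M B 2 _ _
    module
  have wjp a b c := (hX.smooth_j a b).wedge (hY.smooth_p c)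
  have wpj a b c := (hX.smooth_p c).wedge (hY.smooth_j a b)
  have wqq α β := (hX.smooth_q α).wedge (hY.smooth_q β)
  have djp a b c := h𝒜.extD_even_wedge (hX.smooth_j a b) (hY.smooth_p c) (hX.even_j a b)
  have dpj a b c := h𝒜.extD_even_wedge (hX.smooth_p c) (hY.smooth_j a b) (hX.even_p c)
  have dqq α β := h𝒜.extD_odd_wedge (hX.smooth_q α) (hY.smooth_q β) (hX.odd_q α) (hY.odd_q β)
  rw [hp X Y hY.antisymm, hd X Y hY, hd Y X hX,
    extD_sub (((((((wjp 0 1 2).sub (wjp 0 2 1)).add (wjp 1 2 0)).add (wpj 0 1 2)).sub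
      (wpj 0 2 1)).add (wpj 1 2 0)).add (wqq 0 1)) (wqq 1 0),
    extD_add ((((((wjp 0 1 2).sub (wjp 0 2 1)).add (wjp 1 2 0)).add (wpj 0 1 2)).sub
      (wpj 0 2 1)).add (wpj 1 2 0)) (wqq 0 1),
    extD_add (((((wjp 0 1 2).sub (wjp 0 2 1)).add (wjp 1 2 0)).add (wpj 0 1 2)).sub
      (wpj 0 2 1)) (wpj 1 2 0),
    extD_sub ((((wjp 0 1 2).sub (wjp 0 2 1)).add (wjp 1 2 0)).add (wpj 0 1 2)) (wpj 0 2 1),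
    extD_add (((wjp 0 1 2).sub (wjp 0 2 1)).add (wjp 1 2 0)) (wpj 0 1 2),
    extD_add ((wjp 0 1 2).sub (wjp 0 2 1)) (wjp 1 2 0),
    extD_sub (wjp 0 1 2) (wjp 0 2 1)]
  simp only [djp, dpj, dqq]
  abel

variable [CompleteSpace B]

lemma integral_quadratic {V : Type*} [NormedAddCommGroup V] [NormedSpace ℝ V] [CompleteSpace V]
    (a b c : V) : ∫ t in (0 : ℝ)..1, (a + t • b + t ^ 2 • c) =
      a + (1 / 2 : ℝ) • b + (1 / 3 : ℝ) • c := by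
  have h1 : IntervalIntegrable (fun t : ℝ => t • b) MeasureTheory.volume 0 1 :=
    Continuous.intervalIntegrable (by fun_prop) _ _
  have h2 : IntervalIntegrable (fun t : ℝ => t ^ 2 • c) MeasureTheory.volume 0 1 :=
    Continuous.intervalIntegrable (by fun_prop) _ _
  rw [intervalIntegral.integral_add (intervalIntegrable_const.add h1) h2,
    intervalIntegral.integral_add intervalIntegrable_const h1,
    intervalIntegral.integral_smul_const, intervalIntegral.integral_smul_const]
  norm_num

/-- By `pairing_curvature` the integrand is quadratic in `t`; its coefficients are weighted by `1`,
`1 / 2`, `1 / 3`. -/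
lemma transgression_eq (hX : IsPotential 𝒜 X) (hY : IsPotential 𝒜 Y) :
    transgression (superEltL _ X) (superEltL _ Y) =
      transgressionC (wedgeBilin M B 1) (wedgeBilin M B 2) (X - Y) Y (dComps X - dComps Y)
        (dComps Y) := by
  -- The integration parameter is real, whereas the component calculus is linear over `ℂ`.
  have hlin (t : ℝ) : superEltL _ Y + t • (superEltL _ X - superEltL _ Y) =
      superEltL _ (Y + (t : ℂ) • (X - Y)) := by
    rw [map_add, map_smul, map_sub]
    rfl
  funext x
  rw [transgression, ← map_sub]
  have h1 (t : ℝ) := congrFun ((hX.sub hY).pairing_curvature hY (t : ℂ)) x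
  simp only [← map_sub] at hlin
  simp only [hlin, h1]
  set P₀ := (pairC (wedgeBilin M B 2) (X - Y) (dComps Y)
        + (1 / 2 : ℂ) • cubicC (wedgeBilin M B 1) (wedgeBilin M B 2) (X - Y) Y Y) with hP₀
  set P₁ := (pairC (wedgeBilin M B 2) (X - Y) (dComps (X - Y))
        + cubicC (wedgeBilin M B 1) (wedgeBilin M B 2) (X - Y) Y (X - Y)) with hP₁
  set P₂ := ((1 / 2 : ℂ) • cubicC (wedgeBilin M B 1) (wedgeBilin M B 2) (X - Y) (X - Y) (X - Y))
    with hP₂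
  have h2 (t : ℝ) : (P₀ + (t : ℂ) • P₁ + (t : ℂ) ^ 2 • P₂) x =
      P₀ x + t • P₁ x + t ^ 2 • P₂ x := by
    rw [← Complex.ofReal_pow]
    rfl
  simp only [h2]
  rw [integral_quadratic]
  have h3 : (2 : ℝ) • (P₀ x + (1 / 2 : ℝ) • P₁ x + (1 / 3 : ℝ) • P₂ x) =
      ((2 : ℂ) • P₀ + P₁ + (2 / 3 : ℂ) • P₂) x := by
    have hr (r : ℝ) (Z : E3 [⋀^Fin (2 + 1)]→L[ℝ] B) : r • Z = (r : ℂ) • Z := rfl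
    change _ = (2 : ℂ) • P₀ x + P₁ x + (2 / 3 : ℂ) • P₂ x
    rw [hr, hr, hr]
    push_cast
    module
  have h4 : transgressionC (wedgeBilin M B 1) (wedgeBilin M B 2) (X - Y) Y (dComps X - dComps Y)
      (dComps Y) = (2 : ℂ) • P₀ + P₁ + (2 / 3 : ℂ) • P₂ := by
    rw [hP₀, hP₁, hP₂, hX.dComps_sub hY, transgressionC]
    module
  rw [h3, h4]

end IsPotential

end Potentials

/-! ### Forms entering the actions, and their smoothness. -/

section Actions

variable {M : Type*} [TopologicalSpace M] [ChartedSpace (EuclideanHalfSpace 3) M]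
  [IsManifold (𝓡∂ 3) ∞ M]
variable {B : Type*} [NormedRing B] [NormedAlgebra ℂ B] {k : ℕ}
variable {𝒜 : ZMod 2 → Submodule ℂ B} {X Y : Comps (DForm M B 1)}

/-- The triangle `0 ≤ s ≤ t ≤ 1` has area `1 / 2`, so the boundary form is just the pairing of the
difference with the second potential. -/
lemma integral_mul_const_unit {V : Type*} [NormedAddCommGroup V] [NormedSpace ℝ V]
    [CompleteSpace V] (c : V) : (2 : ℝ) • ∫ t in (0 : ℝ)..1, ∫ _s in (0 : ℝ)..t, c = c := by
  simp only [intervalIntegral.integral_const, sub_zero]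
  rw [intervalIntegral.integral_smul_const, smul_smul]
  norm_num

lemma boundaryForm_eq [CompleteSpace B] (A A' : Matrix Idx Idx (DForm M B 1)) :
    boundaryForm A A' = pairing (A - A') A' := funext fun _ => integral_mul_const_unit _

lemma chernSimons_eq [CompleteSpace B] (hX : IsPotential 𝒜 X) : chernSimons (superEltL _ X) =
    chernSimonsC (wedgeBilin M B 1) (wedgeBilin M B 2) X (dComps X) := by
  have h := hX.transgression_eq (𝒜 := 𝒜) IsPotential.zero
  rw [map_zero, sub_zero, IsPotential.dComps_zero, sub_zero, transgressionC_zero] at h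
  exact h

/-- The transgression form is the difference of two Chern–Simons forms up to an exact form. -/
lemma transgression_eq_sub [CompleteSpace B] (h𝒜 : IsSupercommutative 𝒜) (hX : IsPotential 𝒜 X)
    (hY : IsPotential 𝒜 Y) : transgression (superEltL _ X) (superEltL _ Y) =
      chernSimons (superEltL _ X) - chernSimons (superEltL _ Y)
        - extD (boundaryForm (superEltL _ X) (superEltL _ Y)) := by
  rw [boundaryForm_eq, ← map_sub, pairing_eq_pairC (hX.sub hY).antisymm, comps_superElt hY.antisymm,
    (hX.sub hY).extD_pairC h𝒜 hY, hX.dComps_sub hY, hX.transgression_eq hY,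
    transgressionC_eq_sub (superExterior_wedge h𝒜) hX.toIsEvenComps hY.toIsEvenComps,
    chernSimons_eq hX, chernSimons_eq hY]

lemma IsPotential.smooth_pairC {Z : Comps (DForm M B k)} (hX : IsPotential 𝒜 X)
    (hp : ∀ a, IsSmoothForm (Z.1 a)) (hj : ∀ a b, IsSmoothForm (Z.2.1 a b))
    (hq : ∀ α, IsSmoothForm (Z.2.2 α)) : IsSmoothForm (pairC (wedgeBilin M B k) X Z) := by
  have h {α : DForm M B 1} {β : DForm M B k} (hα : IsSmoothForm α) (hβ : IsSmoothForm β) :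
      IsSmoothForm (wedgeBilin M B k α β) := hα.wedge hβ
  have hj' a b := (hj a b).sub (hj b a)
  rw [pairC_apply]
  exact ((((h (hX.smooth_j _ _) (hp _)).sub (h (hX.smooth_j _ _) (hp _))).add
    (h (hX.smooth_j _ _) (hp _))).add ((((h (hX.smooth_p _) (hj' _ _)).sub
    (h (hX.smooth_p _) (hj' _ _))).add (h (hX.smooth_p _) (hj' _ _))).smul _)).add
    ((h (hX.smooth_q _) (hq _)).sub (h (hX.smooth_q _) (hq _)))

lemma smooth_chernSimons [CompleteSpace B] (hX : IsPotential 𝒜 X) :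
    IsSmoothForm (chernSimons (superEltL _ X)) := by
  have h {α β : DForm M B 1} (hα : IsSmoothForm α) (hβ : IsSmoothForm β) :
      IsSmoothForm (wedgeBilin M B 1 α β) := hα.wedge hβ
  have hp a : IsSmoothForm ((mulC (wedgeBilin M B 1) X X).1 a) :=
    (IsSmoothForm.sum _ fun c => (h (hX.smooth_j a c) (hX.smooth_p c)).smul _).add
      (IsSmoothForm.sum _ fun α => IsSmoothForm.sum _ fun β =>
        (h (hX.smooth_q α) (hX.smooth_q β)).smul _)
  have hj a b : IsSmoothForm ((mulC (wedgeBilin M B 1) X X).2.1 a b) :=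
    IsSmoothForm.sum _ fun c => (h (hX.smooth_j a c) (hX.smooth_j c b)).smul _
  have hq α : IsSmoothForm ((mulC (wedgeBilin M B 1) X X).2.2 α) :=
    (IsSmoothForm.sum _ fun β => (((h (hX.smooth_j 0 1) (hX.smooth_q β)).smul _).add
      ((h (hX.smooth_j 0 2) (hX.smooth_q β)).smul _)).add
      ((h (hX.smooth_j 1 2) (hX.smooth_q β)).smul _)).smul _
  rw [chernSimons_eq hX, chernSimonsC, cubicC]
  exact (hX.smooth_pairC (fun a => (hX.smooth_p a).extD) (fun a b => (hX.smooth_j a b).extD)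
    fun α => (hX.smooth_q α).extD).add ((hX.smooth_pairC (fun a => (hp a).add (hp a))
      (fun a b => (hj a b).add (hj a b)) fun α => (hq α).add (hq α)).smul _)

lemma smooth_boundaryForm [CompleteSpace B] (hX : IsPotential 𝒜 X) (hY : IsPotential 𝒜 Y) :
    IsSmoothForm (boundaryForm (superEltL _ X) (superEltL _ Y)) := by
  rw [boundaryForm_eq, ← map_sub, pairing_eq_pairC (hX.sub hY).antisymm, comps_superElt hY.antisymm]
  exact (hX.sub hY).smooth_pairC hY.smooth_p hY.smooth_j hY.smooth_q

lemma IsSmoothForm.bar {ψ : Fin 2 → DForm M B k} (h : ∀ α, IsSmoothForm (ψ α)) (α : Fin 2) :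
    IsSmoothForm (bar ψ α) := IsSmoothForm.sum _ fun β => (h β).smul _

lemma extD_bar {ψ : Fin 2 → DForm M B k} (h : ∀ α, IsSmoothForm (ψ α)) (α : Fin 2) :
    extD (bar ψ α) = bar (fun α => extD (ψ α)) α := by
  rw [bar, extD_sum _ fun β => (h β).smul _]
  exact Finset.sum_congr rfl fun β _ => extD_smul _ (h β)

lemma lmul_bar (χ : Fin 2 → M → B) (α : Fin 2) (β : DForm M B k) :
    lmul (bar χ α) β = ∑ γ, chargeConj γ α • lmul (χ γ) β := by
  refine ((lmulBilin M B k).map_sum₂ _ _ β).trans (Finset.sum_congr rfl fun γ _ => ?_)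
  exact lmul_smul_left _ _ _

end Actions

/-! ### The linear potential, the expected nonlinear potential and their difference. -/

namespace Fields

variable {M : Type*} [TopologicalSpace M] [ChartedSpace (EuclideanHalfSpace 3) M]
  [IsManifold (𝓡∂ 3) ∞ M]
variable {B : Type*} [NormedRing B] [NormedAlgebra ℂ B]
variable {𝒜 : ZMod 2 → Submodule ℂ B} (Φ : Fields M 𝒜)

lemma isPotential : IsPotential 𝒜 (Φ.e, Φ.w, bar Φ.ψ) where
  even_p := Φ.even_e
  even_j := Φ.even_w
  odd_q := DForm.HasParity.bar Φ.odd_ψ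
  antisymm := Φ.antisymm_w
  smooth_p := Φ.smooth_e
  smooth_j := Φ.smooth_w
  smooth_q := IsSmoothForm.bar Φ.smooth_ψ

lemma extD_w_antisymm (a b : Fin 3) : extD (Φ.w a b) = -extD (Φ.w b a) := by
  rw [Φ.antisymm_w a b, extD_neg (Φ.smooth_w b a)]

/-- The Chern–Simons form of the linear potential is the Lagrangian of supergravity up to an
exact form. -/
lemma chernSimons_eq [CompleteSpace B] (h𝒜 : IsSupercommutative 𝒜) :
    chernSimons Φ.gaugePotential = Φ.supergravityLagrangian
      - (1 / 2 : ℂ) • extD (∑ a, ∑ b, ∑ c, ε a b c • wedge (Φ.w a b) (Φ.e c)) := by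
  have hd : dComps (Φ.e, Φ.w, bar Φ.ψ) = (fun a => extD (Φ.e a), fun a b => extD (Φ.w a b),
      bar fun α => extD (Φ.ψ α)) :=
    Prod.ext rfl (Prod.ext rfl (funext fun α => extD_bar Φ.smooth_ψ α))
  have hs a b c := ((Φ.smooth_w a b).wedge (Φ.smooth_e c)).smul (ε a b c)
  have he : extD (∑ a, ∑ b, ∑ c, ε a b c • wedge (Φ.w a b) (Φ.e c)) = ∑ a, ∑ b, ∑ c, ε a b c •
      (wedge (Φ.e c) (extD (Φ.w a b)) - wedge (Φ.w a b) (extD (Φ.e c))) := by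
    rw [extD_sum _ fun a => IsSmoothForm.sum _ fun b => IsSmoothForm.sum _ fun c => hs a b c]
    refine Finset.sum_congr rfl fun a _ => ?_
    rw [extD_sum _ fun b => IsSmoothForm.sum _ fun c => hs a b c]
    refine Finset.sum_congr rfl fun b _ => ?_
    rw [extD_sum _ fun c => hs a b c]
    refine Finset.sum_congr rfl fun c _ => ?_
    rw [extD_smul _ ((Φ.smooth_w a b).wedge (Φ.smooth_e c)),
      h𝒜.extD_even_wedge (Φ.smooth_w a b) (Φ.smooth_e c) (Φ.even_w a b)]
  rw [he]
  refine (TopSugra.chernSimons_eq Φ.isPotential).trans ?_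
  rw [hd]
  exact chernSimonsC_eq (superExterior_wedge h𝒜) _ _ Φ.isPotential.toIsEvenComps Φ.odd_ψ
    Φ.extD_w_antisymm

lemma smooth_covDSpinor (α : Fin 2) : IsSmoothForm (covDSpinor Φ.w Φ.χ α) :=
  (IsSmoothForm.dFun (Φ.smooth_χ α)).add ((IsSmoothForm.sum _ fun a => IsSmoothForm.sum _ fun b =>
    IsSmoothForm.sum _ fun β => ((Φ.smooth_w a b).rmul (Φ.smooth_χ β)).smul _).smul _)

lemma odd_covDSpinor [GradedAlgebra 𝒜] (h𝒜 : IsSupercommutative 𝒜) (α : Fin 2) :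
    DForm.HasParity 𝒜 1 (covDSpinor Φ.w Φ.χ α) :=
  (h𝒜.dFun (Φ.smooth_χ α) (Φ.odd_χ α)).add ((DForm.HasParity.sum _ fun a =>
    DForm.HasParity.sum _ fun b => DForm.HasParity.sum _ fun β => DForm.HasParity.smul _
      (DForm.HasParity.rmul (i := 0) (j := 1) (Φ.even_w a b) (Φ.odd_χ β))).smul _)

lemma smooth_covDVec (a : Fin 3) : IsSmoothForm (covDVec Φ.w Φ.φ a) :=
  (IsSmoothForm.dFun (Φ.smooth_φ a)).add (IsSmoothForm.sum _ fun b => IsSmoothForm.sum _ fun c =>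
    ((Φ.smooth_w a c).rmul (Φ.smooth_φ b)).smul _)

lemma even_covDVec [GradedAlgebra 𝒜] (h𝒜 : IsSupercommutative 𝒜) (a : Fin 3) :
    DForm.HasParity 𝒜 0 (covDVec Φ.w Φ.φ a) :=
  (h𝒜.dFun (Φ.smooth_φ a) (Φ.even_φ a)).add (DForm.HasParity.sum _ fun b =>
    DForm.HasParity.sum _ fun c => DForm.HasParity.smul _
      (DForm.HasParity.rmul (i := 0) (j := 0) (Φ.even_w a c) (Φ.even_φ b)))

lemma smooth_bilinear {ξ : Fin 2 → DForm M B 1} (h : ∀ β, IsSmoothForm (ξ β)) (a : Fin 3) :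
    IsSmoothForm (∑ α, ∑ β, Γup a α β • lmul (bar Φ.χ α) (ξ β)) :=
  IsSmoothForm.sum _ fun α => IsSmoothForm.sum _ fun β => IsSmoothForm.smul _ <| by
    rw [lmul_bar]
    exact IsSmoothForm.sum _ fun γ => ((h β).lmul (Φ.smooth_χ γ)).smul _

lemma even_bilinear [GradedAlgebra 𝒜] {ξ : Fin 2 → DForm M B 1}
    (h : ∀ β, DForm.HasParity 𝒜 1 (ξ β)) (a : Fin 3) :
    DForm.HasParity 𝒜 0 (∑ α, ∑ β, Γup a α β • lmul (bar Φ.χ α) (ξ β)) :=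
  DForm.HasParity.sum _ fun α => DForm.HasParity.sum _ fun β => DForm.HasParity.smul _ <| by
    rw [lmul_bar]
    exact DForm.HasParity.sum _ fun γ => DForm.HasParity.smul _
      (DForm.HasParity.lmul (i := 1) (j := 1) (Φ.odd_χ γ) (h β))

/-- The difference of the linear and of the nonlinear gauge potential. -/
def difference : Comps (DForm M B 1) := (fun a => Φ.e a - Φ.V a, 0, bar (covDSpinor Φ.w Φ.χ))

lemma difference_vec (a : Fin 3) : Φ.e a - Φ.V a = covDVec Φ.w Φ.φ a
    - (Complex.I / 2) • (∑ α, ∑ β, Γup a α β • lmul (bar Φ.χ α) (Φ.ψ β))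
    + (Complex.I / 4) • ∑ α, ∑ β, Γup a α β • lmul (bar Φ.χ α) (covDSpinor Φ.w Φ.χ β) := by
  rw [V]; abel

lemma isPotential_difference [GradedAlgebra 𝒜] (h𝒜 : IsSupercommutative 𝒜) :
    IsPotential 𝒜 Φ.difference where
  even_p a := by
    change DForm.HasParity 𝒜 0 (Φ.e a - Φ.V a)
    rw [difference_vec]
    exact ((Φ.even_covDVec h𝒜 a).sub ((Φ.even_bilinear Φ.odd_ψ a).smul _)).add
      ((Φ.even_bilinear (Φ.odd_covDSpinor h𝒜) a).smul _)
  even_j _ _ := DForm.HasParity.zero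
  odd_q := DForm.HasParity.bar (Φ.odd_covDSpinor h𝒜)
  antisymm _ _ := neg_zero.symm
  smooth_p a := by
    change IsSmoothForm (Φ.e a - Φ.V a)
    rw [difference_vec]
    exact ((Φ.smooth_covDVec a).sub ((Φ.smooth_bilinear Φ.smooth_ψ a).smul _)).add
      ((Φ.smooth_bilinear Φ.smooth_covDSpinor a).smul _)
  smooth_j _ _ := IsSmoothForm.zero
  smooth_q := IsSmoothForm.bar Φ.smooth_covDSpinor

/-- This concerns only the explicit fields `V`, `W`, `Ψ`; that they come from the gauge
transformation is established separately in `nonlinearPotential_eq`. -/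
lemma nonlinear_comps : ((Φ.V, Φ.W, bar Φ.Ψ) : Comps (DForm M B 1)) =
    (Φ.e, Φ.w, bar Φ.ψ) - Φ.difference := by
  refine Prod.ext (funext fun a => ?_) (Prod.ext (funext fun a => funext fun b => ?_)
    (funext fun α => ?_))
  · exact (sub_sub_cancel (Φ.e a) (Φ.V a)).symm
  · exact (sub_zero (Φ.w a b)).symm
  · change bar Φ.Ψ α = bar Φ.ψ α - bar (covDSpinor Φ.w Φ.χ) α
    simp only [bar, Ψ, Fin.sum_univ_two]
    module

lemma isPotential_nonlinear [GradedAlgebra 𝒜] (h𝒜 : IsSupercommutative 𝒜) :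
    IsPotential 𝒜 (Φ.V, Φ.W, bar Φ.Ψ) := by
  rw [nonlinear_comps]
  exact Φ.isPotential.sub (Φ.isPotential_difference h𝒜)

end Fields

/-! ### Antisymmetry of the Lorentz curvature. -/

section LorentzCurvature

variable {N₁ N₂ N₃ : Type*} [AddCommGroup N₁] [Module ℂ N₁]
  [AddCommGroup N₂] [Module ℂ N₂] [AddCommGroup N₃] [Module ℂ N₃]
variable {m : N₁ →ₗ[ℂ] N₁ →ₗ[ℂ] N₂} {n : N₁ →ₗ[ℂ] N₂ →ₗ[ℂ] N₃} {E : ZMod 2 → Set N₁}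
variable {w : Fin 3 → Fin 3 → N₁} {r dw : Fin 3 → Fin 3 → N₂}

lemma η_comm (a b : Fin 3) : η a b = η b a := by
  revert a b
  simp only [forall_fin_three, η_entries, and_self]

lemma curvature_antisymm (h : SuperExterior m n E) (hw : ∀ a b, w a b ∈ E 0)
    (aw : ∀ a b, w a b = -w b a) (adw : ∀ a b, dw a b = -dw b a)
    (hr : ∀ a b, r a b = dw a b + ∑ c, ∑ d, η d c • m (w a d) (w c b)) (a b : Fin 3) :
    r a b = -r b a := by
  have h1 c d : m (w a d) (w c b) = -m (w b c) (w d a) := by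
    rw [h.comm_even _ (hw a d), aw c b, aw a d]
    simp only [map_neg, LinearMap.neg_apply, neg_neg]
  rw [hr, hr, adw a b, neg_add]
  congr 1
  rw [Finset.sum_comm, ← Finset.sum_neg_distrib]
  refine Finset.sum_congr rfl fun d _ => ?_
  rw [← Finset.sum_neg_distrib]
  refine Finset.sum_congr rfl fun c _ => ?_
  rw [h1, smul_neg, η_comm]

end LorentzCurvature

/-! ### Exactness of the transgression form for the fields. -/

namespace Fields

variable {M : Type*} [TopologicalSpace M] [ChartedSpace (EuclideanHalfSpace 3) M]
  [IsManifold (𝓡∂ 3) ∞ M]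
variable {B : Type*} [NormedRing B] [NormedAlgebra ℂ B]
variable {𝒜 : ZMod 2 → Submodule ℂ B} (Φ : Fields M 𝒜)

lemma smooth_lorentzCurv (a b : Fin 3) : IsSmoothForm (lorentzCurv Φ.w a b) :=
  (Φ.smooth_w a b).extD.add (IsSmoothForm.sum _ fun c => IsSmoothForm.sum _ fun d =>
    ((Φ.smooth_w a d).wedge (Φ.smooth_w c b)).smul _)

/-- Since `ddω = 0`, only the derivative of `ω ∧ ω` remains, and `bianchi` replaces `dω` by the
curvature in it. -/
lemma extD_lorentzCurv (h𝒜 : IsSupercommutative 𝒜) (a b : Fin 3) :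
    extD (lorentzCurv Φ.w a b) = ∑ c, ∑ d, η d c •
      (wedge (Φ.w c b) (lorentzCurv Φ.w a d) - wedge (Φ.w a d) (lorentzCurv Φ.w c b)) := by
  have hs c d := ((Φ.smooth_w a d).wedge (Φ.smooth_w c b)).smul (η d c)
  refine Eq.trans ?_ (bianchi (superExterior_wedge h𝒜) Φ.even_w Φ.antisymm_w Φ.extD_w_antisymm
    (fun _ _ => rfl) a b)
  rw [lorentzCurv, extD_add (Φ.smooth_w a b).extD
    (IsSmoothForm.sum _ fun c => IsSmoothForm.sum _ fun d => hs c d),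
    extD_extD (Φ.smooth_w a b), zero_add, extD_sum _ fun c => IsSmoothForm.sum _ fun d => hs c d]
  refine Finset.sum_congr rfl fun c _ => ?_
  rw [extD_sum _ fun d => hs c d]
  refine Finset.sum_congr rfl fun d _ => ?_
  rw [extD_smul _ ((Φ.smooth_w a d).wedge (Φ.smooth_w c b)),
    h𝒜.extD_even_wedge (Φ.smooth_w a d) (Φ.smooth_w c b) (Φ.even_w a d)]
  rfl

lemma covDSpinor_eq (h𝒜 : IsSupercommutative 𝒜) (α : Fin 2) : covDSpinor Φ.w Φ.χ α =
    dFun (Φ.χ α) + (1 / 4 : ℂ) • ∑ a, ∑ b, ∑ β, Γ₂ a b α β • lmul (Φ.χ β) (Φ.w a b) := by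
  simp only [covDSpinor, h𝒜.even_rmul (Φ.even_w _ _)]

/-- As `ω` is even, `χ` can be moved to its left, so that `extD_lmul` applies; `covDSpinor_sq` then
collects the curvature. -/
lemma extD_covDSpinor (h𝒜 : IsSupercommutative 𝒜) (α : Fin 2) :
    extD (covDSpinor Φ.w Φ.χ α) = (1 / 4 : ℂ) • ∑ a, ∑ b, ∑ β, Γ₂ a b α β •
      (lmul (Φ.χ β) (lorentzCurv Φ.w a b) - wedge (Φ.w a b) (covDSpinor Φ.w Φ.χ β)) := by
  have hl a b β := (Φ.smooth_w a b).lmul (Φ.smooth_χ β)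
  have hs a b β := (hl a b β).smul (Γ₂ a b α β)
  have h1 := IsSmoothForm.sum Finset.univ fun a => IsSmoothForm.sum Finset.univ fun b =>
    IsSmoothForm.sum Finset.univ fun β => hs a b β
  refine Eq.trans ?_ (covDSpinor_sq (l₁ := lmulBilin M B 1) (l₂ := lmulBilin M B 2)
    (superExterior_wedge h𝒜) Φ.even_w Φ.antisymm_w Φ.extD_w_antisymm
    (fun _ _ => rfl) wedge_lmul_left (Φ.covDSpinor_eq h𝒜) α)
  rw [Φ.covDSpinor_eq h𝒜, extD_add (IsSmoothForm.dFun (Φ.smooth_χ α)) (h1.smul _),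
    extD_dFun (Φ.smooth_χ α), zero_add, extD_smul _ h1,
    extD_sum _ fun a => IsSmoothForm.sum _ fun b => IsSmoothForm.sum _ fun β => hs a b β]
  congr 1
  refine Finset.sum_congr rfl fun a _ => ?_
  rw [extD_sum _ fun b => IsSmoothForm.sum _ fun β => hs a b β]
  refine Finset.sum_congr rfl fun b _ => ?_
  rw [extD_sum _ fun β => hs a b β]
  refine Finset.sum_congr rfl fun β _ => ?_
  rw [extD_smul _ (hl a b β), extD_lmul (Φ.smooth_χ β) (Φ.smooth_w a b)]
  rfl

lemma topologicalLagrangian_eq (h𝒜 : IsSupercommutative 𝒜) : Φ.topologicalLagrangian =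
    (∑ a, ∑ b, ∑ c, ε a b c • lmul (Φ.φ c) (lorentzCurv Φ.w a b))
      - (2 * Complex.I) • ∑ α, wedge (bar Φ.ψ α) (covDSpinor Φ.w Φ.χ α) := by
  simp only [topologicalLagrangian, h𝒜.rmul_even (Φ.even_φ _)]

lemma smooth_topologicalLagrangian_fst : IsSmoothForm
    (∑ a, ∑ b, ∑ c, ε a b c • lmul (Φ.φ c) (lorentzCurv Φ.w a b)) :=
  IsSmoothForm.sum _ fun a => IsSmoothForm.sum _ fun b => IsSmoothForm.sum _ fun c =>
    ((Φ.smooth_lorentzCurv a b).lmul (Φ.smooth_φ c)).smul _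

lemma smooth_topologicalLagrangian_snd : IsSmoothForm
    (∑ α, wedge (bar Φ.ψ α) (covDSpinor Φ.w Φ.χ α)) :=
  IsSmoothForm.sum _ fun α => (IsSmoothForm.bar Φ.smooth_ψ α).wedge (Φ.smooth_covDSpinor α)

lemma smooth_topologicalLagrangian (h𝒜 : IsSupercommutative 𝒜) :
    IsSmoothForm Φ.topologicalLagrangian := by
  rw [Φ.topologicalLagrangian_eq h𝒜]
  exact Φ.smooth_topologicalLagrangian_fst.sub (Φ.smooth_topologicalLagrangian_snd.smul _)

/-- Pure Leibniz rule: the derivatives of the curvature and of `D_ω χ` are left unevaluated, as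
`transgressionC_eq` takes their values as hypotheses. -/
lemma extD_topologicalLagrangian [GradedAlgebra 𝒜] (h𝒜 : IsSupercommutative 𝒜) :
    extD Φ.topologicalLagrangian =
      (∑ a, ∑ b, ∑ c, ε a b c • (wedge (dFun (Φ.φ c)) (lorentzCurv Φ.w a b)
        + lmul (Φ.φ c) (extD (lorentzCurv Φ.w a b))))
      - (2 * Complex.I) • ∑ α, (-wedge (covDSpinor Φ.w Φ.χ α) (bar (fun β => extD (Φ.ψ β)) α)
        - wedge (bar Φ.ψ α) (extD (covDSpinor Φ.w Φ.χ α))) := by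
  have hl a b c := (Φ.smooth_lorentzCurv a b).lmul (Φ.smooth_φ c)
  have hs a b c := (hl a b c).smul (ε a b c)
  rw [Φ.topologicalLagrangian_eq h𝒜, extD_sub Φ.smooth_topologicalLagrangian_fst
    (Φ.smooth_topologicalLagrangian_snd.smul _), extD_smul _ Φ.smooth_topologicalLagrangian_snd]
  congr 1
  · rw [extD_sum _ fun a => IsSmoothForm.sum _ fun b => IsSmoothForm.sum _ fun c => hs a b c]
    refine Finset.sum_congr rfl fun a _ => ?_
    rw [extD_sum _ fun b => IsSmoothForm.sum _ fun c => hs a b c]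
    refine Finset.sum_congr rfl fun b _ => ?_
    rw [extD_sum _ fun c => hs a b c]
    refine Finset.sum_congr rfl fun c _ => ?_
    rw [extD_smul _ (hl a b c), extD_lmul (Φ.smooth_φ c) (Φ.smooth_lorentzCurv a b)]
  · congr 1
    rw [extD_sum _ fun α => (IsSmoothForm.bar Φ.smooth_ψ α).wedge (Φ.smooth_covDSpinor α)]
    refine Finset.sum_congr rfl fun α _ => ?_
    rw [h𝒜.extD_odd_wedge (IsSmoothForm.bar Φ.smooth_ψ α) (Φ.smooth_covDSpinor α)
      (DForm.HasParity.bar Φ.odd_ψ α) (Φ.odd_covDSpinor h𝒜 α), extD_bar Φ.smooth_ψ]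

/-- The transgression form of the two potentials is exact. -/
lemma transgression_eq_extD [CompleteSpace B] [GradedAlgebra 𝒜] (h𝒜 : IsSupercommutative 𝒜) :
    transgression Φ.gaugePotential (superElt Φ.V Φ.W (bar Φ.Ψ)) =
      extD Φ.topologicalLagrangian := by
  have hX := Φ.isPotential
  have hZ := Φ.isPotential_difference h𝒜
  have hd : dComps (Φ.e, Φ.w, bar Φ.ψ) = (fun a => extD (Φ.e a), fun a b => extD (Φ.w a b),
      bar fun α => extD (Φ.ψ α)) :=
    Prod.ext rfl (Prod.ext rfl (funext fun α => extD_bar Φ.smooth_ψ α))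
  have hd' : dComps Φ.difference = (fun a => extD (Φ.e a - Φ.V a), 0,
      bar fun α => extD (covDSpinor Φ.w Φ.χ α)) :=
    Prod.ext rfl (Prod.ext (funext fun _ => funext fun _ => extD_zero)
      (funext fun α => extD_bar Φ.smooth_covDSpinor α))
  have ht := hX.transgression_eq (Φ.isPotential_nonlinear h𝒜)
  rw [Φ.nonlinear_comps, hX.dComps_sub hZ, sub_sub_cancel, sub_sub_cancel, hd, hd',
    ← Φ.nonlinear_comps] at ht
  refine ht.trans ?_
  rw [Φ.extD_topologicalLagrangian h𝒜, Φ.nonlinear_comps]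
  exact transgressionC_eq (l₁ := lmulBilin M B 1) (l₂ := lmulBilin M B 2) (l₃ := lmulBilin M B 3)
    (superExterior_wedge h𝒜) _ _ _ Φ.even_w Φ.antisymm_w Φ.odd_ψ
    (Φ.odd_covDSpinor h𝒜) (fun _ _ => rfl)
    (curvature_antisymm (superExterior_wedge h𝒜) Φ.even_w Φ.antisymm_w Φ.extD_w_antisymm
      fun _ _ => rfl) (Φ.extD_lorentzCurv h𝒜) (Φ.extD_covDSpinor h𝒜)
    (fun a => by
      rw [Φ.difference_vec, covDVec]
      simp only [h𝒜.even_rmul (Φ.even_w _ _)]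
      rfl)
    wedge_lmul_left (fun α a ha b => h𝒜.odd_wedge_lmul ha (Φ.odd_χ α) b)

end Fields

/-! ### Differentials of affine combinations of functions. -/

section Differential

variable {M : Type*} [TopologicalSpace M] [ChartedSpace (EuclideanHalfSpace 3) M]
variable {B : Type*} [NormedRing B] [NormedAlgebra ℂ B]

lemma dFun_apply_eq_of_hasMFDerivAt {f : M → B} {x : M} {f' : E3 →L[ℝ] B}
    (h : HasMFDerivAt (𝓡∂ 3) 𝓘(ℝ, B) f x f') (v : Fin 1 → E3) : dFun f x v = f' (v 0) := by
  exact congrArg (fun l : E3 →L[ℝ] B => l (v 0)) h.mfderiv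

/-- The differential of an affine combination of functions. -/
lemma dFun_affine {ι : Type*} [Fintype ι] {f : ι → M → B}
    (hf : ∀ i, ContMDiff (𝓡∂ 3) 𝓘(ℝ, B) ∞ (f i)) (b : B) (a : ι → ℂ) (x : M) (v : Fin 1 → E3) :
    dFun (fun y => b + ∑ i, a i • f i y) x v = ∑ i, a i • dFun (f i) x v := by
  let L : (ι → B) →L[ℝ] B := ∑ i, (a i • ContinuousLinearMap.id ℝ B).comp
    (ContinuousLinearMap.proj (R := ℝ) i)
  have hL (z : ι → B) : L z = ∑ i, a i • z i := by
    simp [L]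
  have hF : HasMFDerivAt (𝓡∂ 3) 𝓘(ℝ, ι → B) (fun y i => f i y) x
      (ContinuousLinearMap.pi fun i => (mfderiv (𝓡∂ 3) 𝓘(ℝ, B) (f i) x : E3 →L[ℝ] B)) := by
    have h i := ((hf i).mdifferentiableAt (x := x) (by simp)).hasMFDerivAt
    exact ⟨continuousAt_pi.2 fun i => (h i).1, hasFDerivWithinAt_pi.2 fun i => (h i).2⟩
  have hg : HasFDerivAt (fun z : ι → B => b + L z) L (fun i => f i x) :=
    (L.hasFDerivAt).const_add b
  have h := hg.hasMFDerivAt.comp x hF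
  have h' := dFun_apply_eq_of_hasMFDerivAt h v
  refine Eq.trans ?_ (h'.trans ?_)
  · congr 2
    funext y
    exact congrArg (b + ·) (hL _).symm
  · exact hL _

end Differential

/-! ### Nilpotency of supertranslations and conjugation by the coset element. -/

section Nilpotent

/-- The exponential series has finite support, so neither a norm nor completeness of `A` is
involved. -/
lemma exp_eq_one_add_of_mul_self_eq_zero {A : Type*} [Ring A] [Algebra ℂ A] [TopologicalSpace A]
    [IsTopologicalRing A] {x : A} (h : x * x = 0) : NormedSpace.exp x = 1 + x := by
  rw [NormedSpace.exp_eq_tsum ℂ]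
  refine (tsum_eq_sum (s := Finset.range 2) fun k hk => ?_).trans ?_
  · obtain ⟨j, rfl⟩ := Nat.exists_eq_add_of_le (not_lt.mp (fun h => hk (Finset.mem_range.mpr h)))
    rw [pow_add, pow_two, h, zero_mul, smul_zero]
  · simp [Finset.sum_range_succ]

lemma inverse_one_sub_of_mul_self_eq_zero {A : Type*} [Ring A] {z : A} (h : z * z = 0) :
    Ring.inverse (1 - z) = 1 + z :=
  Ring.inverse_unit ⟨1 - z, 1 + z, by noncomm_ring [h], by noncomm_ring [h]⟩

variable {B : Type*} [NormedRing B] [NormedAlgebra ℂ B]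

lemma matrix_mul_apply (Z Y : Matrix Idx Idx B) (r s : Idx) : (Z * Y) r s =
    (∑ c, Z r (.inl c) * Y (.inl c) s) + (Z r (.inr (.inl 0)) * Y (.inr (.inl 0)) s +
      ∑ β, Z r (.inr (.inr β)) * Y (.inr (.inr β)) s) := by
  simp only [Matrix.mul_apply, Fintype.sum_sum_type, Finset.univ_unique, Finset.sum_singleton]
  rfl

lemma superElt_translation (p : Fin 3 → B) (q : Fin 2 → B) (a d : Fin 3) :
    superElt p 0 q (.inl a) (.inl d) = 0 := by
  simp [superElt, genP, genQ]

lemma superElt_translation_spinor (p : Fin 3 → B) (q : Fin 2 → B) (α β : Fin 2) :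
    superElt p 0 q (.inr (.inr α)) (.inr (.inr β)) = 0 := by
  simp [superElt, genP, genQ]

/-- The only possible entry is the vector–scalar one, the contraction of `q α * q' β` with `Γlow`.
It is antisymmetric against symmetric, hence zero. -/
lemma translation_mul_translation {p p' : Fin 3 → B} {q q' : Fin 2 → B}
    (h : ∀ α β, q α * q' β = -(q β * q' α)) : superElt p 0 q * superElt p' 0 q' = 0 := by
  have h0 α : q α * q' α = 0 := eq_zero_of_eq_neg_self (h α α)
  ext r s
  rw [matrix_mul_apply]
  rcases r with a | r | α
  · rcases s with d | s | β
    · simp [superElt_translation, superElt_scalar, superElt_spinor_vec]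
    · rw [Subsingleton.elim s 0]
      simp only [superElt_translation, superElt_scalar, superElt_spinor_scalar,
        superElt_vec_spinor, Fin.sum_univ_two, Fin.sum_univ_three]
      revert a
      simp only [forall_fin_three, Γlow_entries, add_mul, smul_mul_assoc, mul_neg, h0, h 1 0]
      simp
    · simp [superElt_translation, superElt_scalar, superElt_translation_spinor]
  · rw [Subsingleton.elim r 0]
    simp [superElt_scalar]
  · simp [superElt_spinor_vec, superElt_scalar, superElt_translation_spinor]

variable {e φ dφ : Fin 3 → B} {w : Fin 3 → Fin 3 → B} {ψ χ dχ u : Fin 2 → B}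

set_option maxHeartbeats 2000000 in
/-- The gauge transformation of a potential by an element of the coset, at a point. -/
lemma coset_conj (aw : ∀ a b, w a b = -w b a) (hw : ∀ a b, ∀ x : B, x * w a b = w a b * x)
    (hψχ : ∀ α β, ψ α * χ β = -(χ β * ψ α))
    (hχ : ∀ α β, χ α * χ β = -(χ β * χ α))
    (hu : ∀ α, u α = dχ α + (1 / 4 : ℂ) • ∑ a, ∑ b, ∑ β, Γ₂ a b α β • (w a b * χ β)) :
    (1 + superElt φ 0 (bar χ)) * (superElt e w (bar ψ) * (1 - superElt φ 0 (bar χ)))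
        - (1 + superElt φ 0 (bar χ)) * superElt dφ 0 (bar dχ) =
      superElt (fun a => e a - (dφ a + ∑ b, ∑ c, η c b • (w a c * φ b))
        + (Complex.I / 2) • ∑ α, ∑ β, Γup a α β • (bar χ α * ψ β)
        - (Complex.I / 4) • ∑ α, ∑ β, Γup a α β • (bar χ α * u β)) w
        (bar fun α => ψ α - u α) := by
  have w0 := diag_eq_zero_of_antisymm aw
  have hχ0 α : χ α * χ α = 0 := eq_zero_of_eq_neg_self (hχ α α)
  have hχw α a b x : χ α * (w a b * x) = w a b * (χ α * x) := by
    rw [← mul_assoc, hw, mul_assoc]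
  have hexp (Z a D : Matrix Idx Idx B) : (1 + Z) * (a * (1 - Z)) - (1 + Z) * D =
      a + Z * a - a * Z - Z * (a * Z) - D - Z * D := by noncomm_ring
  rw [hexp]
  ext r s
  simp only [Matrix.sub_apply, Matrix.add_apply, matrix_mul_apply]
  rcases r with a | r | α
  · rcases s with d | s | β
    · simp [superElt_translation, superElt_scalar, superElt_spinor_vec, superElt_lorentz aw]
    · rw [Subsingleton.elim s 0]
      simp only [superElt_translation, superElt_scalar, superElt_spinor_scalar,
        superElt_spinor_vec, superElt_lorentz aw, superElt_vec, superElt_spinor aw,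
        superElt_vec_spinor, Fin.sum_univ_two, Fin.sum_univ_three]
      revert a
      simp only [forall_fin_three, Γlow_entries, η_entries, bar_zero_one, hu, Γup_eq, Γ_entries,
        Γ₂_entries, Γ₂_swap, Γ₂_diag, Matrix.neg_apply, Matrix.zero_apply, Fin.sum_univ_two,
        Fin.sum_univ_three, w0, aw 1 0, aw 2 0, aw 2 1,
        add_mul, mul_add, smul_mul_assoc, mul_smul_comm, mul_neg, neg_mul, mul_zero, zero_mul,
        smul_add, smul_neg, smul_smul, zero_smul, smul_zero, add_zero, zero_add, neg_zero]
      simp only [hχw, hψχ, hχ 1 0, hχ0, mul_zero, mul_neg, smul_neg, smul_zero]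
      refine ⟨?_, ?_, ?_⟩ <;> match_scalars <;> ring_nf <;> norm_num [Complex.I_sq]
    · simp only [superElt_translation, superElt_scalar, superElt_spinor_scalar,
        superElt_spinor_vec, superElt_translation_spinor, superElt_lorentz aw, superElt_vec,
        superElt_spinor aw,
        superElt_vec_spinor, Fin.sum_univ_two, Fin.sum_univ_three]
      revert a β
      simp only [forall_fin_three, Fin.forall_fin_two, Γlow_entries, η_entries, bar_zero_one, hu,
        Γ₂_entries, Γ₂_swap, Γ₂_diag, Matrix.neg_apply, Matrix.zero_apply, Fin.sum_univ_two,
        Fin.sum_univ_three, w0, aw 1 0, aw 2 0, aw 2 1,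
        mul_add, smul_mul_assoc, mul_smul_comm, mul_neg, neg_mul, hw, mul_zero, zero_mul,
        smul_add, smul_neg, smul_smul, zero_smul, smul_zero, add_zero, zero_add, neg_zero, sub_zero]
      refine ⟨⟨?_, ?_⟩, ⟨?_, ?_⟩, ?_, ?_⟩ <;> match_scalars <;> ring_nf
  · rw [Subsingleton.elim r 0]
    simp [superElt_scalar]
  · rcases s with d | s | β
    · simp [superElt_translation, superElt_scalar, superElt_spinor_vec]
    · rw [Subsingleton.elim s 0]
      simp only [superElt_scalar, superElt_spinor_scalar, superElt_spinor_vec,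
        superElt_translation_spinor, superElt_lorentz aw, superElt_vec, superElt_spinor aw,
        superElt_vec_spinor, Fin.sum_univ_two, Fin.sum_univ_three]
      revert α
      simp only [Fin.forall_fin_two, bar_zero_one, hu, Γ₂_entries, Γ₂_swap, Γ₂_diag,
        Matrix.neg_apply, Matrix.zero_apply, Fin.sum_univ_two, Fin.sum_univ_three, w0, aw 1 0,
        aw 2 0, aw 2 1, add_mul, smul_mul_assoc, mul_smul_comm, mul_neg, neg_mul, mul_zero,
        zero_mul, zero_smul, smul_zero, add_zero, zero_add, neg_zero, sub_zero]
      refine ⟨?_, ?_⟩ <;> match_scalars <;> ring_nf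
    · simp [superElt_scalar, superElt_translation_spinor, superElt_spinor_vec, superElt_spinor aw]

end Nilpotent

section Pointwise

variable {M : Type*} [TopologicalSpace M] [ChartedSpace (EuclideanHalfSpace 3) M]
variable {B : Type*} [NormedRing B] [NormedAlgebra ℂ B] {k : ℕ}

lemma bar_form_apply (ψ : Fin 2 → DForm M B k) (α : Fin 2) (x : M) (v : Fin k → E3) :
    bar ψ α x v = bar (fun β => ψ β x v) α := by
  rw [bar, DForm.sum_apply]
  rfl

lemma bar_apply (χ : Fin 2 → M → B) (α : Fin 2) (x : M) :
    bar χ α x = bar (fun β => χ β x) α := by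
  rw [bar, Finset.sum_apply]
  rfl

lemma superElt_apply (p : Fin 3 → DForm M B k) (j : Fin 3 → Fin 3 → DForm M B k)
    (q : Fin 2 → DForm M B k) (r s : Idx) (x : M) (v : Fin k → E3) :
    superElt p j q r s x v =
      superElt (fun a => p a x v) (fun a b => j a b x v) (fun α => q α x v) r s := by
  simp only [superElt, DForm.add_apply, DForm.sum_apply, DForm.smul_apply]

lemma gaugeTransform_apply (g : M → Matrix Idx Idx B) (A : Matrix Idx Idx (DForm M B 1))
    (r s : Idx) (x : M) (v : Fin 1 → E3) : gaugeTransform g A r s x v =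
      (Ring.inverse (g x) * ((Matrix.of fun t u => A t u x v) * g x)
        + Ring.inverse (g x) * Matrix.of fun t u => dFun (fun y => g y t u) x v) r s := by
  simp only [gaugeTransform, DForm.add_apply, DForm.sum_apply, lmul_apply, rmul_apply,
    Matrix.add_apply, Matrix.mul_apply, Matrix.of_apply, Finset.mul_sum]

/-- The differential of a group-valued function `1 - (φ^a P_a + χ̄ Q)`. -/
lemma dFun_one_sub_superElt {φ : Fin 3 → M → B} {χ : Fin 2 → M → B}
    (hφ : ∀ a, ContMDiff (𝓡∂ 3) 𝓘(ℝ, B) ∞ (φ a)) (hχ : ∀ α, ContMDiff (𝓡∂ 3) 𝓘(ℝ, B) ∞ (χ α))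
    (r s : Idx) (x : M) (v : Fin 1 → E3) :
    dFun (fun y => (1 - superElt (fun a => φ a y) 0 (bar fun α => χ α y)) r s) x v =
      -superElt (fun a => dFun (φ a) x v) 0 (bar fun α => dFun (χ α) x v) r s := by
  have h (f : Fin 3 → B) (c : Fin 2 → B) : (1 - superElt f 0 (bar c)) r s =
      (1 : Matrix Idx Idx B) r s + ∑ i, Sum.elim (fun a => -genP a r s)
        (fun β => -∑ α, rowSign r * genQ α r s * chargeConj β α) i • Sum.elim f c i := by
    simp only [Matrix.sub_apply, superElt, bar, Fintype.sum_sum_type, Sum.elim_inl, Sum.elim_inr,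
      Pi.zero_apply, smul_zero, Finset.sum_const_zero, add_zero, Fin.sum_univ_two,
      Fin.sum_univ_three]
    module
  have hs i : ContMDiff (𝓡∂ 3) 𝓘(ℝ, B) ∞ (Sum.elim φ χ i) := by
    rcases i with a | α
    exacts [hφ a, hχ α]
  have h1 : (fun y => (1 - superElt (fun a => φ a y) 0 (bar fun α => χ α y)) r s) = fun y =>
      (1 : Matrix Idx Idx B) r s + ∑ i, Sum.elim (fun a => -genP a r s)
        (fun β => -∑ α, rowSign r * genQ α r s * chargeConj β α) i • Sum.elim φ χ i y := by
    funext y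
    rw [h]
    simp only [Fintype.sum_sum_type, Sum.elim_inl, Sum.elim_inr]
  rw [h1, dFun_affine hs]
  have h2 := h (fun a => dFun (φ a) x v) (fun α => dFun (χ α) x v)
  rw [Matrix.sub_apply, sub_eq_add_neg, add_right_inj] at h2
  rw [h2]
  simp only [Fintype.sum_sum_type, Sum.elim_inl, Sum.elim_inr]

lemma bar_anticomm {χ : Fin 2 → B} (h : ∀ α β, χ α * χ β = -(χ β * χ α)) (α β : Fin 2) :
    bar χ α * bar χ β = -(bar χ β * bar χ α) := by
  revert α β
  simp only [Fin.forall_fin_two, bar_zero_one, mul_neg, neg_mul, smul_mul_assoc, mul_smul_comm,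
    neg_neg, h 1 0, smul_neg]
  have h0 α : χ α * χ α = 0 := eq_zero_of_eq_neg_self (h α α)
  simp [h0]

end Pointwise

namespace Fields

variable {M : Type*} [TopologicalSpace M] [ChartedSpace (EuclideanHalfSpace 3) M]
variable {B : Type*} [NormedRing B] [NormedAlgebra ℂ B]
variable {𝒜 : ZMod 2 → Submodule ℂ B} (Φ : Fields M 𝒜)

lemma χ_anticomm (h𝒜 : IsSupercommutative 𝒜) (x : M) (α β : Fin 2) :
    Φ.χ α x * Φ.χ β x = -(Φ.χ β x * Φ.χ α x) :=
  h𝒜.odd_anticomm _ (Φ.odd_χ α x) _ (Φ.odd_χ β x)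

lemma translation_sq (h𝒜 : IsSupercommutative 𝒜) (p p' : Fin 3 → B) (x : M) :
    superElt p 0 (bar fun α => Φ.χ α x) * superElt p' 0 (bar fun α => Φ.χ α x) = 0 :=
  translation_mul_translation (bar_anticomm (Φ.χ_anticomm h𝒜 x))

/-- The coset element is affine in the fields, as products of translations and supertranslations
vanish. -/
lemma coset_eq (h𝒜 : IsSupercommutative 𝒜) (x : M) :
    Φ.coset x = 1 - superElt (fun a => Φ.φ a x) 0 (bar fun α => Φ.χ α x) := by
  have hX := Φ.translation_sq h𝒜 0 0 x
  have hY : superElt (fun a => Φ.φ a x) 0 (0 : Fin 2 → B)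
      * superElt (fun a => Φ.φ a x) 0 (0 : Fin 2 → B) = 0 :=
    translation_mul_translation fun _ _ => by simp
  have hXY : superElt 0 0 (bar fun α => Φ.χ α x)
      * superElt (fun a => Φ.φ a x) 0 (0 : Fin 2 → B) = 0 :=
    translation_mul_translation fun _ _ => by simp
  have hadd (p : Fin 3 → B) (q : Fin 2 → B) :
      superElt 0 0 q + superElt p 0 0 = superElt p 0 q := by
    refine ((superEltL B).map_add (0, 0, q) (p, 0, 0)).symm.trans ?_
    simp only [superEltL_apply, Prod.mk_add_mk, zero_add, add_zero]
  change NormedSpace.exp (-superElt 0 0 (bar fun α => Φ.χ α x))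
    * NormedSpace.exp (-superElt (fun a => Φ.φ a x) 0 (0 : Fin 2 → B)) = _
  rw [exp_eq_one_add_of_mul_self_eq_zero (by rw [neg_mul_neg, hX]),
    exp_eq_one_add_of_mul_self_eq_zero (by rw [neg_mul_neg, hY])]
  have h4 (X Y : Matrix Idx Idx B) (h : X * Y = 0) : (1 + -X) * (1 + -Y) = 1 - (X + Y) := by
    noncomm_ring [h]
  exact (h4 _ _ hXY).trans (congrArg (1 - ·) (hadd _ _))

/-- The nonlinear gauge potential. -/
lemma nonlinearPotential_eq (h𝒜 : IsSupercommutative 𝒜) :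
    Φ.nonlinearPotential = superElt Φ.V Φ.W (bar Φ.Ψ) := by
  refine Matrix.ext fun r s => DForm.ext_apply (M := M) (B := B) fun x v => ?_
  have hg : Φ.coset = fun y => 1 - superElt (fun a => Φ.φ a y) 0 (bar fun α => Φ.χ α y) :=
    funext (Φ.coset_eq h𝒜)
  rw [nonlinearPotential, gaugeTransform_apply, hg, inverse_one_sub_of_mul_self_eq_zero
    (Φ.translation_sq h𝒜 _ _ x)]
  have hd : (Matrix.of (α := B) fun t u => dFun (fun y : M =>
      ((1 : Matrix Idx Idx B) - superElt (fun a => Φ.φ a y) 0 (bar fun α => Φ.χ α y)) t u) x v) =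
      -superElt (fun a => dFun (Φ.φ a) x v) 0 (bar fun α => dFun (Φ.χ α) x v) :=
    Matrix.ext fun t u => dFun_one_sub_superElt Φ.smooth_φ Φ.smooth_χ t u x v
  have ha : (Matrix.of (α := B) fun t u => Φ.gaugePotential t u x v) =
      superElt (fun a => Φ.e a x v) (fun a b => Φ.w a b x v) (bar fun α => Φ.ψ α x v) :=
    Matrix.ext fun t u => (superElt_apply _ _ _ t u x v).trans (by simp only [bar_form_apply])
  rw [hd, ha, mul_neg, ← sub_eq_add_neg, coset_conj (u := fun α => covDSpinor Φ.w Φ.χ α x v)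
    (fun a b => by rw [Φ.antisymm_w a b]; rfl)
    (fun a b y => (h𝒜.even_comm _ (Φ.even_w a b x v) y).symm)
    (fun α β => h𝒜.odd_anticomm _ (Φ.odd_ψ α x v) _ (Φ.odd_χ β x)) (Φ.χ_anticomm h𝒜 x)
    (fun α => by simp only [covDSpinor, DForm.add_apply, DForm.sum_apply, DForm.smul_apply,
      rmul_apply]), superElt_apply]
  simp only [bar_form_apply, V, W, Ψ, covDVec, DForm.add_apply, DForm.sub_apply, DForm.sum_apply,
    DForm.smul_apply, rmul_apply, lmul_apply, bar_apply]

end Fields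

end TopSugra

end

theorem mainTheorem2 {M : Type*} [TopologicalSpace M] [T2Space M] [CompactSpace M]
    [ChartedSpace (EuclideanHalfSpace 3) M] [IsManifold (𝓡∂ 3) ∞ M] (O : OrientedAtlas M)
    {B : Type*} [NormedRing B] [NormedAlgebra ℂ B] [CompleteSpace B]
    (𝒜 : ZMod 2 → Submodule ℂ B) [GradedAlgebra 𝒜] (h𝒜 : IsSupercommutative 𝒜)
    (κ : ℂ) (Φ : Fields M 𝒜) :
    -- the Chern–Simons action of the linear potential is that of three-dimensional supergravity
    integral O (κ • chernSimons Φ.gaugePotential) =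
        κ • integral O Φ.supergravityLagrangian
          - (κ / 2) • bdryIntegral O
              (∑ a, ∑ b, ∑ c, ε a b c • wedge (Φ.w a b) (Φ.e c)) ∧
    -- the nonlinear gauge fields that come from the coset element
    Φ.nonlinearPotential = superElt Φ.V Φ.W (bar Φ.Ψ) ∧
    -- the transgression action as a difference of Chern–Simons actions with a boundary term
    transgressionAction O κ Φ.gaugePotential Φ.nonlinearPotential =
        integral O (κ • chernSimons Φ.gaugePotential)
          - integral O (κ • chernSimons Φ.nonlinearPotential)
          - κ • bdryIntegral O (boundaryForm Φ.gaugePotential Φ.nonlinearPotential) ∧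
    -- the transgression action collapses to the action of two-dimensional topological supergravity
    transgressionAction O κ Φ.gaugePotential Φ.nonlinearPotential =
        κ • bdryIntegral O Φ.topologicalLagrangian := by
  have hX := Φ.isPotential
  have hY := Φ.isPotential_nonlinear h𝒜
  have hnl := Φ.nonlinearPotential_eq h𝒜
  have hsm : IsSmoothForm (∑ a, ∑ b, ∑ c, ε a b c • wedge (Φ.w a b) (Φ.e c)) :=
    IsSmoothForm.sum _ fun a => IsSmoothForm.sum _ fun b => IsSmoothForm.sum _ fun c =>
      ((Φ.smooth_w a b).wedge (Φ.smooth_e c)).smul _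
  have hsugra := Φ.chernSimons_eq h𝒜
  have hL : IsSmoothForm Φ.supergravityLagrangian := by
    rw [eq_sub_iff_add_eq] at hsugra
    rw [← hsugra]
    exact (smooth_chernSimons hX).add (hsm.extD.smul _)
  refine ⟨?_, hnl, ?_, ?_⟩
  · rw [integral_smul, hsugra, integral_sub O hL (hsm.extD.smul _), integral_smul,
      integral_extD O hsm, smul_sub, smul_smul, mul_one_div]
  · have h := transgression_eq_sub h𝒜 hX hY
    have hs := smooth_boundaryForm hX hY
    have h1 := smooth_chernSimons hX
    have h2 := smooth_chernSimons hY
    have hA : superEltL _ (Φ.e, Φ.w, bar Φ.ψ) = Φ.gaugePotential := rfl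
    have hB : superEltL _ (Φ.V, Φ.W, bar Φ.Ψ) = Φ.nonlinearPotential := hnl.symm
    rw [hA, hB] at h hs
    rw [hA] at h1
    rw [hB] at h2
    rw [transgressionAction, integral_smul, h, integral_sub O (h1.sub h2) hs.extD,
      integral_sub O h1 h2, integral_extD O hs, integral_smul, integral_smul, smul_sub, smul_sub]
  · rw [transgressionAction, integral_smul, hnl, Φ.transgression_eq_extD h𝒜,
      integral_extD O (Φ.smooth_topologicalLagrangian h𝒜)]
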